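/- Let $\zeta,\zeta_1,\zeta_2,\dots$ be i.i.d. with law $\Pi$, let $u,u_1,u_2,\dots$ be i.i.d. $N(0,I_d)$ vectors independent of the $\zeta$'s, and let $F:\mathbb R^d\times\mathcal Z\to\mathbb R$, $f(x)=\mathbb E[F(x,\zeta)]$, with minimizer $x^*$. Gradients and Hessians are in $x$, and matrix norms are operator norms. Assume: 1. for some $\sigma$ and all $x$: $F(x,\zeta)$ is integrable, $\mathbb E[\nabla F(x,\zeta)]=\nabla f(x)$ and $\mathbb E\|\nabla F(x,\zeta)-\nabla f(x)\|^2\le\sigma^2$; 2. $f$ is $C^2$ with $\mu I\preceq\nabla^2 f(x)\preceq L I$ for all $x$, for some $\mu,L>0$; 3. $F(\cdot,z)$ is $C^1$ for every $z$, and for some $K_0$ and all $x$, $\mathbb E\|\nabla F(x,\zeta)-\nabla f(x)\|^2+\|\nabla f(x)\|^2\le K_0(1+\|x-x^*\|^2)$; 4. $F(\cdot,z)$ is twice differentiable and $\|\nabla^2F(x,z)\|\le H(z)$ for all $x,z$, where $\mathbb E[H(\zeta)^4]<\infty$; 5. $\mathbb E\|\nabla F(x^*,\zeta)\|^4<\infty$.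 For $\nu>0$ put $G_\nu(x,z,u)=\frac{F(x+\nu u,z)-F(x,z)}{\nu}\,u$ and $f_\nu(x)=\mathbb E[F(x+\nu u,\zeta)]$. Let $\tfrac12<\alpha<1$, $\eta>0$, $\eta_i=\eta i^{-\alpha}$, and let $x_0\in\mathbb R^d$, $$x_i=x_{i-1}-\eta_iG_\nu(x_{i-1},\zeta_i,u_i),\qquad \bar x_n=\frac1n\sum_{i=0}^{n-1}x_i .$$ Let $\beta>\frac1{1-\alpha}$ and $C>0$, and let $a_1=1$, $a_k=\lfloor Ck^\beta\rfloor$ for $k\ge2$; $C$ is such that $(a_k)_{k\ge1}$ is strictly increasing. For $a_m\le i<a_{m+1}$ let $t_i=a_m$ and $l_i=i-t_i+1$, and set $$\widehat\Sigma_n=\Big(\sum_{i=1}^n l_i\Big)^{-1}\sum_{i=1}^n\Big(\sum_{k=t_i}^i x_k-l_i\bar x_n\Big)\Big(\sum_{k=t_i}^i x_k-l_i\bar x_n\Big)^{T}.$$ Then there is a constant $K>0$, independent of $\nu$, $n$ and $M$, such that the following holds for every $\nu>0$. The function $f_\nu$ has a unique minimizer $x_\nu^*$. Let $$S_\nu=\mathbb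 E[G_\nu(x_\nu^*,\zeta,u)G_\nu(x_\nu^*,\zeta,u)^T],\quad \tilde V=(\nabla^2f_\nu(x_\nu^*))^{-1}S_\nu(\nabla^2f_\nu(x_\nu^*))^{-1},\quad \tilde H=\|uu^T\|H(\zeta),$$ $$\tilde\Sigma_1=4\sqrt{\mathbb E\|G_\nu(x_\nu^*,\zeta,u)\|^2\,\mathbb E\tilde H^2},\quad \tilde\Sigma_2=4\,\mathbb E\tilde H^2,\quad \tilde\Sigma_3=8\,\mathbb E\|G_\nu(x_\nu^*,\zeta,u)\|^4,\quad \tilde\Sigma_4=128\,\mathbb E\tilde H^4,$$ $$C_d=\max\{L,\tilde\Sigma_1^{2/3},\tilde\Sigma_2^{1/2},\tilde\Sigma_3^{1/2},\tilde\Sigma_4^{1/4},\operatorname{tr}S_\nu\}.$$ Then $\mathbb E\|\widehat\Sigma_n-\tilde V\|<\infty$ for every $n$, and for all sufficiently large $M$ (how large may depend on $\nu$) and all $n$ with $a_M\le n<a_{M+1}$, $$\mathbb E\|\widehat\Sigma_n-\tilde V\|\le K\Big(\sqrt{1+\tilde\Sigma_1+C_d^3+\nu+(\nu+\nu^2+\nu^3)\tilde\Sigma_1}\;M^{-\frac{\alpha\beta}4}+\sqrt{1+\nu^2+\nu^4}\;M^{-\frac12}+\sqrt{1+\nu+\nu^2}\;M^{\frac{(\alpha-1)\beta+1}2}\Big).$$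 Hence $\mathbb E\|\widehat\Sigma_n-\tilde V\|\to0$ as $n\to\infty$, and $\widehat\Sigma_n$ is a consistent estimator of $\tilde V$, that is, $\widehat\Sigma_n\to\tilde V$ in probability. -/

import Mathlib

open MeasureTheory ProbabilityTheory Filter Topology

namespace ZOSGD

noncomputable section

/-- `ℝ^d` with the Euclidean norm. -/
abbrev Vec (d : ℕ) : Type := EuclideanSpace ℝ (Fin d)

/-- `d × d` real matrices as linear operators on `ℝ^d`; the norm is the operator norm. -/
abbrev Mat (d : ℕ) : Type := Vec d →L[ℝ] Vec d

/-- The outer product `v vᵀ`. -/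
def outer {d : ℕ} (v : Vec d) : Mat d := InnerProductSpace.rankOne ℝ v v

/-- The Hessian `∇²g(x)`, the derivative of the gradient of `g` at `x`. -/
def hessian {d : ℕ} (g : Vec d → ℝ) (x : Vec d) : Mat d := fderiv ℝ (gradient g) x

/-- The gradient `∇F(x, z)` in the first variable. -/
def gradF {d : ℕ} {Z : Type*} (F : Vec d → Z → ℝ) (x : Vec d) (z : Z) : Vec d :=
  gradient (fun y => F y z) x

/-- The objective `f(x) = E[F(x, ζ)]`, where `ζ` has law `Q`. -/
def objective {d : ℕ} {Z : Type*} [MeasurableSpace Z] (F : Vec d → Z → ℝ) (Q : Measure Z)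
    (x : Vec d) : ℝ := ∫ z, F x z ∂Q

/-- The joint law of `(ζ, u)`: `ζ` has law `Q`, and `u` is standard Gaussian and independent of
`ζ`. -/
def noiseLaw (d : ℕ) {Z : Type*} [MeasurableSpace Z] (Q : Measure Z) : Measure (Z × Vec d) :=
  Q.prod (stdGaussian (Vec d))

/-- The surrogate objective `f_ν(x) = E[F(x + ν u, ζ)]`. -/
def surrogate {d : ℕ} {Z : Type*} [MeasurableSpace Z] (F : Vec d → Z → ℝ) (Q : Measure Z)
    (ν : ℝ) (x : Vec d) : ℝ := ∫ p, F (x + ν • p.2) p.1 ∂(noiseLaw d Q)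

/-- The two-point gradient estimator `G_ν(x, z, u) = ((F(x + ν u, z) - F(x, z)) / ν) u`. -/
def gradEst {d : ℕ} {Z : Type*} (F : Vec d → Z → ℝ) (ν : ℝ) (x : Vec d) (z : Z) (u : Vec d) :
    Vec d := ((F (x + ν • u) z - F x z) / ν) • u

/-- The stochastic zeroth-order oracle is unbiased, for the function and for its gradient, and
its gradient has variance at most `σ²`. -/
structure UnbiasedOracle {d : ℕ} {Z : Type*} [MeasurableSpace Z] (F : Vec d → Z → ℝ)
    (Q : Measure Z) (σ : ℝ) : Prop where
  measurable : ∀ x, Measurable (F x)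
  integrable : ∀ x, Integrable (F x) Q
  gradient_memLp : ∀ x, MemLp (gradF F x) 2 Q
  gradient_mean : ∀ x, ∫ z, gradF F x z ∂Q = gradient (objective F Q) x
  gradient_variance : ∀ x, ∫ z, ‖gradF F x z - gradient (objective F Q) x‖ ^ 2 ∂Q ≤ σ ^ 2

/-- `f` is twice continuously differentiable and `μ I ≤ ∇²f(x) ≤ L I` for every `x`. -/
structure SmoothStronglyConvex {d : ℕ} (f : Vec d → ℝ) (μ L : ℝ) : Prop where
  mu_pos : 0 < μ
  L_pos : 0 < L
  contDiff : ContDiff ℝ 2 f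
  lower : ∀ x v, μ * ‖v‖ ^ 2 ≤ inner ℝ (hessian f x v) v
  upper : ∀ x v, inner ℝ (hessian f x v) v ≤ L * ‖v‖ ^ 2

/-- `F(·, z)` is continuously differentiable, and the second moment of the gradient noise and the
squared norm of the gradient grow at most quadratically around the minimizer `xstar`. -/
structure GradientNoise {d : ℕ} {Z : Type*} [MeasurableSpace Z] (F : Vec d → Z → ℝ)
    (Q : Measure Z) (xstar : Vec d) : Prop where
  contDiff : ∀ z, ContDiff ℝ 1 (fun x => F x z)
  growth : ∃ K : ℝ, ∀ x, (∫ z, ‖gradF F x z - gradient (objective F Q) x‖ ^ 2 ∂Q)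
    + ‖gradient (objective F Q) x‖ ^ 2 ≤ K * (1 + ‖x - xstar‖ ^ 2)

/-- `‖∇²F(x, z)‖ ≤ H(z)` for every `x`, where `H(ζ)` has a finite fourth moment. -/
structure HessianEnvelope {d : ℕ} {Z : Type*} [MeasurableSpace Z] (F : Vec d → Z → ℝ)
    (Q : Measure Z) (H : Z → ℝ) : Prop where
  differentiable : ∀ z, Differentiable ℝ (gradient (fun x => F x z))
  bound : ∀ z x, ‖hessian (fun y => F y z) x‖ ≤ H z
  memLp : MemLp H 4 Q

/-- The random inputs: the pairs `(ζ_i, u_i)` are independent over `i`, each with the joint law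
of `ζ ∼ Q` and an independent standard Gaussian vector `u`. -/
structure IIDInputs {d : ℕ} {Z Ω : Type*} [MeasurableSpace Z] [MeasurableSpace Ω]
    (P : Measure Ω) (Q : Measure Z) (ζ : ℕ → Ω → Z) (u : ℕ → Ω → Vec d) : Prop where
  measurable_noise : ∀ i, Measurable (ζ i)
  measurable_gauss : ∀ i, Measurable (u i)
  law : ∀ i, P.map (fun ω => (ζ i ω, u i ω)) = noiseLaw d Q
  indep : iIndepFun (fun i ω => (ζ i ω, u i ω)) P

/-- The iterates `x_i = x_{i-1} - η_i G_ν(x_{i-1}, ζ_i, u_i)` with `η_i = η i^{-α}`. -/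
def iterate {d : ℕ} {Z Ω : Type*} (F : Vec d → Z → ℝ) (ν η α : ℝ) (x0 : Vec d)
    (ζ : ℕ → Ω → Z) (u : ℕ → Ω → Vec d) : ℕ → Ω → Vec d
  | 0, _ => x0
  | i + 1, ω =>
      iterate F ν η α x0 ζ u i ω
        - (η * ((i + 1 : ℕ) : ℝ) ^ (-α)) •
          gradEst F ν (iterate F ν η α x0 ζ u i ω) (ζ (i + 1) ω) (u (i + 1) ω)

/-- The first index of the `k`-th batch: `a_1 = 1` and `a_k = ⌊C k^β⌋` for `k ≥ 2`. -/
def batchStart (C β : ℝ) (k : ℕ) : ℕ := if k = 1 then 1 else ⌊C * (k : ℝ) ^ β⌋₊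

/-- `t_i`, the first index of the batch that contains `i`: `t_i = a_m` for the largest `m` with
`a_m ≤ i`. -/
def blockStart (C β : ℝ) (i : ℕ) : ℕ :=
  batchStart C β (Nat.findGreatest (fun m => batchStart C β m ≤ i) i)

/-- `l_i = i - t_i + 1`. -/
def blockLen (C β : ℝ) (i : ℕ) : ℕ := i - blockStart C β i + 1

/-- The averaged iterate `(1/n) ∑_{i=0}^{n-1} x_i` of a sequence. -/
def average {d : ℕ} (x : ℕ → Vec d) (n : ℕ) : Vec d :=
  (n : ℝ)⁻¹ • ∑ i ∈ Finset.range n, x i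

/-- The online batch-means covariance estimator `Σ̂_n` of a sequence of iterates. -/
def covEst {d : ℕ} (C β : ℝ) (x : ℕ → Vec d) (n : ℕ) : Mat d :=
  (∑ i ∈ Finset.Icc 1 n, (blockLen C β i : ℝ))⁻¹ •
    ∑ i ∈ Finset.Icc 1 n,
      outer ((∑ k ∈ Finset.Icc (blockStart C β i) i, x k)
        - (blockLen C β i : ℝ) • average x n)

section Constants

variable {d : ℕ} {Z : Type*} [MeasurableSpace Z] (F : Vec d → Z → ℝ) (Q : Measure Z)

/-- `S_ν = E[G_ν(y, ζ, u) G_ν(y, ζ, u)ᵀ]`, used at the minimizer `y` of `f_ν`. -/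
def gradCov (ν : ℝ) (y : Vec d) : Mat d :=
  ∫ p, outer (gradEst F ν y p.1 p.2) ∂(noiseLaw d Q)

/-- `Ṽ = (∇²f_ν(y))⁻¹ S_ν (∇²f_ν(y))⁻¹`, used at the minimizer `y` of `f_ν`. -/
def asympCov (ν : ℝ) (y : Vec d) : Mat d :=
  (hessian (surrogate F Q ν) y).inverse ∘L gradCov F Q ν y ∘L
    (hessian (surrogate F Q ν) y).inverse

/-- `H̃(z, u) = ‖u uᵀ‖ H(z)`, which bounds the Jacobian of `G_ν(·, z, u)`. -/
def envelope (H : Z → ℝ) (p : Z × Vec d) : ℝ := ‖outer p.2‖ * H p.1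

/-- `Σ̃₁ = 4 √(E‖G_ν(y, ζ, u)‖² E H̃(ζ, u)²)`. -/
def sigma1 (H : Z → ℝ) (ν : ℝ) (y : Vec d) : ℝ :=
  4 * √((∫ p, ‖gradEst F ν y p.1 p.2‖ ^ 2 ∂(noiseLaw d Q))
    * ∫ p, envelope (d := d) H p ^ 2 ∂(noiseLaw d Q))

/-- `Σ̃₂ = 4 E H̃(ζ, u)²`. -/
def sigma2 (d : ℕ) (H : Z → ℝ) : ℝ := 4 * ∫ p, envelope (d := d) H p ^ 2 ∂(noiseLaw d Q)

/-- `Σ̃₃ = 8 E‖G_ν(y, ζ, u)‖⁴`. -/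
def sigma3 (ν : ℝ) (y : Vec d) : ℝ :=
  8 * ∫ p, ‖gradEst F ν y p.1 p.2‖ ^ 4 ∂(noiseLaw d Q)

/-- `Σ̃₄ = 128 E H̃(ζ, u)⁴`. -/
def sigma4 (d : ℕ) (H : Z → ℝ) : ℝ := 128 * ∫ p, envelope (d := d) H p ^ 4 ∂(noiseLaw d Q)

/-- `C_d = max {L, Σ̃₁^{2/3}, Σ̃₂^{1/2}, Σ̃₃^{1/2}, Σ̃₄^{1/4}, tr S_ν}`. -/
def constCd (L : ℝ) (H : Z → ℝ) (ν : ℝ) (y : Vec d) : ℝ :=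
  max L (max (sigma1 F Q H ν y ^ (2 / 3 : ℝ)) (max (sigma2 Q d H ^ (1 / 2 : ℝ))
    (max (sigma3 F Q ν y ^ (1 / 2 : ℝ)) (max (sigma4 Q d H ^ (1 / 4 : ℝ))
      (LinearMap.trace ℝ (Vec d) (gradCov F Q ν y).toLinearMap)))))

/-- The error rate after `M` batches, with the minimizer `y` of `f_ν`. -/
def rate (L : ℝ) (H : Z → ℝ) (α β ν : ℝ) (y : Vec d) (M : ℕ) : ℝ :=
  √(1 + sigma1 F Q H ν y + constCd F Q L H ν y ^ 3 + ν
      + (ν + ν ^ 2 + ν ^ 3) * sigma1 F Q H ν y) * (M : ℝ) ^ (-(α * β / 4))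
    + √(1 + ν ^ 2 + ν ^ 4) * (M : ℝ) ^ (-(1 / 2 : ℝ))
    + √(1 + ν + ν ^ 2) * (M : ℝ) ^ (((α - 1) * β + 1) / 2)

end Constants

end

end ZOSGD

namespace ZOSGD

/-! Put `g = ∇f_ν`, `A = ∇²f_ν(x_ν)` and `D_k = x_k - x_ν`. Gaussian integration by parts shows that
`G_ν` is an unbiased estimator of `g`, and that `∇²f_ν` is Lipschitz with constant `L E‖u‖ / ν`, so
near `x_ν` the recursion is linear up to a quadratic error. Strong monotonicity of `g` gives
`E‖D_k‖⁴ = O(k^(-2α))` (`Iterates.exists_fourth_moment_le`).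

For a test vector `v` take `p = A⁻¹v`. Along `p` the recursion reads `⟨p, D_{k+1}⟩ = ⟨p, D_k⟩ -
η_{k+1} (⟨v, D_k⟩ + r_k + δ_k + ξ_k)` with i.i.d. innovations `ξ_k = ⟨p, G_ν(x_ν, ζ_{k+1},
u_{k+1})⟩`, small martingale perturbations `δ_k` and quadratic remainders `r_k`. Solving for `⟨v,
D_k⟩` and summing by parts over a block cut at `i` gives `-S_i` plus boundary terms and small terms,
`S_i` being the sum of the innovations in the cut block. Since `E ξ_k² = ⟨v, Ṽ v⟩`, the mean of
`S_i²` is `l_i ⟨v, Ṽ v⟩`, and the error of the estimator is `∑ (S_i² - l_i ⟨v, Ṽ v⟩)`, divided by `∑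
l_i`, plus corrections.

With block lengths at most `lam`, that main sum is a martingale of size `√(E ξ⁴) lam^(3/2) n^(1/2)`,
and centring at the empirical mean costs the same order. After division by `∑ l_i` this is
`M^(-1/2)`. Every other contribution is collected in `rest`, and its exponent of `M` is strictly
below one of the exponents of the claimed rate. This is why `K` does not depend on `ν`: only the
constant of the leading term has to be tracked, and it is at most a multiple of `√(E‖G_ν(x_ν)‖⁴) ≤
const (1 + ν)²`, because `‖x_ν - x*‖ = O(ν)` (`SmoothStronglyConvex.norm_sub_min_le`,
`integral_norm_gradEst_pow_le`). The other constants may depend on `ν` in any way; they are absorbed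
once `M` is large.

The delicate correction is the product of `S_i` with the boundary term `η_{i+1}⁻¹ ⟨p, D_{i+1}⟩`.
Cauchy-Schwarz would give exactly the order of the third term of the rate, with an uncontrolled
constant. The order is improved by viewing `⟨p, D⟩` as the drift of the recursion along `q = A⁻¹p`
and summing by parts once more (`exists_l1le_blockSum_mul_increment`,
`exists_l1le_blockSum_mul_end`). `exists_l1le_batchMeans` assembles the estimate of a quadratic
form, polarisation passes to the operator norm (`Iterates.exists_l1le_covEst`), and
`exists_batch_bounds` turns it into powers of `M`. -/

/-! ### Gaussian integration by parts. -/

lemma hasDerivAt_gaussianPDFReal_std (t : ℝ) :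
    HasDerivAt (gaussianPDFReal 0 1) (-t * gaussianPDFReal 0 1 t) t := by
  rw [gaussianPDFReal_def]
  have h : HasDerivAt (fun x : ℝ => -(x - 0) ^ 2 / (2 * ((1 : NNReal) : ℝ))) (-t) t := by
    have := ((hasDerivAt_id t).pow 2).neg.div_const 2
    convert! this using 1
    · ext x; simp
    · simp; ring
  have := (h.exp).const_mul (√(2 * Real.pi * ((1 : NNReal) : ℝ)))⁻¹
  convert! this using 1
  ring

lemma integrable_gaussianReal_iff {f : ℝ → ℝ} :
    Integrable f (gaussianReal 0 1) ↔ Integrable (fun t => gaussianPDFReal 0 1 t * f t) := by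
  rw [gaussianReal_of_var_ne_zero _ one_ne_zero,
    integrable_withDensity_iff_integrable_smul' (measurable_gaussianPDF _ _)
      (ae_of_all _ fun _ => gaussianPDF_lt_top)]
  simp [toReal_gaussianPDF]

/-- Gaussian integration by parts on the line. -/
lemma stein_real {φ φ' : ℝ → ℝ} (hφ : ∀ t, HasDerivAt φ (φ' t) t)
    (h0 : Integrable φ (gaussianReal 0 1)) (h1 : Integrable φ' (gaussianReal 0 1))
    (h2 : Integrable (fun t => φ t * t) (gaussianReal 0 1)) :
    ∫ t, φ t * t ∂(gaussianReal 0 1) = ∫ t, φ' t ∂(gaussianReal 0 1) := by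
  rw [integrable_gaussianReal_iff] at h0 h1 h2
  rw [integral_gaussianReal_eq_integral_smul one_ne_zero,
    integral_gaussianReal_eq_integral_smul one_ne_zero]
  have := integral_mul_deriv_eq_deriv_mul_of_integrable (u := gaussianPDFReal 0 1)
    (u' := fun t => -t * gaussianPDFReal 0 1 t) (v := φ) (v' := φ')
    (fun x _ => hasDerivAt_gaussianPDFReal_std x) (fun x _ => hφ x) h1
    (by convert! h2.neg using 1; ext t; simp; ring) h0
  simp only [smul_eq_mul]
  rw [this, ← integral_neg]
  congr 1; ext t; ring

/-- A Gaussian measure has moments of every order, so polynomial growth of any degree is integrable.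
-/
lemma integrable_of_sq_growth {E G : Type*} [NormedAddCommGroup E] [NormedSpace ℝ E]
    [MeasurableSpace E] [BorelSpace E] [SecondCountableTopology E] [CompleteSpace E]
    [NormedAddCommGroup G] {γ : Measure E} [IsGaussian γ] {φ : E → G}
    (hm : AEStronglyMeasurable φ γ) {c : ℝ} (N : ℕ) (hN : N ≠ 0)
    (hb : ∀ x, ‖φ x‖ ≤ c * (1 + ‖x‖) ^ N) : Integrable φ γ := by
  have h : MemLp (fun x : E => 1 + ‖x‖) N γ :=
    (memLp_const (1 : ℝ)).add (IsGaussian.memLp_id γ N (by simp)).norm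
  have h1 := (h.integrable_norm_pow hN).const_mul c
  refine h1.mono' hm (ae_of_all _ fun x => ?_)
  simpa [abs_of_nonneg (show (0:ℝ) ≤ 1 + ‖x‖ by positivity)] using hb x

/-- Gaussian integration by parts in `ℝ^d`, along a coordinate direction. -/
lemma stein_coord {d : ℕ} (j : Fin d) {φ : Vec d → ℝ} (hφ : ContDiff ℝ 1 φ) {c : ℝ}
    (h0 : ∀ x, ‖φ x‖ ≤ c * (1 + ‖x‖) ^ 2) (h1 : ∀ x, ‖fderiv ℝ φ x‖ ≤ c * (1 + ‖x‖) ^ 2) :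
    ∫ u, φ u * u j ∂(stdGaussian (Vec d))
      = ∫ u, fderiv ℝ φ u (EuclideanSpace.single j 1) ∂(stdGaussian (Vec d)) := by
  -- The dimension is positive because `j` exists; the successor form lets coordinate `j` be split
  -- off.
  obtain ⟨n, rfl⟩ : ∃ n, d = n + 1 := ⟨d - 1, by have := j.2; omega⟩
  have hd : Continuous (fderiv ℝ φ) := hφ.continuous_fderiv one_ne_zero
  have hc0 : 0 ≤ c := by have := (norm_nonneg _).trans (h0 0); simpa using this
  have i0 : Integrable φ (stdGaussian (Vec (n + 1))) :=
    integrable_of_sq_growth hφ.continuous.aestronglyMeasurable 2 two_ne_zero h0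
  have i1 : Integrable (fun u => fderiv ℝ φ u (EuclideanSpace.single j 1))
      (stdGaussian (Vec (n + 1))) := by
    refine integrable_of_sq_growth (c := c) (by fun_prop) 2 two_ne_zero fun x => ?_
    refine (ContinuousLinearMap.le_opNorm _ _).trans ?_
    simpa using h1 x
  have i2 : Integrable (fun u => φ u * u j) (stdGaussian (Vec (n + 1))) := by
    refine integrable_of_sq_growth (c := c) (by have := hφ.continuous; fun_prop) 3 (by norm_num)
      fun x => ?_
    rw [norm_mul, pow_succ, ← mul_assoc]
    gcongr
    · exact h0 x
    · exact (PiLp.norm_apply_le x j).trans (by linarith [norm_nonneg x])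
  let γ : Measure ℝ := gaussianReal 0 1
  let e := MeasurableEquiv.piFinSuccAbove (fun _ : Fin (n + 1) => ℝ) j
  have he : MeasurePreserving e.symm (γ.prod (Measure.pi fun _ => γ)) (Measure.pi fun _ => γ) :=
    (measurePreserving_piFinSuccAbove (fun _ : Fin (n + 1) => γ) j).symm
  have hT : MeasurePreserving (fun p => (WithLp.toLp 2 (e.symm p) : Vec (n + 1)))
      (γ.prod (Measure.pi fun _ => γ)) (stdGaussian (Vec (n + 1))) := by
    have h2 : MeasurePreserving (WithLp.toLp 2 : (Fin (n + 1) → ℝ) → Vec (n + 1))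
      (Measure.pi fun _ => γ) (stdGaussian (Vec (n + 1))) :=
      ⟨by fun_prop, map_pi_eq_stdGaussian⟩
    exact h2.comp he
  -- Fubini with `t` the coordinate `j` and `y` the others; the formula on the line is then applied
  -- for almost every fixed `y`.
  have key : ∀ g : Vec (n + 1) → ℝ, Integrable g (stdGaussian (Vec (n + 1))) →
      (∫ u, g u ∂(stdGaussian (Vec (n + 1)))
        = ∫ y, ∫ t, g (WithLp.toLp 2 (e.symm (t, y))) ∂γ ∂(Measure.pi fun _ => γ)) ∧
      ∀ᵐ y ∂(Measure.pi fun _ : Fin n => γ),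
        Integrable (fun t => g (WithLp.toLp 2 (e.symm (t, y)))) γ := by
    intro g hg
    have hg' := hT.integrable_comp_of_integrable hg
    refine ⟨?_, hg'.prod_left_ae⟩
    rw [← hT.map_eq, integral_map hT.measurable.aemeasurable
      (by rw [hT.map_eq]; exact hg.aestronglyMeasurable)]
    exact integral_prod_symm _ hg'
  rw [(key _ i2).1, (key _ i1).1]
  refine integral_congr_ae ?_
  filter_upwards [(key _ i0).2, (key _ i1).2, (key _ i2).2] with y a0 a1 a2
  have he' : ∀ t, e.symm (t, y) = Fin.insertNth j t y := fun t => rfl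
  have hj : ∀ t, e.symm (t, y) j = t := by
    intro t; simp [he']
  simp only [hj] at a2 ⊢
  refine stein_real (fun t => ?_) a0 a1 a2
  have hline : HasDerivAt (fun t => (WithLp.toLp 2 (e.symm (t, y)) : Vec (n + 1)))
      (EuclideanSpace.single j 1) t := by
    have : (fun t => (WithLp.toLp 2 (e.symm (t, y)) : Vec (n + 1)))
        = fun t => WithLp.toLp 2 (e.symm (0, y)) + t • EuclideanSpace.single j (1 : ℝ) := by
      ext t k
      refine Fin.succAboveCases j ?_ (fun i => ?_) k
      · simp [he']
      · simp [he', Fin.succAbove_ne]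
    rw [this]
    simpa using ((hasDerivAt_id t).smul_const (EuclideanSpace.single j (1 : ℝ))).const_add
      (WithLp.toLp 2 (e.symm (0, y)) : Vec (n + 1))
  exact ((hφ.differentiable one_ne_zero _).hasFDerivAt).comp_hasDerivAt t hline

/-- Gaussian integration by parts in `ℝ^d`. -/
lemma stein {d : ℕ} {φ : Vec d → ℝ} (hφ : ContDiff ℝ 1 φ) {c : ℝ}
    (h0 : ∀ x, ‖φ x‖ ≤ c * (1 + ‖x‖) ^ 2) (h1 : ∀ x, ‖fderiv ℝ φ x‖ ≤ c * (1 + ‖x‖) ^ 2)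
    (h : Vec d) :
    ∫ u, φ u * inner ℝ u h ∂(stdGaussian (Vec d))
      = ∫ u, fderiv ℝ φ u h ∂(stdGaussian (Vec d)) := by
  have hd : Continuous (fderiv ℝ φ) := hφ.continuous_fderiv one_ne_zero
  have hc0 : 0 ≤ c := by have := (norm_nonneg _).trans (h0 0); simpa using this
  have e1 : ∀ u : Vec d, φ u * inner ℝ u h = ∑ j, h j * (φ u * u j) := by
    intro u
    rw [PiLp.inner_apply, Finset.mul_sum]
    exact Finset.sum_congr rfl fun j _ => by simp; ring
  have e2 : ∀ u : Vec d, fderiv ℝ φ u h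
      = ∑ j, h j * fderiv ℝ φ u (EuclideanSpace.single j 1) := by
    intro u
    conv_lhs => rw [← (EuclideanSpace.basisFun (Fin d) ℝ).sum_repr h]
    simp
  simp only [e1, e2]
  rw [integral_finsetSum, integral_finsetSum]
  · exact Finset.sum_congr rfl fun j _ => by
      rw [integral_const_mul, integral_const_mul, stein_coord j hφ h0 h1]
  · intro j _
    refine Integrable.const_mul ?_ _
    refine integrable_of_sq_growth (c := c) (by fun_prop) 2 two_ne_zero fun x => ?_
    refine (ContinuousLinearMap.le_opNorm _ _).trans ?_
    simpa using h1 x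
  · intro j _
    refine Integrable.const_mul ?_ _
    refine integrable_of_sq_growth (c := c) (by have := hφ.continuous; fun_prop) 3 (by norm_num)
      fun x => ?_
    rw [norm_mul, pow_succ, ← mul_assoc]
    gcongr
    · exact h0 x
    · exact (PiLp.norm_apply_le x j).trans (by linarith [norm_nonneg x])


/-! ### Strongly convex functions and their Gaussian smoothing. -/

/-- Symmetry of second derivatives, carried from the derivative to the gradient by the Riesz map
`T`. -/
lemma inner_fderiv_gradient_symm {d : ℕ} {f : Vec d → ℝ} {g : Vec d → Vec d} {A : Mat d}
    {x : Vec d} (hf : ∀ y, HasGradientAt f (g y) y) (hg : HasFDerivAt g A x) (v w : Vec d) :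
    inner ℝ (A v) w = inner ℝ (A w) v := by
  let T : Vec d →ₗ[ℝ] (Vec d →L[ℝ] ℝ) :=
    { toFun := fun v => innerSL ℝ v
      map_add' := fun v w => by ext; simp
      map_smul' := fun c v => by ext; simp }
  have h := second_derivative_symmetric (𝕜 := ℝ) (f := f) (f' := fun y => T (g y))
    (f'' := T.toContinuousLinearMap ∘L A) (x := x) (fun y => (hf y).hasFDerivAt)
    (T.toContinuousLinearMap.hasFDerivAt.comp x hg) v w
  simpa [T] using h

/-- A second-order Taylor lower bound on the line. -/
lemma taylor_lower {φ φ' φ'' : ℝ → ℝ} {m : ℝ} (h1 : ∀ t, HasDerivAt φ (φ' t) t)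
    (h2 : ∀ t, HasDerivAt φ' (φ'' t) t) (hm : ∀ t, m ≤ φ'' t) :
    φ 0 + φ' 0 + m / 2 ≤ φ 1 := by
  have a1 : Monotone (fun t => φ' t - m * t) := by
    refine monotone_of_deriv_nonneg (fun t => ?_) (fun t => ?_)
    · exact ((h2 t).sub ((hasDerivAt_id t).const_mul m)).differentiableAt
    · have := ((h2 t).sub ((hasDerivAt_id t).const_mul m)).deriv
      simp only [id, mul_one] at this
      have e : deriv (fun t => φ' t - m * t) t = φ'' t - m := this
      rw [e]; linarith [hm t]
  have d2 : ∀ t, HasDerivAt (fun t => φ t - (φ' 0 * t + m / 2 * t ^ 2))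
      (φ' t - (φ' 0 + m * t)) t := by
    intro t
    have := (h1 t).sub (((hasDerivAt_id t).const_mul (φ' 0)).add
      (((hasDerivAt_id t).pow 2).const_mul (m / 2)))
    convert! this using 1
    simp; ring
  have a2 : MonotoneOn (fun t => φ t - (φ' 0 * t + m / 2 * t ^ 2)) (Set.Ici 0) := by
    refine monotoneOn_of_deriv_nonneg (convex_Ici 0)
      (fun t _ => (d2 t).continuousAt.continuousWithinAt)
      (fun t _ => (d2 t).differentiableAt.differentiableWithinAt) (fun t ht => ?_)
    rw [(d2 t).deriv]
    simp only [interior_Ici, Set.mem_Ioi] at ht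
    have := a1 ht.le
    simp only at this
    linarith
  have := a2 (Set.mem_Ici.2 le_rfl) (Set.mem_Ici.2 zero_le_one) zero_le_one
  simp only at this
  linarith

section Smooth

variable {d : ℕ} {f : Vec d → ℝ} {μ L : ℝ}

lemma SmoothStronglyConvex.hasGradientAt (h : SmoothStronglyConvex f μ L) (x : Vec d) :
    HasGradientAt f (gradient f x) x :=
  ((h.contDiff.differentiable two_ne_zero) x).hasGradientAt

lemma SmoothStronglyConvex.contDiff_gradient (h : SmoothStronglyConvex f μ L) :
    ContDiff ℝ 1 (gradient f) := by
  have h1 : ContDiff ℝ 1 (fderiv ℝ f) := h.contDiff.fderiv_right (by norm_num)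
  exact ((InnerProductSpace.toDual ℝ (Vec d)).symm.contDiff).comp h1

lemma SmoothStronglyConvex.hasFDerivAt_gradient (h : SmoothStronglyConvex f μ L) (x : Vec d) :
    HasFDerivAt (gradient f) (hessian f x) x :=
  (h.contDiff_gradient.differentiable one_ne_zero x).hasFDerivAt

/-- Polarisation for the symmetric form `A`, with `0 ≤ A ≤ L`, at `w = Av / L`: `4⟨Av, w⟩ ≤ L‖v +
w‖² ≤ 2L‖v‖² + 2L‖w‖²`, which rearranges to `‖Av‖ ≤ L‖v‖`. -/
lemma SmoothStronglyConvex.norm_hessian_le (h : SmoothStronglyConvex f μ L) (x : Vec d) :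
    ‖hessian f x‖ ≤ L := by
  refine ContinuousLinearMap.opNorm_le_bound _ h.L_pos.le fun v => ?_
  set A := hessian f x
  have hs := inner_fderiv_gradient_symm h.hasGradientAt (h.hasFDerivAt_gradient x)
  have hL := h.L_pos
  set w := (1 / L) • A v with hw
  have h1 := h.upper x (v + w)
  have h2 : 0 ≤ inner ℝ (A (v - w)) (v - w) :=
    le_trans (by have := h.mu_pos; positivity) (h.lower x (v - w))
  have h3 : inner ℝ (A w) v = inner ℝ (A v) w := hs w v
  have h4 : inner ℝ (A v) w = (1 / L) * ‖A v‖ ^ 2 := by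
    rw [hw, inner_smul_right, real_inner_self_eq_norm_sq]
  have h5 : ‖v + w‖ ^ 2 ≤ 2 * ‖v‖ ^ 2 + 2 * ‖w‖ ^ 2 := by
    have := parallelogram_law_with_norm ℝ v w
    nlinarith [sq_nonneg ‖v - w‖]
  have h6 : ‖w‖ = (1 / L) * ‖A v‖ := by
    rw [hw, norm_smul, Real.norm_of_nonneg (by positivity)]
  change inner ℝ (A (v + w)) (v + w) ≤ _ at h1
  simp only [map_add, map_sub, inner_add_left, inner_add_right, inner_sub_left,
    inner_sub_right] at h1 h2
  rw [h6] at h5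
  have h7 : 4 * ((1 / L) * ‖A v‖ ^ 2) ≤ L * (2 * ‖v‖ ^ 2 + 2 * ((1 / L) * ‖A v‖) ^ 2) := by
    nlinarith
  have h8 : ‖A v‖ ^ 2 ≤ (L * ‖v‖) ^ 2 := by
    have : L * (2 * ‖v‖ ^ 2 + 2 * ((1 / L) * ‖A v‖) ^ 2)
        = 2 * L * ‖v‖ ^ 2 + 2 * ((1 / L) * ‖A v‖ ^ 2) := by field_simp
    rw [this] at h7
    have h9 : (1 / L) * ‖A v‖ ^ 2 ≤ L * ‖v‖ ^ 2 := by linarith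
    calc ‖A v‖ ^ 2 = L * ((1 / L) * ‖A v‖ ^ 2) := by field_simp
      _ ≤ L * (L * ‖v‖ ^ 2) := by gcongr
      _ = _ := by ring
  exact abs_le_of_sq_le_sq' h8 (by positivity) |>.2

lemma norm_sub_le_of_hasFDerivAt {g : Vec d → Vec d} {g' : Vec d → Mat d} {c : ℝ}
    (hg : ∀ x, HasFDerivAt g (g' x) x) (hc : ∀ x, ‖g' x‖ ≤ c) (x y : Vec d) :
    ‖g x - g y‖ ≤ c * ‖x - y‖ :=
  convex_univ.norm_image_sub_le_of_norm_hasFDerivWithin_le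
    (fun z _ => (hg z).hasFDerivWithinAt) (fun z _ => hc z) (Set.mem_univ y) (Set.mem_univ x)

lemma SmoothStronglyConvex.norm_gradient_sub_le (h : SmoothStronglyConvex f μ L) (x y : Vec d) :
    ‖gradient f x - gradient f y‖ ≤ L * ‖x - y‖ :=
  norm_sub_le_of_hasFDerivAt h.hasFDerivAt_gradient h.norm_hessian_le x y

lemma SmoothStronglyConvex.line (h : SmoothStronglyConvex f μ L) (x w : Vec d) (t : ℝ) :
    HasDerivAt (fun s => f (x + s • w)) (inner ℝ (gradient f (x + t • w)) w) t ∧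
    HasDerivAt (fun s => inner ℝ (gradient f (x + s • w)) w)
      (inner ℝ (hessian f (x + t • w) w) w) t := by
  have hl : HasDerivAt (fun s : ℝ => x + s • w) w t := by
    simpa using ((hasDerivAt_id t).smul_const w).const_add x
  constructor
  · have := ((h.hasGradientAt (x + t • w)).hasFDerivAt).comp_hasDerivAt t hl
    simpa using! this
  · have h1 := (h.hasFDerivAt_gradient (x + t • w)).comp_hasDerivAt t hl
    have := h1.inner ℝ (hasDerivAt_const t w)
    simpa using! this

lemma SmoothStronglyConvex.lower_quad (h : SmoothStronglyConvex f μ L) (x w : Vec d) :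
    f x + inner ℝ (gradient f x) w + μ / 2 * ‖w‖ ^ 2 ≤ f (x + w) := by
  have := taylor_lower (fun t => (h.line x w t).1) (fun t => (h.line x w t).2)
    (fun t => h.lower (x + t • w) w)
  simp only [zero_smul, add_zero, one_smul] at this
  linarith

lemma SmoothStronglyConvex.upper_quad (h : SmoothStronglyConvex f μ L) (x w : Vec d) :
    f (x + w) ≤ f x + inner ℝ (gradient f x) w + L / 2 * ‖w‖ ^ 2 := by
  have := taylor_lower (m := -(L * ‖w‖ ^ 2)) (fun t => (h.line x w t).1.neg)
    (fun t => (h.line x w t).2.neg)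
    (fun t => neg_le_neg (h.upper (x + t • w) w))
  simp only [Pi.neg_apply, zero_smul, add_zero, one_smul] at this
  linarith

lemma SmoothStronglyConvex.norm_gradient_le (h : SmoothStronglyConvex f μ L) (x : Vec d) :
    ‖gradient f x‖ ≤ ‖gradient f 0‖ + L * ‖x‖ := by
  have := h.norm_gradient_sub_le x 0
  rw [sub_zero] at this
  linarith [norm_le_norm_add_norm_sub' (gradient f x) (gradient f 0)]

/-- A function with quadratic upper and lower models around `x` of slope `g` is differentiable. -/
lemma hasGradientAt_of_quad {φ : Vec d → ℝ} {g x : Vec d} {a b : ℝ}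
    (hl : ∀ w, φ x + inner ℝ g w + a * ‖w‖ ^ 2 ≤ φ (x + w))
    (hu : ∀ w, φ (x + w) ≤ φ x + inner ℝ g w + b * ‖w‖ ^ 2) : HasGradientAt φ g x := by
  rw [hasGradientAt_iff_isLittleO_nhds_zero]
  have hO : (fun w => φ (x + w) - φ x - inner ℝ g w) =O[𝓝 0] fun w : Vec d => ‖w‖ ^ 2 := by
    refine Asymptotics.IsBigO.of_bound (|a| + |b|) (Eventually.of_forall fun w => ?_)
    rw [Real.norm_eq_abs, Real.norm_of_nonneg (by positivity)]
    have h1 := hl w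
    have h2 := hu w
    have h3 : 0 ≤ ‖w‖ ^ 2 := by positivity
    rw [abs_le]
    constructor <;> nlinarith [le_abs_self a, neg_abs_le a, le_abs_self b, neg_abs_le b]
  exact hO.trans_isLittleO (by simpa using Asymptotics.isLittleO_norm_pow_id (n := 2) one_lt_two)

/-- The Gaussian smoothing of the gradient field. -/
noncomputable def smoothGrad (f : Vec d → ℝ) (ν : ℝ) (x : Vec d) : Vec d :=
  ∫ u, gradient f (x + ν • u) ∂(stdGaussian (Vec d))

lemma SmoothStronglyConvex.continuous (h : SmoothStronglyConvex f μ L) : Continuous f :=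
  h.contDiff.continuous

lemma SmoothStronglyConvex.continuous_gradient (h : SmoothStronglyConvex f μ L) :
    Continuous (gradient f) := h.contDiff_gradient.continuous

lemma SmoothStronglyConvex.abs_le (h : SmoothStronglyConvex f μ L) (x : Vec d) :
    ‖f x‖ ≤ (|f 0| + ‖gradient f 0‖ + L) * (1 + ‖x‖) ^ 2 := by
  have h1 := h.lower_quad 0 x
  have h2 := h.upper_quad 0 x
  rw [zero_add] at h1 h2
  have h3 := abs_real_inner_le_norm (gradient f 0) x
  have := h.mu_pos
  have := h.L_pos
  have h4 := _root_.abs_le.1 h3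
  have h5 := neg_abs_le (f 0)
  have h6 := le_abs_self (f 0)
  have h7 := norm_nonneg (gradient f 0)
  have h8 := norm_nonneg x
  have h9 : 0 ≤ |f 0| := abs_nonneg _
  have e1 : |f 0| ≤ |f 0| * (1 + ‖x‖) ^ 2 := le_mul_of_one_le_right h9 (by nlinarith)
  have e2 : ‖gradient f 0‖ * ‖x‖ ≤ ‖gradient f 0‖ * (1 + ‖x‖) ^ 2 := by gcongr; nlinarith
  have e3 : L / 2 * ‖x‖ ^ 2 ≤ L * (1 + ‖x‖) ^ 2 := by nlinarith
  have e4 : 0 ≤ μ / 2 * ‖x‖ ^ 2 := by positivity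
  have e5 : 0 ≤ L * (1 + ‖x‖) ^ 2 := by positivity
  rw [Real.norm_eq_abs, _root_.abs_le]
  constructor <;> nlinarith

lemma SmoothStronglyConvex.norm_gradient_le' (h : SmoothStronglyConvex f μ L) (x : Vec d) :
    ‖gradient f x‖ ≤ (‖gradient f 0‖ + L) * (1 + ‖x‖) ^ 1 := by
  have := h.norm_gradient_le x
  nlinarith [norm_nonneg (gradient f 0), h.L_pos, norm_nonneg x]

lemma one_add_norm_add_smul_le (x u : Vec d) (ν : ℝ) :
    1 + ‖x + ν • u‖ ≤ (1 + ‖x‖ + |ν|) * (1 + ‖u‖) := by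
  have := norm_add_le x (ν • u)
  rw [norm_smul, Real.norm_eq_abs] at this
  nlinarith [norm_nonneg x, norm_nonneg u, abs_nonneg ν, mul_nonneg (norm_nonneg x) (norm_nonneg u)]

lemma integrable_shift {G : Type*} [NormedAddCommGroup G] {φ : Vec d → G} (hm : Continuous φ)
    {c : ℝ} {N : ℕ} (hN : N ≠ 0) (hb : ∀ x, ‖φ x‖ ≤ c * (1 + ‖x‖) ^ N) (ν : ℝ) (x : Vec d) :
    Integrable (fun u => φ (x + ν • u)) (stdGaussian (Vec d)) := by
  have hc0 : 0 ≤ c := by have := (norm_nonneg _).trans (hb 0); simpa using this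
  refine integrable_of_sq_growth (c := c * (1 + ‖x‖ + |ν|) ^ N)
    (hm.comp (by fun_prop)).aestronglyMeasurable N hN fun u => (hb _).trans ?_
  rw [mul_assoc, ← mul_pow]
  gcongr
  exact one_add_norm_add_smul_le x u ν

lemma SmoothStronglyConvex.integrable_shift (h : SmoothStronglyConvex f μ L) (ν : ℝ) (x : Vec d) :
    Integrable (fun u => f (x + ν • u)) (stdGaussian (Vec d)) :=
  ZOSGD.integrable_shift h.continuous two_ne_zero h.abs_le ν x

lemma SmoothStronglyConvex.integrable_gradient_shift (h : SmoothStronglyConvex f μ L) (ν : ℝ)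
    (x : Vec d) : Integrable (fun u => gradient f (x + ν • u)) (stdGaussian (Vec d)) :=
  ZOSGD.integrable_shift h.continuous_gradient one_ne_zero h.norm_gradient_le' ν x

/-- The Gaussian smoothing of `f`. -/
noncomputable def smooth (f : Vec d → ℝ) (ν : ℝ) (x : Vec d) : ℝ :=
  ∫ u, f (x + ν • u) ∂(stdGaussian (Vec d))

lemma SmoothStronglyConvex.integral_model (h : SmoothStronglyConvex f μ L) (ν : ℝ)
    (x w : Vec d) (a : ℝ) :
    Integrable (fun u => f (x + ν • u) + inner ℝ (gradient f (x + ν • u)) w + a)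
      (stdGaussian (Vec d)) ∧
    ∫ u, (f (x + ν • u) + inner ℝ (gradient f (x + ν • u)) w + a) ∂(stdGaussian (Vec d))
      = smooth f ν x + inner ℝ (smoothGrad f ν x) w + a := by
  have i1 := h.integrable_shift ν x
  have i2 : Integrable (fun u => inner ℝ (gradient f (x + ν • u)) w) (stdGaussian (Vec d)) :=
    (h.integrable_gradient_shift ν x).inner_const w
  refine ⟨(i1.add i2).add (integrable_const a), ?_⟩
  rw [integral_add (f := fun u => f (x + ν • u) + inner ℝ (gradient f (x + ν • u)) w)
    (i1.add i2) (integrable_const a), integral_add i1 i2]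
  simp only [integral_const, probReal_univ, smul_eq_mul, one_mul]
  congr 2
  rw [smoothGrad, real_inner_comm, ← integral_inner (h.integrable_gradient_shift ν x)]
  simp only [real_inner_comm]

lemma SmoothStronglyConvex.smooth_lower_quad (h : SmoothStronglyConvex f μ L) (ν : ℝ)
    (x w : Vec d) :
    smooth f ν x + inner ℝ (smoothGrad f ν x) w + μ / 2 * ‖w‖ ^ 2 ≤ smooth f ν (x + w) := by
  obtain ⟨i, e⟩ := h.integral_model ν x w (μ / 2 * ‖w‖ ^ 2)
  rw [← e]
  refine integral_mono i (h.integrable_shift ν (x + w)) fun u => ?_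
  have := h.lower_quad (x + ν • u) w
  rwa [add_right_comm x] at this

lemma SmoothStronglyConvex.smooth_upper_quad (h : SmoothStronglyConvex f μ L) (ν : ℝ)
    (x w : Vec d) :
    smooth f ν (x + w) ≤ smooth f ν x + inner ℝ (smoothGrad f ν x) w + L / 2 * ‖w‖ ^ 2 := by
  obtain ⟨i, e⟩ := h.integral_model ν x w (L / 2 * ‖w‖ ^ 2)
  rw [← e]
  refine integral_mono (h.integrable_shift ν (x + w)) i fun u => ?_
  have := h.upper_quad (x + ν • u) w
  rwa [add_right_comm x] at this

/-- Averaging over the shifts `ν u` preserves the quadratic models of `f` from below and above with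
the same constants, and two such models force differentiability. -/
lemma SmoothStronglyConvex.hasGradientAt_smooth (h : SmoothStronglyConvex f μ L) (ν : ℝ)
    (x : Vec d) : HasGradientAt (smooth f ν) (smoothGrad f ν x) x :=
  hasGradientAt_of_quad (h.smooth_lower_quad ν x) (h.smooth_upper_quad ν x)

lemma SmoothStronglyConvex.smoothGrad_mono (h : SmoothStronglyConvex f μ L) (ν : ℝ)
    (x y : Vec d) :
    μ * ‖x - y‖ ^ 2 ≤ inner ℝ (smoothGrad f ν x - smoothGrad f ν y) (x - y) := by
  have h1 := h.smooth_lower_quad ν x (y - x)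
  have h2 := h.smooth_lower_quad ν y (x - y)
  rw [add_sub_cancel] at h1 h2
  rw [← neg_sub x y, inner_neg_right, norm_neg] at h1
  rw [inner_sub_left]
  linarith

lemma SmoothStronglyConvex.smoothGrad_lipschitz (h : SmoothStronglyConvex f μ L) (ν : ℝ)
    (x y : Vec d) : ‖smoothGrad f ν x - smoothGrad f ν y‖ ≤ L * ‖x - y‖ := by
  rw [smoothGrad, smoothGrad, ← integral_sub (h.integrable_gradient_shift ν x)
    (h.integrable_gradient_shift ν y)]
  refine (norm_integral_le_of_norm_le_const (C := L * ‖x - y‖)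
    (ae_of_all _ fun u => ?_)).trans_eq (by simp)
  have := h.norm_gradient_sub_le (x + ν • u) (y + ν • u)
  rwa [add_sub_add_right_eq_sub] at this

/-- The lower model at `0` makes the smoothing coercive, so a minimum is attained. -/
lemma SmoothStronglyConvex.exists_smooth_min (h : SmoothStronglyConvex f μ L) (ν : ℝ) :
    ∃ y, smoothGrad f ν y = 0 := by
  have hc : Continuous (smooth f ν) :=
    continuous_iff_continuousAt.2 fun x => (h.hasGradientAt_smooth ν x).continuousAt
  have hlim : Tendsto (smooth f ν) (cocompact (Vec d)) atTop := by
    have h0 : ∀ w, smooth f ν 0 + (-‖smoothGrad f ν 0‖ * ‖w‖ + μ / 2 * ‖w‖ ^ 2)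
        ≤ smooth f ν w := by
      intro w
      have h1 := h.smooth_lower_quad ν 0 w
      rw [zero_add] at h1
      have h2 := (_root_.abs_le.1 (abs_real_inner_le_norm (smoothGrad f ν 0) w)).1
      linarith
    refine tendsto_atTop_mono h0 (tendsto_atTop_add_const_left _ _ ?_)
    have hq : Tendsto (fun t : ℝ => t * (-‖smoothGrad f ν 0‖ + μ / 2 * t)) atTop atTop := by
      refine tendsto_id.atTop_mul_atTop₀ (tendsto_atTop_add_const_left _ _ ?_)
      exact tendsto_id.const_mul_atTop (by have := h.mu_pos; positivity)
    refine (hq.comp (tendsto_norm_cocompact_atTop (E := Vec d))).congr fun w => ?_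
    simp only [Function.comp]; ring
  obtain ⟨y, hy⟩ := hc.exists_forall_le hlim
  refine ⟨y, ?_⟩
  have h1 : IsLocalMin (smooth f ν) y := Eventually.of_forall hy
  have h2 := h1.hasFDerivAt_eq_zero (h.hasGradientAt_smooth ν y).hasFDerivAt
  simpa using h2

lemma SmoothStronglyConvex.smooth_lt (h : SmoothStronglyConvex f μ L) {ν : ℝ} {y : Vec d}
    (hy : smoothGrad f ν y = 0) {z : Vec d} (hz : z ≠ y) : smooth f ν y < smooth f ν z := by
  have h1 := h.smooth_lower_quad ν y (z - y)
  rw [add_sub_cancel, hy, inner_zero_left] at h1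
  have h2 : 0 < μ / 2 * ‖z - y‖ ^ 2 := by
    have := h.mu_pos
    have := norm_pos_iff.2 (sub_ne_zero.2 hz)
    positivity
  linarith

/-- The first moment of the norm of a standard Gaussian vector. -/
noncomputable def gaussMean (d : ℕ) : ℝ := ∫ u, ‖u‖ ∂(stdGaussian (Vec d))

lemma gaussMean_nonneg (d : ℕ) : 0 ≤ gaussMean d := integral_nonneg fun _ => norm_nonneg _

lemma integrable_norm_gauss (d : ℕ) : Integrable (fun u => ‖u‖) (stdGaussian (Vec d)) :=
  (IsGaussian.integrable_id).norm

/-- Since `∇f(xs) = 0`, the smoothed gradient at `xs` is at most `L ν E‖u‖`, and strong monotonicity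
converts this into a distance. The linear dependence on `ν` is what keeps the leading constant of
the final bound of order `(1 + ν)²`. -/
lemma SmoothStronglyConvex.norm_sub_min_le (h : SmoothStronglyConvex f μ L) {ν : ℝ} (hν : 0 ≤ ν)
    {xs y : Vec d} (hxs : gradient f xs = 0) (hy : smoothGrad f ν y = 0) :
    ‖y - xs‖ ≤ L * gaussMean d / μ * ν := by
  have h1 := h.smoothGrad_mono ν y xs
  have h2 : ‖smoothGrad f ν xs‖ ≤ L * ν * gaussMean d := by
    rw [smoothGrad, gaussMean, ← integral_const_mul]
    refine norm_integral_le_of_norm_le ((integrable_norm_gauss d).const_mul _)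
      (ae_of_all _ fun u => ?_)
    have := h.norm_gradient_sub_le (xs + ν • u) xs
    rwa [hxs, sub_zero, add_sub_cancel_left, norm_smul, Real.norm_of_nonneg hν, ← mul_assoc] at this
  rw [hy, zero_sub, inner_neg_left] at h1
  have h3 := (_root_.abs_le.1 (abs_real_inner_le_norm (smoothGrad f ν xs) (y - xs))).1
  have hμ := h.mu_pos
  rcases (norm_nonneg (y - xs)).eq_or_lt with h0 | h0
  · rw [← h0]
    have := h.L_pos
    have := gaussMean_nonneg d
    positivity
  · have h4 : μ * ‖y - xs‖ ≤ L * ν * gaussMean d := by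
      have : μ * ‖y - xs‖ * ‖y - xs‖ ≤ (L * ν * gaussMean d) * ‖y - xs‖ := by nlinarith
      exact le_of_mul_le_mul_right this h0
    calc ‖y - xs‖ = (μ * ‖y - xs‖) / μ := by field_simp
      _ ≤ (L * ν * gaussMean d) / μ := by gcongr
      _ = _ := by ring

/-- The Gaussian smoothing of the Hessian field. -/
noncomputable def smoothHess (f : Vec d → ℝ) (ν : ℝ) (x : Vec d) : Mat d :=
  ∫ u, hessian f (x + ν • u) ∂(stdGaussian (Vec d))

lemma SmoothStronglyConvex.continuous_hessian (h : SmoothStronglyConvex f μ L) :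
    Continuous (hessian f) := h.contDiff_gradient.continuous_fderiv one_ne_zero

lemma SmoothStronglyConvex.integrable_hessian_shift (h : SmoothStronglyConvex f μ L) (ν : ℝ)
    (x : Vec d) : Integrable (fun u => hessian f (x + ν • u)) (stdGaussian (Vec d)) :=
  ZOSGD.integrable_shift h.continuous_hessian (c := L) one_ne_zero
    (fun y => (h.norm_hessian_le y).trans (by nlinarith [h.L_pos, norm_nonneg y])) ν x

/-- Differentiation under the integral, dominated by the Lipschitz constant `L` of the gradient. -/
lemma SmoothStronglyConvex.hasFDerivAt_smoothGrad (h : SmoothStronglyConvex f μ L) (ν : ℝ)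
    (x : Vec d) : HasFDerivAt (smoothGrad f ν) (smoothHess f ν x) x := by
  refine (hasFDerivAt_integral_of_dominated_loc_of_lip (s := Set.univ) (bound := fun _ => L)
    univ_mem (Eventually.of_forall fun y =>
      (h.integrable_gradient_shift ν y).aestronglyMeasurable)
    (h.integrable_gradient_shift ν x) (h.integrable_hessian_shift ν x).aestronglyMeasurable
    (ae_of_all _ fun u => ?_) (integrable_const L) (ae_of_all _ fun u => ?_)).2
  · refine LipschitzOnWith.of_dist_le_mul fun y _ z _ => ?_
    rw [dist_eq_norm, dist_eq_norm, Real.coe_nnabs, abs_of_pos h.L_pos]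
    have := h.norm_gradient_sub_le (y + ν • u) (z + ν • u)
    rwa [add_sub_add_right_eq_sub] at this
  · have := (h.hasFDerivAt_gradient (x + ν • u)).comp x ((hasFDerivAt_id x).add_const (ν • u))
    simpa using! this

/-- The integration-by-parts formula for the smoothed Hessian. -/
lemma SmoothStronglyConvex.inner_smoothHess (h : SmoothStronglyConvex f μ L) {ν : ℝ} (hν : 0 < ν)
    (x v w : Vec d) :
    ν * inner ℝ w (smoothHess f ν x v)
      = ∫ u, inner ℝ w (gradient f (x + ν • u)) * inner ℝ u v ∂(stdGaussian (Vec d)) := by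
  have hd : ∀ u, HasFDerivAt (fun u => inner ℝ w (gradient f (x + ν • u)))
      ((innerSL ℝ w) ∘L (ν • hessian f (x + ν • u))) u := by
    intro u
    have h1 := (h.hasFDerivAt_gradient (x + ν • u)).comp u
      (((hasFDerivAt_id u).const_smul ν).const_add x)
    have h2 := (innerSL ℝ w).hasFDerivAt.comp u h1
    convert! h2 using 1
    ext z; simp
  have hφ : ContDiff ℝ 1 (fun u => inner ℝ w (gradient f (x + ν • u))) :=
    contDiff_const.inner ℝ (h.contDiff_gradient.comp (by fun_prop))
  have hL := h.L_pos
  set c := ‖w‖ * (‖gradient f 0‖ + L) * (1 + ‖x‖ + |ν|) + ‖w‖ * |ν| * L with hc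
  rw [stein hφ (c := c)]
  · simp only [(hd _).fderiv]
    simp only [ContinuousLinearMap.comp_apply, smul_apply, innerSL_apply_apply,
      inner_smul_right]
    rw [integral_const_mul, integral_inner (𝕜 := ℝ)]
    · rw [smoothHess, ContinuousLinearMap.integral_apply (h.integrable_hessian_shift ν x)]
    · exact (h.integrable_hessian_shift ν x).apply_continuousLinearMap v
  · intro u
    have h1 := (norm_inner_le_norm (𝕜 := ℝ) w (gradient f (x + ν • u))).trans
      (mul_le_mul_of_nonneg_left (h.norm_gradient_le' _) (norm_nonneg w))
    rw [pow_one] at h1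
    refine h1.trans ?_
    have h2 := one_add_norm_add_smul_le x u ν
    have h3 : ‖w‖ * ((‖gradient f 0‖ + L) * (1 + ‖x + ν • u‖))
        ≤ ‖w‖ * (‖gradient f 0‖ + L) * (1 + ‖x‖ + |ν|) * (1 + ‖u‖) := by
      rw [mul_assoc, mul_assoc, ← mul_assoc]
      have : (‖gradient f 0‖ + L) * (1 + ‖x + ν • u‖)
        ≤ (‖gradient f 0‖ + L) * ((1 + ‖x‖ + |ν|) * (1 + ‖u‖)) := by gcongr
      nlinarith [norm_nonneg w]
    refine h3.trans ?_
    have h4 : (1 + ‖u‖) ≤ (1 + ‖u‖) ^ 2 := by nlinarith [norm_nonneg u]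
    refine mul_le_mul ?_ h4 (by positivity) (by positivity)
    rw [hc]
    have : 0 ≤ ‖w‖ * |ν| * L := by positivity
    linarith
  · intro u
    rw [(hd u).fderiv]
    refine (ContinuousLinearMap.opNorm_comp_le _ _).trans ?_
    rw [innerSL_apply_norm, norm_smul, Real.norm_eq_abs]
    have h1 : ‖w‖ * (|ν| * ‖hessian f (x + ν • u)‖) ≤ ‖w‖ * |ν| * L := by
      rw [mul_assoc]
      gcongr
      exact h.norm_hessian_le _
    refine h1.trans ?_
    have h4 : 1 ≤ (1 + ‖u‖) ^ 2 := by nlinarith [norm_nonneg u]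
    have h5 : ‖w‖ * |ν| * L ≤ c := by
      rw [hc]
      have : 0 ≤ ‖w‖ * (‖gradient f 0‖ + L) * (1 + ‖x‖ + |ν|) := by positivity
      linarith
    have h6 : 0 ≤ c := by positivity
    nlinarith

/-- The Hessian of `f` is only continuous. Integration by parts moves one derivative onto the
Gaussian weight, which leaves a difference of gradients and costs a factor `1 / ν`. This factor
enters only terms of lower order, where its size is harmless. -/
lemma SmoothStronglyConvex.smoothHess_lipschitz (h : SmoothStronglyConvex f μ L) {ν : ℝ}
    (hν : 0 < ν) (x y : Vec d) :
    ‖smoothHess f ν x - smoothHess f ν y‖ ≤ L * gaussMean d / ν * ‖x - y‖ := by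
  have hL := h.L_pos
  have hg := gaussMean_nonneg d
  refine ContinuousLinearMap.opNorm_le_bound _ (by positivity) fun v => ?_
  set D := (smoothHess f ν x - smoothHess f ν y) v with hD
  have hint : ∀ z, Integrable (fun u => inner ℝ D (gradient f (z + ν • u)) * inner ℝ u v)
      (stdGaussian (Vec d)) := by
    intro z
    refine integrable_of_sq_growth
      (c := ‖D‖ * ((‖gradient f 0‖ + L) * (1 + ‖z‖ + |ν|)) * ‖v‖)
      (by have := h.continuous_gradient; fun_prop) 2 two_ne_zero fun u => ?_
    rw [norm_mul]
    have h1 := (norm_inner_le_norm (𝕜 := ℝ) D (gradient f (z + ν • u))).trans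
      (mul_le_mul_of_nonneg_left (h.norm_gradient_le' _) (norm_nonneg D))
    have h2 : ‖inner ℝ u v‖ ≤ (1 + ‖u‖) * ‖v‖ :=
      (norm_inner_le_norm (𝕜 := ℝ) u v).trans (by gcongr; linarith)
    have h3 := one_add_norm_add_smul_le z u ν
    rw [pow_one] at h1
    calc _ ≤ (‖D‖ * ((‖gradient f 0‖ + L) * ((1 + ‖z‖ + |ν|) * (1 + ‖u‖))))
          * ((1 + ‖u‖) * ‖v‖) := by
            refine mul_le_mul (h1.trans ?_) h2 (norm_nonneg _) (by positivity)
            gcongr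
      _ = _ := by ring
  have key : ν * ‖D‖ ^ 2 ≤ ‖D‖ * (L * ‖x - y‖) * ‖v‖ * gaussMean d := by
    have e1 : ν * ‖D‖ ^ 2 = ∫ u, (inner ℝ D (gradient f (x + ν • u)) * inner ℝ u v
        - inner ℝ D (gradient f (y + ν • u)) * inner ℝ u v) ∂(stdGaussian (Vec d)) := by
      rw [integral_sub (hint x) (hint y), ← h.inner_smoothHess hν, ← h.inner_smoothHess hν,
        ← mul_sub, ← inner_sub_right, ← sub_apply, ← hD,
        real_inner_self_eq_norm_sq]
    rw [e1, gaussMean, ← integral_const_mul]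
    refine integral_mono ((hint x).sub (hint y)) ((integrable_norm_gauss d).const_mul _)
      fun u => ?_
    simp only
    rw [← sub_mul, ← inner_sub_right]
    refine (le_abs_self _).trans ?_
    rw [abs_mul, mul_assoc (_ * _)]
    refine mul_le_mul ((abs_real_inner_le_norm _ _).trans ?_)
      ((abs_real_inner_le_norm _ _).trans_eq (mul_comm _ _)) (abs_nonneg _) (by positivity)
    have := h.norm_gradient_sub_le (x + ν • u) (y + ν • u)
    rw [add_sub_add_right_eq_sub] at this
    gcongr
  rcases (norm_nonneg D).eq_or_lt with h0 | h0
  · rw [← h0]; positivity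
  · have h4 : ν * ‖D‖ ≤ L * ‖x - y‖ * ‖v‖ * gaussMean d := by
      have : ν * ‖D‖ * ‖D‖ ≤ (L * ‖x - y‖ * ‖v‖ * gaussMean d) * ‖D‖ := by nlinarith
      exact le_of_mul_le_mul_right this h0
    calc ‖D‖ = (ν * ‖D‖) / ν := by field_simp
      _ ≤ (L * ‖x - y‖ * ‖v‖ * gaussMean d) / ν := by gcongr
      _ = _ := by ring

/-- On the ball of radius `‖w‖` around `y` the smoothed Hessian stays within a multiple of `‖w‖` of
its value at `y`. This quadratic error is what the linearization of the recursion needs. -/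
lemma SmoothStronglyConvex.smoothGrad_remainder (h : SmoothStronglyConvex f μ L) {ν : ℝ}
    (hν : 0 < ν) (y w : Vec d) :
    ‖smoothGrad f ν (y + w) - smoothGrad f ν y - smoothHess f ν y w‖
      ≤ L * gaussMean d / ν * ‖w‖ ^ 2 := by
  have hL := h.L_pos
  have hg := gaussMean_nonneg d
  have := (convex_closedBall y ‖w‖).norm_image_sub_le_of_norm_hasFDerivWithin_le'
    (f := smoothGrad f ν) (f' := smoothHess f ν) (φ := smoothHess f ν y)
    (C := L * gaussMean d / ν * ‖w‖) (x := y) (y := y + w)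
    (fun z _ => (h.hasFDerivAt_smoothGrad ν z).hasFDerivWithinAt) (fun z hz => ?_)
    (by simp) (by simp)
  · rw [add_sub_cancel_left] at this
    exact this.trans_eq (by ring)
  · refine (h.smoothHess_lipschitz hν z y).trans ?_
    gcongr
    simpa [dist_eq_norm] using hz

lemma SmoothStronglyConvex.smoothHess_lower (h : SmoothStronglyConvex f μ L) (ν : ℝ)
    (x v : Vec d) : μ * ‖v‖ ^ 2 ≤ inner ℝ (smoothHess f ν x v) v := by
  have hi := (h.integrable_hessian_shift ν x)
  have hv : Integrable (fun u => hessian f (x + ν • u) v) (stdGaussian (Vec d)) :=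
    hi.apply_continuousLinearMap v
  rw [smoothHess, ContinuousLinearMap.integral_apply hi, real_inner_comm,
    ← integral_inner (𝕜 := ℝ) hv]
  calc μ * ‖v‖ ^ 2 = ∫ _, μ * ‖v‖ ^ 2 ∂(stdGaussian (Vec d)) := by simp
    _ ≤ _ := integral_mono (integrable_const _) (hv.const_inner v) fun u => by
      simp only
      rw [real_inner_comm]
      exact h.lower _ v

lemma SmoothStronglyConvex.smoothHess_symm (h : SmoothStronglyConvex f μ L) (ν : ℝ)
    (x v w : Vec d) :
    inner ℝ (smoothHess f ν x v) w = inner ℝ (smoothHess f ν x w) v :=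
  inner_fderiv_gradient_symm (h.hasGradientAt_smooth ν) (h.hasFDerivAt_smoothGrad ν x) v w

end Smooth


/-! ### The zeroth-order oracle: moments, Lipschitz constant and unbiasedness. -/

lemma memLp_four_iff {α E : Type*} {m : MeasurableSpace α} {P : Measure α}
    [NormedAddCommGroup E] {f : α → E} (hf : AEStronglyMeasurable f P) :
    MemLp f 4 P ↔ Integrable (fun a => ‖f a‖ ^ 4) P := by
  rw [← integrable_norm_rpow_iff hf (by norm_num) (by norm_num)]
  have : (4 : ENNReal).toReal = ((4 : ℕ) : ℝ) := by norm_num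
  simp only [this, Real.rpow_natCast]

lemma memLp_four_mul_prod {α β : Type*} [MeasurableSpace α] [MeasurableSpace β] {P : Measure α}
    {R : Measure β} [SFinite P] [SFinite R] {f : α → ℝ} {g : β → ℝ} (hf : MemLp f 4 P)
    (hg : MemLp g 4 R) : MemLp (fun z : α × β => f z.1 * g z.2) 4 (P.prod R) := by
  have hm : AEStronglyMeasurable (fun z : α × β => f z.1 * g z.2) (P.prod R) :=
    hf.1.comp_fst.mul hg.1.comp_snd
  rw [memLp_four_iff hm]
  refine (((memLp_four_iff hf.1).1 hf).mul_prod ((memLp_four_iff hg.1).1 hg)).congr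
    (ae_of_all _ fun z => ?_)
  simp only [norm_mul, mul_pow]

lemma memLp_norm_pow_gauss (d N : ℕ) :
    MemLp (fun u : Vec d => ‖u‖ ^ N) 4 (stdGaussian (Vec d)) := by
  rw [memLp_four_iff (by fun_prop)]
  -- The degree is raised by one because `integrable_of_sq_growth` excludes degree zero, which `N =
  -- 0` would give.
  refine integrable_of_sq_growth (c := 1) (by fun_prop) (N * 4 + 1) (by omega) fun u => ?_
  rw [norm_pow, norm_norm, norm_pow, norm_norm, ← pow_mul, one_mul]
  calc ‖u‖ ^ (N * 4) ≤ (1 + ‖u‖) ^ (N * 4) := by gcongr; linarith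
    _ ≤ _ := pow_le_pow_right₀ (by linarith [norm_nonneg u]) (by omega)

section Oracle

variable {d : ℕ} {Z : Type*} [MeasurableSpace Z] {F : Vec d → Z → ℝ} {Q : Measure Z}
  [IsProbabilityMeasure Q] {H : Z → ℝ} {σ μ L : ℝ} {xstar : Vec d}

omit [IsProbabilityMeasure Q] in
lemma HessianEnvelope.nonneg (h : HessianEnvelope F Q H) (z : Z) : 0 ≤ H z :=
  (norm_nonneg _).trans (h.bound z 0)

omit [IsProbabilityMeasure Q] in
lemma HessianEnvelope.norm_gradF_sub_le (h : HessianEnvelope F Q H) (z : Z) (x y : Vec d) :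
    ‖gradF F x z - gradF F y z‖ ≤ H z * ‖x - y‖ :=
  norm_sub_le_of_hasFDerivAt (g := gradient fun y => F y z)
    (fun x => ((h.differentiable z) x).hasFDerivAt) (fun x => h.bound z x) x y

omit [IsProbabilityMeasure Q] in
lemma GradientNoise.hasGradientAt (h : GradientNoise F Q xstar) (z : Z) (x : Vec d) :
    HasGradientAt (fun y => F y z) (gradF F x z) x :=
  ((h.contDiff z).differentiable one_ne_zero x).hasGradientAt

lemma abs_sub_le_of_gradient_le {φ : Vec d → ℝ} {g : Vec d → Vec d}
    (hφ : ∀ x, HasGradientAt φ (g x) x) {c : ℝ} (x w : Vec d)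
    (hg : ∀ y, ‖y - x‖ ≤ ‖w‖ → ‖g y‖ ≤ c) : |φ (x + w) - φ x| ≤ c * ‖w‖ := by
  have := (convex_closedBall x ‖w‖).norm_image_sub_le_of_norm_hasFDerivWithin_le (𝕜 := ℝ)
    (f := φ) (C := c) (x := x) (y := x + w)
    (fun z _ => (hφ z).hasFDerivAt.hasFDerivWithinAt) (fun z hz => ?_) (by simp) (by simp)
  · simpa using this
  · rw [LinearIsometryEquiv.norm_map]
    exact hg z (by simpa [dist_eq_norm] using hz)

omit [IsProbabilityMeasure Q] in
lemma abs_F_sub_le (hn : GradientNoise F Q xstar) (hh : HessianEnvelope F Q H) (z : Z)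
    (x w : Vec d) : |F (x + w) z - F x z| ≤ (‖gradF F x z‖ + H z * ‖w‖) * ‖w‖ := by
  refine abs_sub_le_of_gradient_le (fun y => hn.hasGradientAt z y) x w fun y hy => ?_
  have h1 := hh.norm_gradF_sub_le z y x
  have h2 := norm_le_norm_add_norm_sub' (gradF F y z) (gradF F x z)
  have h3 := mul_le_mul_of_nonneg_left hy (hh.nonneg z)
  linarith

omit [IsProbabilityMeasure Q] in
lemma norm_gradEst_le (hn : GradientNoise F Q xstar) (hh : HessianEnvelope F Q H) {ν : ℝ}
    (hν : 0 < ν) (x : Vec d) (z : Z) (u : Vec d) :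
    ‖gradEst F ν x z u‖ ≤ (‖gradF F x z‖ + H z * (ν * ‖u‖)) * ‖u‖ ^ 2 := by
  have h := abs_F_sub_le hn hh z x (ν • u)
  rw [norm_smul, Real.norm_of_nonneg hν.le] at h
  rw [gradEst, norm_smul, Real.norm_eq_abs, abs_div, abs_of_pos hν]
  calc |F (x + ν • u) z - F x z| / ν * ‖u‖
      ≤ ((‖gradF F x z‖ + H z * (ν * ‖u‖)) * (ν * ‖u‖)) / ν * ‖u‖ := by gcongr
    _ = _ := by field_simp

omit [IsProbabilityMeasure Q] in
-- The increment `x ↦ F(x + ν u, z) - F(x, z)` has gradient at most `H(z) ν ‖u‖`; the division by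
-- `ν` cancels, so the random Lipschitz constant is free of `ν`.
lemma norm_gradEst_sub_le (hn : GradientNoise F Q xstar) (hh : HessianEnvelope F Q H) {ν : ℝ}
    (hν : 0 < ν) (x y : Vec d) (z : Z) (u : Vec d) :
    ‖gradEst F ν x z u - gradEst F ν y z u‖ ≤ (H z * ‖u‖ ^ 2) * ‖x - y‖ := by
  have h : |(F (x + ν • u) z - F x z) - (F (y + ν • u) z - F y z)|
      ≤ H z * (ν * ‖u‖) * ‖x - y‖ := by
    have := abs_sub_le_of_gradient_le (φ := fun x => F (x + ν • u) z - F x z)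
      (g := fun x => gradF F (x + ν • u) z - gradF F x z) (fun x => ?_)
      (c := H z * (ν * ‖u‖)) y (x - y) (fun w _ => ?_)
    · simpa using this
    · have h1 := (hn.hasGradientAt z (x + ν • u)).hasFDerivAt.comp x
        ((hasFDerivAt_id x).add_const (ν • u))
      have h2 := h1.sub (hn.hasGradientAt z x).hasFDerivAt
      rw [hasGradientAt_iff_hasFDerivAt]
      convert! h2 using 1
      ext v; simp
    · have := hh.norm_gradF_sub_le z (w + ν • u) w
      rwa [add_sub_cancel_left, norm_smul, Real.norm_of_nonneg hν.le] at this
  rw [gradEst, gradEst, ← sub_smul, ← sub_div, norm_smul, Real.norm_eq_abs, abs_div, abs_of_pos hν]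
  calc |(F (x + ν • u) z - F x z) - (F (y + ν • u) z - F y z)| / ν * ‖u‖
      ≤ (H z * (ν * ‖u‖) * ‖x - y‖) / ν * ‖u‖ := by gcongr
    _ = _ := by field_simp

omit [IsProbabilityMeasure Q] in
-- A Carathéodory function, continuous in `x` and measurable in `z`, is jointly measurable.
lemma measurable_F (ho : UnbiasedOracle F Q σ) (hn : GradientNoise F Q xstar) :
    Measurable (fun p : Vec d × Z => F p.1 p.2) :=
  measurable_uncurry_of_continuous_of_measurable (u := F) (fun z => (hn.contDiff z).continuous)
    ho.measurable

omit [IsProbabilityMeasure Q] in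
lemma measurable_gradEst (ho : UnbiasedOracle F Q σ) (hn : GradientNoise F Q xstar) (ν : ℝ) :
    Measurable (fun p : Vec d × (Z × Vec d) => gradEst F ν p.1 p.2.1 p.2.2) := by
  have hF := measurable_F ho hn
  have h1 : Measurable (fun p : Vec d × (Z × Vec d) => F (p.1 + ν • p.2.2) p.2.1) :=
    hF.comp (f := fun p : Vec d × (Z × Vec d) => (p.1 + ν • p.2.2, p.2.1)) (by fun_prop)
  have h2 : Measurable (fun p : Vec d × (Z × Vec d) => F p.1 p.2.1) :=
    hF.comp (f := fun p : Vec d × (Z × Vec d) => (p.1, p.2.1)) (by fun_prop)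
  exact ((h1.sub h2).div_const ν).smul (by fun_prop)

instance : IsProbabilityMeasure (noiseLaw d Q) := by unfold noiseLaw; infer_instance

lemma memLp_lipConst (hh : HessianEnvelope F Q H) :
    MemLp (fun p : Z × Vec d => H p.1 * ‖p.2‖ ^ 2) 4 (noiseLaw d Q) :=
  memLp_four_mul_prod hh.memLp (memLp_norm_pow_gauss d 2)

/-- An envelope of `G_ν(y, z, u) / (1 + ν)` for `y` at distance at most `c ν` of `x`. -/
noncomputable def estEnvelope (F : Vec d → Z → ℝ) (H : Z → ℝ) (x : Vec d) (c : ℝ)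
    (p : Z × Vec d) : ℝ :=
  ‖gradF F x p.1‖ * ‖p.2‖ ^ 2 + (H p.1 * (c * ‖p.2‖ ^ 2) + H p.1 * ‖p.2‖ ^ 3)

lemma memLp_estEnvelope (hh : HessianEnvelope F Q H) {x : Vec d} (hx : MemLp (gradF F x) 4 Q)
    (c : ℝ) : MemLp (estEnvelope F H x c) 4 (noiseLaw d Q) :=
  (memLp_four_mul_prod hx.norm (memLp_norm_pow_gauss d 2)).add
    ((memLp_four_mul_prod hh.memLp ((memLp_norm_pow_gauss d 2).const_mul c)).add
      (memLp_four_mul_prod hh.memLp (memLp_norm_pow_gauss d 3)))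

omit [IsProbabilityMeasure Q] [MeasurableSpace Z] in
lemma estEnvelope_nonneg (hH : ∀ z, 0 ≤ H z) {c : ℝ} (hc : 0 ≤ c) (x : Vec d)
    (p : Z × Vec d) : 0 ≤ estEnvelope F H x c p := by
  have := hH p.1
  unfold estEnvelope; positivity

omit [IsProbabilityMeasure Q] in
lemma norm_gradEst_le_envelope (hn : GradientNoise F Q xstar) (hh : HessianEnvelope F Q H)
    {ν : ℝ} (hν : 0 < ν) {c : ℝ} (hc : 0 ≤ c) {x y : Vec d} (hy : ‖y - x‖ ≤ c * ν)
    (p : Z × Vec d) :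
    ‖gradEst F ν y p.1 p.2‖ ≤ (1 + ν) * estEnvelope F H x c p := by
  have h1 := norm_gradEst_le hn hh hν y p.1 p.2
  have hH := hh.nonneg p.1
  have h2 : ‖gradF F y p.1‖ ≤ ‖gradF F x p.1‖ + H p.1 * (c * ν) := by
    have h3 := hh.norm_gradF_sub_le p.1 y x
    have h4 := norm_le_norm_add_norm_sub' (gradF F y p.1) (gradF F x p.1)
    have h5 := mul_le_mul_of_nonneg_left hy hH
    linarith
  refine h1.trans ?_
  calc (‖gradF F y p.1‖ + H p.1 * (ν * ‖p.2‖)) * ‖p.2‖ ^ 2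
      ≤ ((‖gradF F x p.1‖ + H p.1 * (c * ν)) + H p.1 * (ν * ‖p.2‖)) * ‖p.2‖ ^ 2 := by gcongr
    _ ≤ _ := by
      unfold estEnvelope
      have e1 : 0 ≤ ν * (‖gradF F x p.1‖ * ‖p.2‖ ^ 2) := by positivity
      have e2 : 0 ≤ H p.1 * (c * ‖p.2‖ ^ 2) := by positivity
      have e3 : 0 ≤ H p.1 * ‖p.2‖ ^ 3 := by positivity
      nlinarith

lemma memLp_gradEst (ho : UnbiasedOracle F Q σ) (hn : GradientNoise F Q xstar)
    (hh : HessianEnvelope F Q H) {ν : ℝ} (hν : 0 < ν) {x : Vec d} (hx : MemLp (gradF F x) 4 Q)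
    (y : Vec d) : MemLp (fun p => gradEst F ν y p.1 p.2) 4 (noiseLaw d Q) := by
  refine ((memLp_estEnvelope hh hx (‖y - x‖ / ν)).const_mul (1 + ν)).mono'
    ((measurable_gradEst ho hn ν).comp
      (measurable_const.prodMk measurable_id)).aestronglyMeasurable (ae_of_all _ fun p => ?_)
  exact norm_gradEst_le_envelope hn hh hν (by positivity) (by rw [div_mul_cancel₀ _ hν.ne']) p

/-- The constant is uniform over `ν` and over points within `c ν` of `x`; with `norm_sub_min_le` it
bounds the fourth moment at every minimizer `x_ν` at once. -/
lemma integral_norm_gradEst_pow_le (ho : UnbiasedOracle F Q σ) (hn : GradientNoise F Q xstar)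
    (hh : HessianEnvelope F Q H) {x : Vec d} (hx : MemLp (gradF F x) 4 Q) {c : ℝ} (hc : 0 ≤ c) :
    ∃ K : ℝ, 0 < K ∧ ∀ ν, 0 < ν → ∀ y, ‖y - x‖ ≤ c * ν →
      ∫ p, ‖gradEst F ν y p.1 p.2‖ ^ 4 ∂(noiseLaw d Q) ≤ K * (1 + ν) ^ 4 := by
  have hm := memLp_estEnvelope (d := d) hh hx c
  have hi := (memLp_four_iff hm.1).1 hm
  -- The added `1` makes the constant positive.
  refine ⟨(∫ p, ‖estEnvelope F H x c p‖ ^ 4 ∂(noiseLaw d Q)) + 1, ?_, fun ν hν y hy => ?_⟩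
  · have : 0 ≤ ∫ p, ‖estEnvelope F H x c p‖ ^ 4 ∂(noiseLaw d Q) :=
      integral_nonneg fun _ => by positivity
    linarith
  · have hg := memLp_gradEst ho hn hh hν hx y
    have h1 : ∫ p, ‖gradEst F ν y p.1 p.2‖ ^ 4 ∂(noiseLaw d Q)
        ≤ ∫ p, (1 + ν) ^ 4 * ‖estEnvelope F H x c p‖ ^ 4 ∂(noiseLaw d Q) := by
      refine integral_mono ((memLp_four_iff hg.1).1 hg) (hi.const_mul _) fun p => ?_
      simp only
      rw [← mul_pow]
      refine pow_le_pow_left₀ (norm_nonneg _) ?_ 4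
      rw [Real.norm_of_nonneg (estEnvelope_nonneg hh.nonneg hc x p)]
      exact norm_gradEst_le_envelope hn hh hν hc hy p
    rw [integral_const_mul] at h1
    have : 0 ≤ (1 + ν) ^ 4 := by positivity
    nlinarith

lemma integrable_F_shift (ho : UnbiasedOracle F Q σ) (hn : GradientNoise F Q xstar)
    (hh : HessianEnvelope F Q H) {ν : ℝ} (hν : 0 < ν) (y : Vec d) :
    Integrable (fun p : Z × Vec d => F (y + ν • p.2) p.1) (noiseLaw d Q) := by
  have hF := measurable_F ho hn
  have hxy : MemLp (gradF F y) 1 Q := (ho.gradient_memLp y).mono_exponent (by norm_num)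
  have h1 : Integrable (fun p : Z × Vec d => F y p.1) (noiseLaw d Q) :=
    (ho.integrable y).comp_fst _
  have h2 : Integrable (fun p : Z × Vec d =>
      ‖gradF F y p.1‖ * (ν * ‖p.2‖) + H p.1 * (ν * ‖p.2‖) ^ 2) (noiseLaw d Q) := by
    refine Integrable.add ?_ ?_
    · exact (memLp_one_iff_integrable.1 hxy).norm.mul_prod ((integrable_norm_gauss d).const_mul ν)
    · refine Integrable.mul_prod (f := H) (g := fun u : Vec d => (ν * ‖u‖) ^ 2)
        (hh.memLp.integrable (by norm_num)) ?_
      refine integrable_of_sq_growth (c := ν ^ 2) (by fun_prop) 2 two_ne_zero fun u => ?_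
      rw [norm_pow, norm_mul, norm_norm, Real.norm_of_nonneg hν.le, mul_pow]
      gcongr
      linarith
  have h3 : Integrable (fun p : Z × Vec d => F (y + ν • p.2) p.1 - F y p.1) (noiseLaw d Q) := by
    refine h2.mono' ?_ (ae_of_all _ fun p => ?_)
    · refine Measurable.aestronglyMeasurable (Measurable.sub ?_ ?_)
      · exact hF.comp (f := fun p : Z × Vec d => (y + ν • p.2, p.1)) (by fun_prop)
      · exact hF.comp (f := fun p : Z × Vec d => (y, p.1)) (by fun_prop)
    · have := abs_F_sub_le hn hh p.1 y (ν • p.2)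
      rw [norm_smul, Real.norm_of_nonneg hν.le] at this
      rw [Real.norm_eq_abs]
      exact this.trans_eq (by ring)
  refine (h3.add h1).congr (ae_of_all _ fun p => ?_)
  simp

lemma surrogate_eq_smooth (ho : UnbiasedOracle F Q σ) (hn : GradientNoise F Q xstar)
    (hh : HessianEnvelope F Q H) {ν : ℝ} (hν : 0 < ν) :
    surrogate F Q ν = smooth (objective F Q) ν := by
  ext y
  rw [surrogate, noiseLaw,
    integral_prod_symm _ (integrable_F_shift ho hn hh hν y)]
  rfl

/-- The zeroth-order estimator is unbiased for the gradient of the smoothed objective. -/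
lemma integral_gradEst (ho : UnbiasedOracle F Q σ)
    (hc : SmoothStronglyConvex (objective F Q) μ L) (hn : GradientNoise F Q xstar)
    (hh : HessianEnvelope F Q H) {x : Vec d} (hx : MemLp (gradF F x) 4 Q) {ν : ℝ} (hν : 0 < ν)
    (y : Vec d) :
    ∫ p, gradEst F ν y p.1 p.2 ∂(noiseLaw d Q) = smoothGrad (objective F Q) ν y := by
  set f := objective F Q with hf
  have hL := hc.L_pos
  have hi : Integrable (fun p => gradEst F ν y p.1 p.2) (noiseLaw d Q) :=
    (memLp_gradEst ho hn hh hν hx y).integrable (by norm_num)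
  refine ext_inner_right ℝ fun w => ?_
  have hd : ∀ u, HasFDerivAt (fun u => f (y + ν • u))
      ((InnerProductSpace.toDual ℝ (Vec d) (gradient f (y + ν • u)))
        ∘L (ν • ContinuousLinearMap.id ℝ (Vec d))) u := by
    intro u
    have h1 := (hc.hasGradientAt (y + ν • u)).hasFDerivAt.comp u
      (((hasFDerivAt_id u).const_smul ν).const_add y)
    exact h1
  have hφ : ContDiff ℝ 1 (fun u => f (y + ν • u)) :=
    (hc.contDiff.of_le (by norm_num)).comp (by fun_prop)
  set c := (|f 0| + ‖gradient f 0‖ + L) * (1 + ‖y‖ + |ν|) ^ 2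
    + (‖gradient f 0‖ + L) * (1 + ‖y‖ + |ν|) * ν with hcdef
  have hb0 : ∀ u, ‖f (y + ν • u)‖ ≤ c * (1 + ‖u‖) ^ 2 := by
    intro u
    calc ‖f (y + ν • u)‖ ≤ (|f 0| + ‖gradient f 0‖ + L) * (1 + ‖y + ν • u‖) ^ 2 := hc.abs_le _
      _ ≤ (|f 0| + ‖gradient f 0‖ + L) * ((1 + ‖y‖ + |ν|) * (1 + ‖u‖)) ^ 2 := by
        gcongr; exact one_add_norm_add_smul_le y u ν
      _ = (|f 0| + ‖gradient f 0‖ + L) * (1 + ‖y‖ + |ν|) ^ 2 * (1 + ‖u‖) ^ 2 := by ring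
      _ ≤ _ := by
        gcongr
        rw [hcdef]
        have : 0 ≤ (‖gradient f 0‖ + L) * (1 + ‖y‖ + |ν|) * ν := by positivity
        linarith
  have hb1 : ∀ u, ‖fderiv ℝ (fun u => f (y + ν • u)) u‖ ≤ c * (1 + ‖u‖) ^ 2 := by
    intro u
    rw [(hd u).fderiv]
    calc _ ≤ ‖gradient f (y + ν • u)‖ * ν := by
          refine (ContinuousLinearMap.opNorm_comp_le _ _).trans ?_
          rw [LinearIsometryEquiv.norm_map, norm_smul, Real.norm_of_nonneg hν.le]
          have := ContinuousLinearMap.norm_id_le (𝕜 := ℝ) (E := Vec d)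
          have h5 : ν * ‖ContinuousLinearMap.id ℝ (Vec d)‖ ≤ ν := by nlinarith
          gcongr
      _ ≤ ((‖gradient f 0‖ + L) * ((1 + ‖y‖ + |ν|) * (1 + ‖u‖))) * ν := by
          gcongr
          refine (hc.norm_gradient_le' _).trans ?_
          rw [pow_one]
          gcongr
          exact one_add_norm_add_smul_le y u ν
      _ = (‖gradient f 0‖ + L) * (1 + ‖y‖ + |ν|) * ν * (1 + ‖u‖) := by ring
      _ ≤ (‖gradient f 0‖ + L) * (1 + ‖y‖ + |ν|) * ν * (1 + ‖u‖) ^ 2 := by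
          gcongr; nlinarith [norm_nonneg u]
      _ ≤ _ := by
        gcongr
        rw [hcdef]
        have : 0 ≤ (|f 0| + ‖gradient f 0‖ + L) * (1 + ‖y‖ + |ν|) ^ 2 := by positivity
        linarith
  -- For `φ(u) = f(y + ν u)` this is `E[f(y + ν u)⟨u, w⟩] = ν E⟨∇f(y + ν u), w⟩`.
  have hs := stein hφ hb0 hb1 w
  have hR : inner ℝ (smoothGrad f ν y) w
      = ν⁻¹ * ∫ u, f (y + ν • u) * inner ℝ u w ∂(stdGaussian (Vec d)) := by
    rw [hs]
    simp only [(hd _).fderiv]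
    rw [smoothGrad, real_inner_comm,
      ← integral_inner (𝕜 := ℝ) (hc.integrable_gradient_shift ν y), ← integral_const_mul]
    congr 1; ext u
    simp [hν.ne']
  have hLft : inner ℝ (∫ p, gradEst F ν y p.1 p.2 ∂(noiseLaw d Q)) w
      = ∫ u, ((f (y + ν • u) - f y) / ν) * inner ℝ u w ∂(stdGaussian (Vec d)) := by
    rw [real_inner_comm, ← integral_inner (𝕜 := ℝ) hi, noiseLaw,
      integral_prod_symm _ (by exact hi.const_inner w)]
    congr 1; ext u
    simp only [gradEst, inner_smul_right]
    rw [integral_mul_const, integral_div, integral_sub (ho.integrable _) (ho.integrable _),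
      real_inner_comm]
    rfl
  rw [hLft, hR, ← integral_const_mul]
  have hiu : Integrable (fun u => inner ℝ u w) (stdGaussian (Vec d)) :=
    (IsGaussian.integrable_id (μ := stdGaussian (Vec d))).inner_const w
  have hif : Integrable (fun u => f (y + ν • u) * inner ℝ u w) (stdGaussian (Vec d)) := by
    refine integrable_of_sq_growth (c := c * ‖w‖) (by have := hc.continuous; fun_prop) 3
      (by norm_num) fun u => ?_
    rw [norm_mul]
    calc _ ≤ (c * (1 + ‖u‖) ^ 2) * ((1 + ‖u‖) * ‖w‖) := by
          refine mul_le_mul (hb0 u) ((norm_inner_le_norm (𝕜 := ℝ) u w).trans ?_)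
            (norm_nonneg _) ((norm_nonneg _).trans (hb0 u))
          gcongr; linarith
      _ = _ := by ring
  have e : ∀ u, ((f (y + ν • u) - f y) / ν) * inner ℝ u w
      = ν⁻¹ * (f (y + ν • u) * inner ℝ u w) - (f y / ν) * inner ℝ u w := by
    intro u; field_simp
  simp only [e]
  rw [integral_sub (hif.const_mul _) (hiu.const_mul _), integral_const_mul (f y / ν)]
  -- The subtracted value `f(y)` contributes nothing because `u` is centred.
  have h0 : ∫ u, inner ℝ u w ∂(stdGaussian (Vec d)) = 0 := by
    have := integral_inner (𝕜 := ℝ) (IsGaussian.integrable_id (μ := stdGaussian (Vec d))) w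
    simp only [id] at this
    rw [integral_id_stdGaussian, inner_zero_right] at this
    rw [← this]
    simp only [real_inner_comm]
  rw [h0, mul_zero, sub_zero]

omit [IsProbabilityMeasure Q] in
lemma gradient_eq_zero_of_min (hc : SmoothStronglyConvex (objective F Q) μ L)
    (hmin : ∀ y, objective F Q xstar ≤ objective F Q y) : gradient (objective F Q) xstar = 0 := by
  have h1 : IsLocalMin (objective F Q) xstar := Eventually.of_forall hmin
  have h2 := h1.hasFDerivAt_eq_zero (hc.hasGradientAt xstar).hasFDerivAt
  exact (LinearIsometryEquiv.map_eq_zero_iff _).1 h2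

end Oracle


/-! ### Mean-square and absolute-moment inequalities. -/

/-- Hölder exponents that put a product of two `L⁴` variables in `L²`. -/
instance holderTriple_four_four_two : ENNReal.HolderTriple 4 4 2 where
  inv_add_inv_eq_inv := by
    rw [← ENNReal.toReal_eq_toReal_iff' (by simp) (by simp), ENNReal.toReal_add (by simp) (by simp)]
    norm_num

section L2

variable {Ω : Type*} {mΩ : MeasurableSpace Ω} {P : Measure Ω}

/-- The `L²` norm of a real random variable. -/
noncomputable def n2 (P : Measure Ω) (X : Ω → ℝ) : ℝ := √(∫ ω, X ω ^ 2 ∂P)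

lemma n2_nonneg (X : Ω → ℝ) : 0 ≤ n2 P X := Real.sqrt_nonneg _

lemma n2_sq (X : Ω → ℝ) : n2 P X ^ 2 = ∫ ω, X ω ^ 2 ∂P :=
  Real.sq_sqrt (integral_nonneg fun _ => sq_nonneg _)

lemma n2_le_of_sq_le {X : Ω → ℝ} {a : ℝ} (ha : 0 ≤ a) (h : ∫ ω, X ω ^ 2 ∂P ≤ a ^ 2) :
    n2 P X ≤ a := Real.sqrt_le_iff.2 ⟨ha, h⟩

lemma n2_eq_toReal_eLpNorm {X : Ω → ℝ} (hX : MemLp X 2 P) : n2 P X = (eLpNorm X 2 P).toReal := by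
  rw [hX.eLpNorm_eq_integral_rpow_norm two_ne_zero (by norm_num), ENNReal.toReal_ofReal
    (by positivity), n2, Real.sqrt_eq_rpow]
  simp

lemma n2_add_le {X Y : Ω → ℝ} (hX : MemLp X 2 P) (hY : MemLp Y 2 P) :
    n2 P (fun ω => X ω + Y ω) ≤ n2 P X + n2 P Y := by
  have h : MemLp (fun ω => X ω + Y ω) 2 P := hX.add hY
  rw [n2_eq_toReal_eLpNorm hX, n2_eq_toReal_eLpNorm hY, n2_eq_toReal_eLpNorm h,
    ← ENNReal.toReal_add hX.eLpNorm_ne_top hY.eLpNorm_ne_top]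
  exact ENNReal.toReal_mono (by simp [hX.eLpNorm_ne_top, hY.eLpNorm_ne_top])
    (eLpNorm_add_le hX.1 hY.1 one_le_two)

lemma n2_const_mul (a : ℝ) (X : Ω → ℝ) : n2 P (fun ω => a * X ω) = |a| * n2 P X := by
  simp only [n2, mul_pow]
  rw [integral_const_mul, Real.sqrt_mul (sq_nonneg a), Real.sqrt_sq_eq_abs]

lemma n2_neg (X : Ω → ℝ) : n2 P (fun ω => -X ω) = n2 P X := by simp [n2]

lemma n2_sub_le {X Y : Ω → ℝ} (hX : MemLp X 2 P) (hY : MemLp Y 2 P) :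
    n2 P (fun ω => X ω - Y ω) ≤ n2 P X + n2 P Y := by
  have := n2_add_le hX hY.neg
  simp only [sub_eq_add_neg]
  refine this.trans_eq ?_
  rw [← n2_neg (P := P) Y]; rfl

lemma n2_zero : n2 P (fun _ => (0 : ℝ)) = 0 := by simp [n2]

lemma n2_sum_le {ι : Type*} (S : Finset ι) {X : ι → Ω → ℝ} (hX : ∀ i ∈ S, MemLp (X i) 2 P) :
    n2 P (fun ω => ∑ i ∈ S, X i ω) ≤ ∑ i ∈ S, n2 P (X i) := by
  classical
  induction S using Finset.induction_on with
  | empty => simp [n2_zero]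
  | insert i S hi ih =>
    simp only [Finset.sum_insert hi]
    refine (n2_add_le (hX i (by simp)) (memLp_finsetSum S fun j hj => hX j (by simp [hj]))).trans ?_
    gcongr
    exact ih fun j hj => hX j (by simp [hj])

lemma integral_abs_mul_le {X Y : Ω → ℝ} (hX : MemLp X 2 P) (hY : MemLp Y 2 P) :
    ∫ ω, |X ω * Y ω| ∂P ≤ n2 P X * n2 P Y := by
  have h := integral_mul_le_Lp_mul_Lq_of_nonneg (μ := P) Real.HolderConjugate.two_two
    (f := fun ω => |X ω|) (g := fun ω => |Y ω|) (ae_of_all _ fun _ => abs_nonneg _)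
    (ae_of_all _ fun _ => abs_nonneg _) (by rw [ENNReal.ofReal_ofNat]; exact hX.abs)
    (by rw [ENNReal.ofReal_ofNat]; exact hY.abs)
  simpa [n2, abs_mul, Real.sqrt_eq_rpow] using h

lemma integrable_mul_of_memLp {X Y : Ω → ℝ} (hX : MemLp X 2 P) (hY : MemLp Y 2 P) :
    Integrable (fun ω => X ω * Y ω) P := hX.integrable_mul hY

lemma memLp_two_mul {X Y : Ω → ℝ} (hX : MemLp X 4 P) (hY : MemLp Y 4 P) :
    MemLp (fun ω => X ω * Y ω) 2 P := hY.mul hX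

variable [IsProbabilityMeasure P]

lemma integral_abs_le_n2 {X : Ω → ℝ} (hX : MemLp X 2 P) : ∫ ω, |X ω| ∂P ≤ n2 P X := by
  have := integral_abs_mul_le hX (memLp_const (1 : ℝ))
  simpa [n2] using this

omit [IsProbabilityMeasure P] in
lemma integral_abs_sum_le {ι : Type*} (S : Finset ι) {X : ι → Ω → ℝ}
    (hX : ∀ i ∈ S, Integrable (X i) P) :
    ∫ ω, |∑ i ∈ S, X i ω| ∂P ≤ ∑ i ∈ S, ∫ ω, |X i ω| ∂P := by
  rw [← integral_finsetSum S fun i hi => (hX i hi).abs]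
  exact integral_mono (integrable_finsetSum S hX).abs (integrable_finsetSum S fun i hi => (hX i hi).abs)
    fun ω => Finset.abs_sum_le_sum_abs _ _

omit [IsProbabilityMeasure P] in
lemma integral_abs_add_le {X Y : Ω → ℝ} (hX : Integrable X P) (hY : Integrable Y P) :
    ∫ ω, |X ω + Y ω| ∂P ≤ ∫ ω, |X ω| ∂P + ∫ ω, |Y ω| ∂P := by
  rw [← integral_add hX.abs hY.abs]
  exact integral_mono (hX.add hY).abs (hX.abs.add hY.abs) fun ω => abs_add_le _ _

lemma memLp_two_of_four {X : Ω → ℝ} (hX : MemLp X 4 P) : MemLp X 2 P :=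
  hX.mono_exponent (by norm_num)

omit [IsProbabilityMeasure P] in
lemma integrable_pow_four {X : Ω → ℝ} (hX : MemLp X 4 P) : Integrable (fun ω => X ω ^ 4) P := by
  have := (memLp_four_iff hX.1).1 hX
  refine this.congr (ae_of_all _ fun ω => ?_)
  simp only [Real.norm_eq_abs]
  exact Even.pow_abs (by decide) _

omit [IsProbabilityMeasure P] in
lemma integrable_pow_two {X : Ω → ℝ} (hX : MemLp X 2 P) : Integrable (fun ω => X ω ^ 2) P :=
  (memLp_two_iff_integrable_sq hX.1).1 hX

lemma sq_integral_sq_le {X : Ω → ℝ} (hX : MemLp X 4 P) :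
    (∫ ω, X ω ^ 2 ∂P) ^ 2 ≤ ∫ ω, X ω ^ 4 ∂P := by
  have h2 : MemLp (fun ω => X ω ^ 2) 2 P := by
    simpa only [pow_two] using memLp_two_mul hX hX
  have h := integral_abs_le_n2 h2
  have h0 : 0 ≤ ∫ ω, X ω ^ 2 ∂P := integral_nonneg fun _ => sq_nonneg _
  simp only [abs_pow, sq_abs] at h
  have h3 := pow_le_pow_left₀ h0 h 2
  rw [n2_sq] at h3
  refine h3.trans_eq ?_
  congr 1; ext ω; ring

end L2

/-! ### Martingale differences, innovations and perturbations. -/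

section Martingale

variable {Ω : Type*} {mΩ : MeasurableSpace Ω}

/-- Square integrable martingale differences, `d k` being revealed at time `k + 1`. -/
structure MDiff (P : Measure Ω) (𝓕 : Filtration ℕ mΩ) (d : ℕ → Ω → ℝ) : Prop where
  meas : ∀ k, Measurable[𝓕 (k + 1)] (d k)
  memLp : ∀ k, MemLp (d k) 2 P
  orth : ∀ k (Y : Ω → ℝ), Measurable[𝓕 k] Y → MemLp Y 2 P → ∫ ω, Y ω * d k ω ∂P = 0

variable {P : Measure Ω} {𝓕 : Filtration ℕ mΩ}

lemma measurable_sum_of_lt {d : ℕ → Ω → ℝ} (hd : ∀ k, Measurable[𝓕 (k + 1)] (d k)) {n : ℕ}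
    {S : Finset ℕ} (hS : ∀ k ∈ S, k < n) : Measurable[𝓕 n] (fun ω => ∑ k ∈ S, d k ω) :=
  Finset.measurable_fun_sum S fun k hk => (hd k).mono (𝓕.mono (hS k hk)) le_rfl

lemma MDiff.smul {d : ℕ → Ω → ℝ} (hd : MDiff P 𝓕 d) (a : ℕ → ℝ) :
    MDiff P 𝓕 (fun k ω => a k * d k ω) where
  meas k := (hd.meas k).const_mul _
  memLp k := (hd.memLp k).const_mul _
  orth k Y hY hY2 := by
    have : ∀ ω, Y ω * (a k * d k ω) = a k * (Y ω * d k ω) := fun ω => by ring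
    simp only [this]
    rw [integral_const_mul, hd.orth k Y hY hY2, mul_zero]

/-- Pythagoras: adding the largest index last, `orth` cancels its product with the earlier sum. -/
lemma MDiff.integral_sum_sq {d : ℕ → Ω → ℝ} (hd : MDiff P 𝓕 d) (S : Finset ℕ) :
    ∫ ω, (∑ k ∈ S, d k ω) ^ 2 ∂P = ∑ k ∈ S, ∫ ω, d k ω ^ 2 ∂P := by
  induction S using Finset.induction_on_max with
  | empty => simp
  | insert n S hS ih =>
    have hn : n ∉ S := fun h => lt_irrefl _ (hS n h)
    have hm : MemLp (fun ω => ∑ k ∈ S, d k ω) 2 P := memLp_finsetSum S fun k _ => hd.memLp k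
    have e : ∀ ω, (∑ k ∈ insert n S, d k ω) ^ 2
        = d n ω ^ 2 + (2 * ((∑ k ∈ S, d k ω) * d n ω) + (∑ k ∈ S, d k ω) ^ 2) := by
      intro ω; rw [Finset.sum_insert hn]; ring
    simp only [e]
    have i1 := integrable_pow_two (hd.memLp n)
    have i2 := (integrable_mul_of_memLp hm (hd.memLp n)).const_mul 2
    have i3 := integrable_pow_two hm
    have i23 : Integrable (fun ω => 2 * ((∑ k ∈ S, d k ω) * d n ω) + (∑ k ∈ S, d k ω) ^ 2) P :=
      i2.add i3
    rw [integral_add i1 i23, integral_add i2 i3, integral_const_mul,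
      hd.orth n _ (measurable_sum_of_lt hd.meas hS) hm, Finset.sum_insert hn, ih]
    ring

lemma MDiff.n2_sum_smul_le {d : ℕ → Ω → ℝ} (hd : MDiff P 𝓕 d) (S : Finset ℕ) (a b : ℕ → ℝ)
    (hb : ∀ k ∈ S, a k ^ 2 * ∫ ω, d k ω ^ 2 ∂P ≤ b k) :
    n2 P (fun ω => ∑ k ∈ S, a k * d k ω) ≤ √(∑ k ∈ S, b k) := by
  rw [n2, (hd.smul a).integral_sum_sq S]
  refine Real.sqrt_le_sqrt (Finset.sum_le_sum fun k hk => ?_)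
  refine le_trans (le_of_eq ?_) (hb k hk)
  rw [← integral_const_mul]
  congr 1; ext ω; ring

/-- Centred innovations with variance `s` and fourth moment at most `B ^ 2`. -/
structure Innovation (P : Measure Ω) (𝓕 : Filtration ℕ mΩ) (s B : ℝ) (ξ : ℕ → Ω → ℝ) :
    Prop where
  meas : ∀ k, Measurable[𝓕 (k + 1)] (ξ k)
  indep : ∀ k (Y : Ω → ℝ), Measurable[𝓕 k] Y → IndepFun Y (ξ k) P
  memLp : ∀ k, MemLp (ξ k) 4 P
  mean : ∀ k, ∫ ω, ξ k ω ∂P = 0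
  var : ∀ k, ∫ ω, ξ k ω ^ 2 ∂P = s
  fourth : ∀ k, ∫ ω, ξ k ω ^ 4 ∂P ≤ B ^ 2
  B_nonneg : 0 ≤ B

section Innovation

variable [IsProbabilityMeasure P] {s B : ℝ} {ξ : ℕ → Ω → ℝ}

omit [IsProbabilityMeasure P] in
lemma Innovation.s_nonneg (h : Innovation P 𝓕 s B ξ) : 0 ≤ s := by
  rw [← h.var 0]; exact integral_nonneg fun _ => sq_nonneg _

/-- Jensen's inequality. It lets `B` alone carry the constants of the estimates. -/
lemma Innovation.s_le (h : Innovation P 𝓕 s B ξ) : s ≤ B := by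
  have h1 := sq_integral_sq_le (h.memLp 0)
  rw [h.var 0] at h1
  exact abs_le_of_sq_le_sq' (h1.trans (h.fourth 0)) h.B_nonneg |>.2

omit [IsProbabilityMeasure P] in
lemma Innovation.measurable (h : Innovation P 𝓕 s B ξ) (k : ℕ) : Measurable (ξ k) :=
  (h.meas k).mono (𝓕.le _) le_rfl

omit [IsProbabilityMeasure P] in
lemma Innovation.integral_mul (h : Innovation P 𝓕 s B ξ) {k : ℕ} {Y : Ω → ℝ}
    (hY : Measurable[𝓕 k] Y) : ∫ ω, Y ω * ξ k ω ∂P = 0 := by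
  rw [(h.indep k Y hY).integral_fun_mul_eq_mul_integral
    (hY.mono (𝓕.le k) le_rfl).aestronglyMeasurable (h.measurable k).aestronglyMeasurable,
    h.mean, mul_zero]

omit [IsProbabilityMeasure P] in
lemma Innovation.integral_mul_sq (h : Innovation P 𝓕 s B ξ) {k : ℕ} {Y : Ω → ℝ}
    (hY : Measurable[𝓕 k] Y) : ∫ ω, Y ω * ξ k ω ^ 2 ∂P = (∫ ω, Y ω ∂P) * s := by
  have hi : IndepFun Y (fun ω => ξ k ω ^ 2) P :=
    (h.indep k Y hY).comp measurable_id (measurable_id.pow_const 2)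
  rw [hi.integral_fun_mul_eq_mul_integral
    (hY.mono (𝓕.le k) le_rfl).aestronglyMeasurable
    ((h.measurable k).pow_const 2).aestronglyMeasurable, h.var]

lemma Innovation.memLp_mul (h : Innovation P 𝓕 s B ξ) {k : ℕ} {Y : Ω → ℝ}
    (hY : Measurable[𝓕 k] Y) (hY2 : MemLp Y 2 P) :
    MemLp (fun ω => Y ω * ξ k ω) 2 P := by
  have hYm := (hY.mono (𝓕.le k) le_rfl)
  refine (memLp_two_iff_integrable_sq (hYm.mul (h.measurable k)).aestronglyMeasurable).2 ?_
  have hi : IndepFun (fun ω => Y ω ^ 2) (fun ω => ξ k ω ^ 2) P :=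
    (h.indep k Y hY).comp (measurable_id.pow_const 2) (measurable_id.pow_const 2)
  refine (hi.integrable_mul (integrable_pow_two hY2)
    (integrable_pow_two (memLp_two_of_four (h.memLp k)))).congr (ae_of_all _ fun ω => ?_)
  simp [mul_pow]

omit [IsProbabilityMeasure P] in
lemma Innovation.integral_mul_sq' (h : Innovation P 𝓕 s B ξ) {k : ℕ} {Y : Ω → ℝ}
    (hY : Measurable[𝓕 k] Y) : ∫ ω, (Y ω * ξ k ω) ^ 2 ∂P = (∫ ω, Y ω ^ 2 ∂P) * s := by
  rw [← h.integral_mul_sq (hY.pow_const 2)]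
  congr 1; ext ω; ring

/-- Martingale transforms of innovations are martingale differences. -/
lemma Innovation.mdiff_mul (h : Innovation P 𝓕 s B ξ) {Y : ℕ → Ω → ℝ}
    (hY : ∀ k, Measurable[𝓕 k] (Y k)) (hY2 : ∀ k, MemLp (Y k) 2 P) :
    MDiff P 𝓕 (fun k ω => Y k ω * ξ k ω) where
  meas k := ((hY k).mono (𝓕.mono k.le_succ) le_rfl).mul (h.meas k)
  memLp k := h.memLp_mul (hY k) (hY2 k)
  orth k X hX _ := by
    simp only [← mul_assoc]
    exact h.integral_mul (hX.mul (hY k))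

lemma Innovation.mdiff (h : Innovation P 𝓕 s B ξ) : MDiff P 𝓕 ξ := by
  have := h.mdiff_mul (Y := fun _ _ => 1) (fun _ => measurable_const) (fun _ => memLp_const 1)
  simpa using this

lemma Innovation.mdiff_sq (h : Innovation P 𝓕 s B ξ) : MDiff P 𝓕 (fun k ω => ξ k ω ^ 2 - s) where
  meas k := ((h.meas k).pow_const 2).sub_const s
  memLp k := by
    have : MemLp (fun ω => ξ k ω ^ 2) 2 P := by
      simpa only [pow_two] using memLp_two_mul (h.memLp k) (h.memLp k)
    exact this.sub (memLp_const s)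
  orth k Y hY hY2 := by
    have h2 : MemLp (fun ω => ξ k ω ^ 2) 2 P := by
      simpa only [pow_two] using memLp_two_mul (h.memLp k) (h.memLp k)
    simp only [mul_sub]
    rw [integral_sub (integrable_mul_of_memLp hY2 h2)
      ((hY2.integrable one_le_two).mul_const s), h.integral_mul_sq hY, integral_mul_const, sub_self]

omit [IsProbabilityMeasure P] in
lemma MDiff.add {d d' : ℕ → Ω → ℝ} (h : MDiff P 𝓕 d) (h' : MDiff P 𝓕 d') :
    MDiff P 𝓕 (fun k ω => d k ω + d' k ω) where
  meas k := (h.meas k).add (h'.meas k)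
  memLp k := (h.memLp k).add (h'.memLp k)
  orth k Y hY hY2 := by
    simp only [mul_add]
    rw [integral_add (integrable_mul_of_memLp hY2 (h.memLp k))
      (integrable_mul_of_memLp hY2 (h'.memLp k)), h.orth k Y hY hY2, h'.orth k Y hY hY2, add_zero]

lemma Innovation.integral_sum_sq (h : Innovation P 𝓕 s B ξ) (S : Finset ℕ) :
    ∫ ω, (∑ k ∈ S, ξ k ω) ^ 2 ∂P = S.card * s := by
  rw [h.mdiff.integral_sum_sq]
  simp [h.var]

omit [IsProbabilityMeasure P] in
lemma Innovation.memLp_sum (h : Innovation P 𝓕 s B ξ) (S : Finset ℕ) :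
    MemLp (fun ω => ∑ k ∈ S, ξ k ω) 4 P := memLp_finsetSum S fun k _ => h.memLp k

omit [IsProbabilityMeasure P] in
lemma integrable_monomial {X Y : Ω → ℝ} (hX : MemLp X 4 P) (hY : MemLp Y 4 P) {g : Ω → ℝ}
    (hg : AEStronglyMeasurable g P) {c : ℝ} (hb : ∀ ω, |g ω| ≤ c * (X ω ^ 4 + Y ω ^ 4)) :
    Integrable g P :=
  (((integrable_pow_four hX).add (integrable_pow_four hY)).const_mul c).mono' hg
    (ae_of_all _ hb)

/-- Fourth moment of a sum of innovations. -/
lemma Innovation.integral_sum_pow_four_le (h : Innovation P 𝓕 s B ξ) (S : Finset ℕ) :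
    ∫ ω, (∑ k ∈ S, ξ k ω) ^ 4 ∂P ≤ 4 * (S.card : ℝ) ^ 2 * B ^ 2 := by
  induction S using Finset.induction_on_max with
  | empty => simp
  | insert n S hS ih =>
    have hn : n ∉ S := fun h => lt_irrefl _ (hS n h)
    set X : Ω → ℝ := fun ω => ∑ k ∈ S, ξ k ω with hXdef
    have hX4 : MemLp X 4 P := h.memLp_sum S
    have hXm : Measurable[𝓕 n] X := measurable_sum_of_lt h.meas hS
    have hXm' : Measurable X := hXm.mono (𝓕.le n) le_rfl
    have hξ := h.memLp n
    have hξm := h.measurable n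
    -- In the binomial expansion `4Xξ³ ≤ 2X²ξ² + 2ξ⁴`, which turns the coefficients `6` and `1` into
    -- `8` and `3`. The term `4X³ξ` is kept because its mean vanishes.
    have e : ∀ ω, (∑ k ∈ insert n S, ξ k ω) ^ 4
        ≤ X ω ^ 4 + (4 * (X ω ^ 3 * ξ n ω) + (8 * (X ω ^ 2 * ξ n ω ^ 2) + 3 * ξ n ω ^ 4)) := by
      intro ω
      rw [Finset.sum_insert hn]
      change (ξ n ω + X ω) ^ 4 ≤ _
      nlinarith [mul_nonneg (sq_nonneg (ξ n ω)) (sq_nonneg (X ω - ξ n ω))]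
    have i1 := integrable_pow_four hX4
    have i4 := integrable_pow_four hξ
    have i3 : Integrable (fun ω => X ω ^ 2 * ξ n ω ^ 2) P := by
      refine integrable_monomial hX4 hξ
        ((hXm'.pow_const 2).mul (hξm.pow_const 2)).aestronglyMeasurable (c := 1) fun ω => ?_
      rw [abs_of_nonneg (by positivity)]
      nlinarith [sq_nonneg (X ω ^ 2 - ξ n ω ^ 2)]
    have i2 : Integrable (fun ω => X ω ^ 3 * ξ n ω) P := by
      refine integrable_monomial hX4 hξ
        ((hXm'.pow_const 3).mul hξm).aestronglyMeasurable (c := 1) fun ω => ?_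
      rw [abs_le]
      constructor <;> nlinarith [sq_nonneg (X ω ^ 2 - ξ n ω ^ 2), sq_nonneg (X ω * ξ n ω + X ω ^ 2),
        sq_nonneg (X ω * ξ n ω - X ω ^ 2)]
    have i34 : Integrable (fun ω => 8 * (X ω ^ 2 * ξ n ω ^ 2) + 3 * ξ n ω ^ 4) P :=
      (i3.const_mul 8).add (i4.const_mul 3)
    have i234 : Integrable (fun ω => 4 * (X ω ^ 3 * ξ n ω)
        + (8 * (X ω ^ 2 * ξ n ω ^ 2) + 3 * ξ n ω ^ 4)) P := (i2.const_mul 4).add i34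
    have i5 : Integrable (fun ω => X ω ^ 4 + (4 * (X ω ^ 3 * ξ n ω)
        + (8 * (X ω ^ 2 * ξ n ω ^ 2) + 3 * ξ n ω ^ 4))) P :=
      i1.add i234
    have h1 := integral_mono (integrable_pow_four (h.memLp_sum (insert n S))) i5 e
    have h2 : ∫ ω, (X ω ^ 4 + (4 * (X ω ^ 3 * ξ n ω)
        + (8 * (X ω ^ 2 * ξ n ω ^ 2) + 3 * ξ n ω ^ 4))) ∂P
        = ∫ ω, X ω ^ 4 ∂P + (4 * ∫ ω, X ω ^ 3 * ξ n ω ∂P + (8 * ∫ ω, X ω ^ 2 * ξ n ω ^ 2 ∂P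
          + 3 * ∫ ω, ξ n ω ^ 4 ∂P)) := by
      rw [integral_add i1 i234, integral_add (i2.const_mul 4) i34,
        integral_add (i3.const_mul 8) (i4.const_mul 3)]
      simp only [integral_const_mul]
    rw [h2, h.integral_mul (hXm.pow_const 3), h.integral_mul_sq (hXm.pow_const 2),
      h.integral_sum_sq] at h1
    refine h1.trans ?_
    rw [Finset.card_insert_of_notMem hn]
    push_cast
    have h3 := h.fourth n
    have h4 : (S.card : ℝ) * s * s ≤ S.card * B ^ 2 := by
      have h5 : s * s ≤ B ^ 2 := by nlinarith [h.s_le, h.s_nonneg]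
      nlinarith [(Nat.cast_nonneg S.card : (0:ℝ) ≤ S.card)]
    -- With `m` the cardinality of `S`, the increment `(8m + 3)B²` is at most `4((m + 1)² - m²)B² =
    -- (8m + 4)B²`.
    nlinarith [sq_nonneg B]

end Innovation

/-- Noise with conditional mean zero and a conditional second moment of order `(k + 1) ^ (-α)`,
in the weak form that is used with past factors. -/
structure Perturbation (P : Measure Ω) (𝓕 : Filtration ℕ mΩ) (α c : ℝ) (δ : ℕ → Ω → ℝ) :
    Prop where
  meas : ∀ k, Measurable[𝓕 (k + 1)] (δ k)
  orth : ∀ k (Y : Ω → ℝ), Measurable[𝓕 k] Y → Integrable (fun ω => Y ω * δ k ω) P →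
    ∫ ω, Y ω * δ k ω ∂P = 0
  memLp : ∀ k (Y : Ω → ℝ), Measurable[𝓕 k] Y → MemLp Y 4 P → MemLp (fun ω => Y ω * δ k ω) 2 P
  sq_le : ∀ k (Y : Ω → ℝ), Measurable[𝓕 k] Y → MemLp Y 4 P →
    ∫ ω, (Y ω * δ k ω) ^ 2 ∂P ≤ c * √(∫ ω, Y ω ^ 4 ∂P) * ((k : ℝ) + 1) ^ (-α)

section Perturbation

variable [IsProbabilityMeasure P] {α c : ℝ} {δ : ℕ → Ω → ℝ}

omit [IsProbabilityMeasure P] in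
lemma Perturbation.mdiff_mul (h : Perturbation P 𝓕 α c δ) {Y : ℕ → Ω → ℝ}
    (hY : ∀ k, Measurable[𝓕 k] (Y k)) (hY4 : ∀ k, MemLp (Y k) 4 P) :
    MDiff P 𝓕 (fun k ω => Y k ω * δ k ω) where
  meas k := ((hY k).mono (𝓕.mono k.le_succ) le_rfl).mul (h.meas k)
  memLp k := h.memLp k _ (hY k) (hY4 k)
  orth k X hX hX2 := by
    simp only [← mul_assoc]
    refine h.orth k _ (hX.mul (hY k)) ?_
    simpa only [mul_assoc] using integrable_mul_of_memLp hX2 (h.memLp k _ (hY k) (hY4 k))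

lemma Perturbation.mdiff (h : Perturbation P 𝓕 α c δ) : MDiff P 𝓕 δ := by
  have := h.mdiff_mul (Y := fun _ _ => 1) (fun _ => measurable_const) (fun _ => memLp_const 1)
  simpa using this

lemma Perturbation.integral_sq_le (h : Perturbation P 𝓕 α c δ) (k : ℕ) :
    ∫ ω, δ k ω ^ 2 ∂P ≤ c * ((k : ℝ) + 1) ^ (-α) := by
  have := h.sq_le k (fun _ => 1) measurable_const (memLp_const 1)
  simpa using this

end Perturbation

end Martingale


/-! ### Power sums, and summation over blocks of indices. -/

section PowerSums

/-- By induction: Bernoulli's inequality for the exponent `1 + s` in `(0, 1]` gives `(1 + s)(n +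
1)^s ≤ (n + 1)^(1 + s) - n^(1 + s)`. -/
lemma sum_range_rpow_neg_le {s : ℝ} (h0 : -1 < s) (h1 : s ≤ 0) (n : ℕ) :
    ∑ k ∈ Finset.range n, ((k : ℝ) + 1) ^ s ≤ (1 + s)⁻¹ * (n : ℝ) ^ (1 + s) := by
  have hp : 0 < 1 + s := by linarith
  induction n with
  | zero => simp [Real.zero_rpow hp.ne']
  | succ n ih =>
    rw [Finset.sum_range_succ]
    have hb := rpow_one_add_le_one_add_mul_self (s := -1 / ((n : ℝ) + 1)) (p := 1 + s)
      (by rw [neg_div, neg_le_neg_iff, div_le_one (by positivity)]; linarith [n.cast_nonneg (α := ℝ)])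
      hp.le (by linarith)
    have hn : (0 : ℝ) < (n : ℝ) + 1 := by positivity
    have e1 : (n : ℝ) = (n + 1) * (1 + -1 / ((n : ℝ) + 1)) := by field_simp; ring
    have e2 : (n : ℝ) ^ (1 + s) ≤ ((n : ℝ) + 1) ^ (1 + s) - (1 + s) * ((n : ℝ) + 1) ^ s := by
      have hnn : 0 ≤ 1 + -1 / ((n : ℝ) + 1) := by
        have : 1 / ((n : ℝ) + 1) ≤ 1 := by
          rw [div_le_one hn]; linarith [n.cast_nonneg (α := ℝ)]
        rw [neg_div]; linarith
      conv_lhs => rw [e1]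
      rw [Real.mul_rpow hn.le hnn]
      calc ((n : ℝ) + 1) ^ (1 + s) * (1 + -1 / ((n : ℝ) + 1)) ^ (1 + s)
          ≤ ((n : ℝ) + 1) ^ (1 + s) * (1 + (1 + s) * (-1 / ((n : ℝ) + 1))) := by gcongr
        _ = _ := by
          rw [Real.rpow_add hn, Real.rpow_one]
          field_simp
          ring
    push_cast
    calc _ ≤ (1 + s)⁻¹ * (((n : ℝ) + 1) ^ (1 + s) - (1 + s) * ((n : ℝ) + 1) ^ s)
          + ((n : ℝ) + 1) ^ s := by gcongr; exact ih.trans (by gcongr)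
      _ = _ := by field_simp; ring

/-- Power sums of order above `-1`. -/
lemma exists_sum_rpow_le {s : ℝ} (hs : -1 < s) :
    ∃ c : ℝ, 0 ≤ c ∧ ∀ n : ℕ, 1 ≤ n → ∀ S ⊆ Finset.range (n + 1),
      ∑ k ∈ S, ((k : ℝ) + 1) ^ s ≤ c * (n : ℝ) ^ (1 + s) := by
  have hp : 0 < 1 + s := by linarith
  rcases le_or_gt s 0 with h | h
  · refine ⟨(1 + s)⁻¹ * 2 ^ (1 + s), by positivity, fun n hn S hS => ?_⟩
    have hn' : (1 : ℝ) ≤ n := by exact_mod_cast hn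
    calc _ ≤ ∑ k ∈ Finset.range (n + 1), ((k : ℝ) + 1) ^ s :=
          Finset.sum_le_sum_of_subset_of_nonneg hS fun _ _ _ => by positivity
      _ ≤ (1 + s)⁻¹ * ((n + 1 : ℕ) : ℝ) ^ (1 + s) := sum_range_rpow_neg_le hs h _
      _ ≤ (1 + s)⁻¹ * (2 * (n : ℝ)) ^ (1 + s) := by gcongr; push_cast; linarith
      _ = _ := by rw [Real.mul_rpow (by norm_num) (by positivity)]; ring
  · refine ⟨2 * 2 ^ s, by positivity, fun n hn S hS => ?_⟩
    have hn' : (1 : ℝ) ≤ n := by exact_mod_cast hn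
    calc _ ≤ ∑ k ∈ Finset.range (n + 1), ((k : ℝ) + 1) ^ s :=
          Finset.sum_le_sum_of_subset_of_nonneg hS fun _ _ _ => by positivity
      _ ≤ ∑ k ∈ Finset.range (n + 1), (2 * (n : ℝ)) ^ s := by
          refine Finset.sum_le_sum fun k hk => ?_
          have : (k : ℝ) ≤ n := by
            exact_mod_cast Nat.lt_succ_iff.1 (Finset.mem_range.1 hk)
          gcongr
          linarith
      _ = ((n : ℝ) + 1) * (2 * (n : ℝ)) ^ s := by simp
      _ ≤ (2 * n) * (2 * (n : ℝ)) ^ s := by gcongr; linarith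
      _ = _ := by
          rw [Real.mul_rpow (by norm_num) (by positivity), Real.rpow_add (by positivity),
            Real.rpow_one]
          ring

/-- Power sums of order below `-1`. -/
lemma exists_sum_rpow_le_const {s : ℝ} (hs : s < -1) :
    ∃ c : ℝ, 0 ≤ c ∧ ∀ S : Finset ℕ, ∑ k ∈ S, ((k : ℝ) + 1) ^ s ≤ c := by
  have h := (summable_nat_add_iff 1).2 (Real.summable_nat_rpow.2 hs)
  refine ⟨∑' k : ℕ, ((k + 1 : ℕ) : ℝ) ^ s, tsum_nonneg fun _ => by positivity, fun S => ?_⟩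
  have := h.sum_le_tsum S fun _ _ => by positivity
  simpa using this

lemma rpow_sub_rpow_le {a : ℝ} (ha : 1 ≤ a) {α : ℝ} (h1 : α ≤ 1) (h0 : 0 < α) :
    a ^ α - (a - 1) ^ α ≤ a ^ (α - 1) := by
  have ha0 : 0 < a := by linarith
  have key : a ^ (α - 1) * (a - 1) ≤ (a - 1) ^ α := by
    rcases eq_or_lt_of_le ha with h | h
    · rw [← h]; simp [Real.zero_rpow h0.ne']
    · have h2 : 0 < a - 1 := by linarith
      have h3 : a ^ (α - 1) ≤ (a - 1) ^ (α - 1) :=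
        Real.rpow_le_rpow_of_nonpos h2 (by linarith) (by linarith)
      calc _ ≤ (a - 1) ^ (α - 1) * (a - 1) := by gcongr
        _ = _ := by rw [Real.rpow_sub_one h2.ne']; field_simp
  have e : a ^ α = a ^ (α - 1) * a := by rw [Real.rpow_sub_one ha0.ne']; field_simp
  rw [e]; linarith

end PowerSums

section Blocks

/-- Consecutive blocks of indices: `t i` is the first index of the block that contains `i`. -/
structure Blocks (t : ℕ → ℕ) (c0 : ℝ) : Prop where
  le : ∀ i, t i ≤ i
  const : ∀ i k : ℕ, t i ≤ k → k ≤ i → t k = t i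
  comparable : ∀ i : ℕ, (i : ℝ) + 1 ≤ c0 * ((t i : ℝ) + 1)

variable {t : ℕ → ℕ} {c0 : ℝ}

/-- The number of indices from the first one of the block of `i` to `i`. -/
def len (t : ℕ → ℕ) (i : ℕ) : ℕ := i - t i + 1

lemma Blocks.card_Icc (h : Blocks t c0) (i : ℕ) : (Finset.Icc (t i) i).card = len t i := by
  have := h.le i
  simp [len]; omega

lemma Blocks.one_le (h : Blocks t c0) : 1 ≤ c0 := by
  have h1 := h.comparable 0
  have h2 : t 0 = 0 := by have := h.le 0; omega
  simpa [h2] using h1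

/-- `comparable` bounds `i + 1` by `c0 (k + 1)` from the first index of the block on, so negative
powers are of one order along a block. -/
lemma Blocks.rpow_le (h : Blocks t c0) {s : ℝ} (hs : s ≤ 0) {i k : ℕ} (hk : t i ≤ k) :
    ((k : ℝ) + 1) ^ s ≤ c0 ^ (-s) * ((i : ℝ) + 1) ^ s := by
  have h0 := h.one_le
  have hk' : (t i : ℝ) ≤ k := by exact_mod_cast hk
  have h1 : (i : ℝ) + 1 ≤ c0 * ((k : ℝ) + 1) :=
    (h.comparable i).trans (by gcongr)
  have h2 : (c0 * ((k : ℝ) + 1)) ^ s ≤ ((i : ℝ) + 1) ^ s :=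
    Real.rpow_le_rpow_of_nonpos (by positivity) h1 hs
  rw [Real.mul_rpow (by positivity) (by positivity)] at h2
  calc ((k : ℝ) + 1) ^ s = c0 ^ (-s) * (c0 ^ s * ((k : ℝ) + 1) ^ s) := by
        rw [← mul_assoc, ← Real.rpow_add (by positivity)]; simp
    _ ≤ _ := by gcongr

lemma Blocks.sum_rpow_le (h : Blocks t c0) {s : ℝ} (hs : s ≤ 0) {i lam : ℕ}
    (hi : len t i ≤ lam) {S : Finset ℕ} (hS : S ⊆ Finset.Icc (t i) i) :
    ∑ k ∈ S, ((k : ℝ) + 1) ^ s ≤ c0 ^ (-s) * (lam * ((i : ℝ) + 1) ^ s) := by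
  have h0 := h.one_le
  have hc : (S.card : ℝ) ≤ lam := by
    have := Finset.card_le_card hS
    rw [h.card_Icc] at this
    exact_mod_cast this.trans hi
  calc _ ≤ ∑ k ∈ S, c0 ^ (-s) * ((i : ℝ) + 1) ^ s :=
        Finset.sum_le_sum fun k hk => h.rpow_le hs (Finset.mem_Icc.1 (hS hk)).1
    _ = S.card * (c0 ^ (-s) * ((i : ℝ) + 1) ^ s) := by simp
    _ ≤ lam * (c0 ^ (-s) * ((i : ℝ) + 1) ^ s) := by gcongr
    _ = _ := by ring

/-- The number of indices `i ≤ n` whose block, cut at `i`, contains `k`. -/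
noncomputable def mult (t : ℕ → ℕ) (n k : ℕ) : ℝ :=
  ((Finset.Icc 1 n).filter fun i => t i ≤ k ∧ k ≤ i).card

lemma mult_nonneg (t : ℕ → ℕ) (n k : ℕ) : 0 ≤ mult t n k := Nat.cast_nonneg _

lemma sum_blocks (t : ℕ → ℕ) (n : ℕ) (f : ℕ → ℝ) :
    ∑ i ∈ Finset.Icc 1 n, ∑ k ∈ Finset.Icc (t i) i, f k
      = ∑ k ∈ Finset.range (n + 1), mult t n k * f k := by
  rw [Finset.sum_comm' (t' := Finset.range (n + 1))
    (s' := fun k => (Finset.Icc 1 n).filter fun i => t i ≤ k ∧ k ≤ i)]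
  · simp [mult]
  · intro i k
    simp only [Finset.mem_Icc, Finset.mem_filter, Finset.mem_range]
    omega

/-- An index `i` counted for `k` satisfies `k ≤ i < k + lam`, since its cut block reaches from `k`
or earlier up to `i`. -/
lemma mult_le {n lam : ℕ} (hlam : ∀ i ≤ n, len t i ≤ lam) (k : ℕ) : mult t n k ≤ lam := by
  have h : (Finset.Icc 1 n).filter (fun i => t i ≤ k ∧ k ≤ i) ⊆ Finset.Ico k (k + lam) := by
    intro i hi
    simp only [Finset.mem_filter, Finset.mem_Icc] at hi
    have := hlam i hi.1.2
    unfold len at this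
    simp only [Finset.mem_Ico]
    omega
  have := Finset.card_le_card h
  rw [Nat.card_Ico, Nat.add_sub_cancel_left] at this
  unfold mult
  exact_mod_cast this

/-- Summation by parts for a linear recursion. -/
lemma sum_eq_of_recursion {x y h v : ℕ → ℝ} (hrec : ∀ k, x k = h k * (y k - y (k + 1)) - v k)
    {a b : ℕ} (hab : a ≤ b) :
    ∑ k ∈ Finset.Icc a b, x k = -(∑ k ∈ Finset.Icc a b, v k)
      + (∑ k ∈ Finset.Ioc a b, (h k - h (k - 1)) * y k) + h a * y a - h b * y (b + 1) := by
  induction b, hab using Nat.le_induction with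
  | base => simp [hrec a]; ring
  | succ b hab ih =>
    rw [Finset.sum_Icc_succ_top (by omega), Finset.sum_Icc_succ_top (by omega), ih,
      Finset.sum_Ioc_succ_top hab, hrec (b + 1), Nat.add_sub_cancel]
    ring

/-- Summation by parts against block sums. -/
lemma sum_mul_sub_eq {m z κ ξ θ : ℕ → ℝ} (hm : ∀ i, m (i + 1) = m i + ξ (i + 1) - θ i * m i)
    (n : ℕ) :
    ∑ i ∈ Finset.Icc 1 n, κ i * m i * (z (i + 1) - z (i + 2))
      = (∑ i ∈ Finset.Icc 1 n, (κ i - κ (i - 1)) * (m i * z (i + 1)))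
        + κ 0 * (m 1 * z 2) - κ n * (m (n + 1) * z (n + 2))
        + (∑ i ∈ Finset.Icc 1 n, κ i * (ξ (i + 1) * z (i + 1)))
        - (∑ i ∈ Finset.Icc 1 n, κ i * (ξ (i + 1) * (z (i + 1) - z (i + 2))))
        - ∑ i ∈ Finset.Icc 1 n, κ i * (θ i * m i * z (i + 2)) := by
  induction n with
  | zero => simp
  | succ n ih =>
    simp only [Finset.sum_Icc_succ_top (show 1 ≤ n + 1 by omega)]
    rw [ih, Nat.add_sub_cancel, hm (n + 1)]
    ring

/-- The square of a sum, minus its compensator, as a sum of increments. -/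
lemma sq_sum_sub_eq (ξ : ℕ → ℝ) (s : ℝ) {a b : ℕ} (hab : a ≤ b) :
    (∑ k ∈ Finset.Icc a b, ξ k) ^ 2 - ((b : ℝ) - a + 1) * s
      = ∑ k ∈ Finset.Icc a b, (2 * ((∑ j ∈ Finset.Ico a k, ξ j) * ξ k) + (ξ k ^ 2 - s)) := by
  induction b, hab using Nat.le_induction with
  | base => simp
  | succ b hab ih =>
    rw [Finset.sum_Icc_succ_top (by omega), Finset.sum_Icc_succ_top (by omega), ← ih]
    have : Finset.Ico a (b + 1) = Finset.Icc a b := by ext; simp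
    rw [this]
    push_cast
    ring

end Blocks


/-! ### The scalar linearized recursion and its sums over blocks. -/

/-- The inverse step size. -/
noncomputable def invStep (η α : ℝ) (k : ℕ) : ℝ := η⁻¹ * ((k : ℝ) + 1) ^ α

lemma invStep_pos {η α : ℝ} (hη : 0 < η) (k : ℕ) : 0 < invStep η α k := by
  unfold invStep; positivity

lemma invStep_mono {η α : ℝ} (hη : 0 < η) (hα : 0 ≤ α) : Monotone (invStep η α) := by
  intro a b hab
  have : (a : ℝ) ≤ b := by exact_mod_cast hab
  unfold invStep
  gcongr

lemma invStep_sub_le {η α : ℝ} (hη : 0 < η) (h0 : 0 < α) (h1 : α ≤ 1) {k : ℕ} (hk : 1 ≤ k) :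
    |invStep η α k - invStep η α (k - 1)| ≤ η⁻¹ * ((k : ℝ) + 1) ^ (α - 1) := by
  rw [abs_of_nonneg (sub_nonneg.2 (invStep_mono hη h0.le (Nat.sub_le k 1)))]
  have := rpow_sub_rpow_le (a := (k : ℝ) + 1) (by linarith [k.cast_nonneg (α := ℝ)]) h1 h0
  unfold invStep
  rw [Nat.cast_sub hk, ← mul_sub, Nat.cast_one, sub_add_cancel]
  rw [add_sub_cancel_right] at this
  gcongr

section Component

variable {Ω : Type*} {mΩ : MeasurableSpace Ω}

/-- A scalar component of a linearized stochastic approximation recursion: `y` is driven by the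
drift `x`, a remainder `r`, a perturbation `δ` and the innovation `ξ`. -/
structure Component (P : Measure Ω) (𝓕 : Filtration ℕ mΩ) (α η c : ℝ)
    (x y r δ ξ : ℕ → Ω → ℝ) : Prop where
  step : ∀ k ω, y (k + 1) ω
    = y k ω - η * ((k : ℝ) + 1) ^ (-α) * (x k ω + (r k ω + δ k ω + ξ k ω))
  meas : ∀ k, Measurable[𝓕 k] (y k)
  memLp_x : ∀ k, MemLp (x k) 2 P
  memLp_y : ∀ k, MemLp (y k) 2 P
  memLp_r : ∀ k, MemLp (r k) 2 P
  n2_x : ∀ k : ℕ, n2 P (x k) ≤ c * ((k : ℝ) + 1) ^ (-(α / 2))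
  n2_y : ∀ k : ℕ, n2 P (y k) ≤ c * ((k : ℝ) + 1) ^ (-(α / 2))
  n2_r : ∀ k : ℕ, n2 P (r k) ≤ c * ((k : ℝ) + 1) ^ (-α)
  pert : Perturbation P 𝓕 α c δ
  c_nonneg : 0 ≤ c

/-- The part of a sum of drifts that is negligible in mean square: perturbations, remainders, and
the variation of the step sizes. -/
noncomputable def rem (η α : ℝ) (y r δ : ℕ → Ω → ℝ) (a b : ℕ) (ω : Ω) : ℝ :=
  -(∑ k ∈ Finset.Icc a b, δ k ω) - (∑ k ∈ Finset.Icc a b, r k ω)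
    + ∑ k ∈ Finset.Ioc a b, (invStep η α k - invStep η α (k - 1)) * y k ω

/-- The difference between a sum of drifts and the opposite sum of innovations. -/
noncomputable def bdry (η α : ℝ) (y r δ : ℕ → Ω → ℝ) (a b : ℕ) (ω : Ω) : ℝ :=
  rem η α y r δ a b ω + (invStep η α a * y a ω - invStep η α b * y (b + 1) ω)

variable {P : Measure Ω} {𝓕 : Filtration ℕ mΩ} {α η c s B c0 : ℝ}
  {x y r δ ξ : ℕ → Ω → ℝ} {t : ℕ → ℕ}

lemma Component.drift_eq (h : Component P 𝓕 α η c x y r δ ξ) (hη : 0 < η) (k : ℕ) (ω : Ω) :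
    x k ω = invStep η α k * (y k ω - y (k + 1) ω) - (r k ω + δ k ω + ξ k ω) := by
  rw [h.step k ω, invStep, Real.rpow_neg (by positivity)]
  field_simp
  ring

/-- The recursion solved for the drift and summed by parts: what remains besides the innovations is
a pair of end terms and the small terms of `rem`. -/
lemma Component.sum_drift_eq (h : Component P 𝓕 α η c x y r δ ξ) (hη : 0 < η) {a b : ℕ}
    (hab : a ≤ b) (ω : Ω) :
    ∑ k ∈ Finset.Icc a b, x k ω
      = -(∑ k ∈ Finset.Icc a b, ξ k ω) + bdry η α y r δ a b ω := by
  rw [sum_eq_of_recursion (x := fun k => x k ω) (fun k => h.drift_eq hη k ω) hab, bdry, rem,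
    Finset.sum_add_distrib, Finset.sum_add_distrib]
  ring

variable [IsProbabilityMeasure P]

lemma Component.memLp_rem (h : Component P 𝓕 α η c x y r δ ξ) (a b : ℕ) :
    MemLp (rem η α y r δ a b) 2 P :=
  (((memLp_finsetSum _ fun k _ => h.pert.mdiff.memLp k).neg).sub
    (memLp_finsetSum _ fun k _ => h.memLp_r k)).add
    (memLp_finsetSum _ fun k _ => (h.memLp_y k).const_mul _)

lemma Component.memLp_bdry (h : Component P 𝓕 α η c x y r δ ξ) (a b : ℕ) :
    MemLp (bdry η α y r δ a b) 2 P :=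
  (h.memLp_rem a b).add (((h.memLp_y a).const_mul _).sub ((h.memLp_y (b + 1)).const_mul _))

/-- Perturbations are orthogonal, so their squares add and a square root appears; remainders and
step-size variations are only bounded by the triangle inequality. -/
lemma Component.n2_rem_le (h : Component P 𝓕 α η c x y r δ ξ) (hη : 0 < η) (h0 : 0 < α)
    (h1 : α ≤ 1) (a b : ℕ) :
    n2 P (rem η α y r δ a b)
      ≤ √(c * ∑ k ∈ Finset.Icc a b, ((k : ℝ) + 1) ^ (-α))
        + c * ∑ k ∈ Finset.Icc a b, ((k : ℝ) + 1) ^ (-α)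
        + η⁻¹ * c * ∑ k ∈ Finset.Ioc a b, ((k : ℝ) + 1) ^ (α / 2 - 1) := by
  have hc := h.c_nonneg
  have mδ : MemLp (fun ω => ∑ k ∈ Finset.Icc a b, δ k ω) 2 P :=
    memLp_finsetSum _ fun k _ => h.pert.mdiff.memLp k
  have mr : MemLp (fun ω => ∑ k ∈ Finset.Icc a b, r k ω) 2 P :=
    memLp_finsetSum _ fun k _ => h.memLp_r k
  have my : ∀ k, MemLp (fun ω => (invStep η α k - invStep η α (k - 1)) * y k ω) 2 P :=
    fun k => (h.memLp_y k).const_mul _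
  refine (n2_add_le (X := fun ω => -(∑ k ∈ Finset.Icc a b, δ k ω)
    - (∑ k ∈ Finset.Icc a b, r k ω)) (mδ.neg.sub mr)
    (memLp_finsetSum _ fun k _ => my k)).trans ?_
  refine add_le_add ((n2_sub_le (X := fun ω => -(∑ k ∈ Finset.Icc a b, δ k ω)) mδ.neg mr).trans
    (add_le_add ?_ ?_)) ?_
  · rw [n2_neg]
    have := h.pert.mdiff.n2_sum_smul_le (Finset.Icc a b) (fun _ => 1)
      (fun k => c * ((k : ℝ) + 1) ^ (-α)) (fun k _ => by simpa using h.pert.integral_sq_le k)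
    simpa [Finset.mul_sum] using this
  · refine (n2_sum_le _ fun k _ => h.memLp_r k).trans ?_
    rw [Finset.mul_sum]
    exact Finset.sum_le_sum fun k _ => h.n2_r k
  · refine (n2_sum_le _ fun k _ => my k).trans ?_
    rw [Finset.mul_sum]
    refine Finset.sum_le_sum fun k hk => ?_
    rw [n2_const_mul]
    have hk1 : 1 ≤ k := by have := (Finset.mem_Ioc.1 hk).1; omega
    calc _ ≤ (η⁻¹ * ((k : ℝ) + 1) ^ (α - 1)) * (c * ((k : ℝ) + 1) ^ (-(α / 2))) :=
          mul_le_mul (invStep_sub_le hη h0 h1 hk1) (h.n2_y k) (n2_nonneg _) (by positivity)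
      _ = η⁻¹ * c * (((k : ℝ) + 1) ^ (α - 1) * ((k : ℝ) + 1) ^ (-(α / 2))) := by ring
      _ = _ := by rw [← Real.rpow_add (by positivity)]; congr 2; ring

/-- The order of `rem` on a block. -/
noncomputable def remRate (α : ℝ) (lam i : ℕ) : ℝ :=
  √lam * ((i : ℝ) + 1) ^ (-(α / 2)) + lam * ((i : ℝ) + 1) ^ (-α)
    + lam * ((i : ℝ) + 1) ^ (α / 2 - 1)

lemma Component.exists_n2_rem_le (h : Component P 𝓕 α η c x y r δ ξ) (hη : 0 < η) (h0 : 0 < α)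
    (h1 : α ≤ 1) (hb : Blocks t c0) :
    ∃ K, 0 ≤ K ∧ ∀ i lam, len t i ≤ lam →
      n2 P (rem η α y r δ (t i) i) ≤ K * remRate α lam i := by
  have hc := h.c_nonneg
  have hc0 := hb.one_le
  refine ⟨√(c * c0 ^ α) + c * c0 ^ α + η⁻¹ * c * c0 ^ (1 - α / 2), by positivity,
    fun i lam hi => ?_⟩
  refine (h.n2_rem_le hη h0 h1 _ _).trans ?_
  have s1 := hb.sum_rpow_le (s := -α) (by linarith) hi (Finset.Subset.refl _)
  have s2 := hb.sum_rpow_le (s := α / 2 - 1) (by linarith) hi Finset.Ioc_subset_Icc_self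
  rw [neg_neg] at s1
  rw [neg_sub] at s2
  have r1 : √(((i : ℝ) + 1) ^ (-α)) = ((i : ℝ) + 1) ^ (-(α / 2)) := by
    rw [Real.sqrt_eq_rpow, ← Real.rpow_mul (by positivity)]; congr 1; ring
  have e1 : √(c * ∑ k ∈ Finset.Icc (t i) i, ((k : ℝ) + 1) ^ (-α))
      ≤ √(c * c0 ^ α) * (√lam * ((i : ℝ) + 1) ^ (-(α / 2))) := by
    rw [← r1, ← Real.sqrt_mul (by positivity), ← Real.sqrt_mul (by positivity)]
    refine Real.sqrt_le_sqrt ?_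
    calc _ ≤ c * (c0 ^ α * (lam * ((i : ℝ) + 1) ^ (-α))) := by gcongr
      _ = _ := by ring
  have e2 : c * ∑ k ∈ Finset.Icc (t i) i, ((k : ℝ) + 1) ^ (-α)
      ≤ c * c0 ^ α * (lam * ((i : ℝ) + 1) ^ (-α)) := by
    calc _ ≤ c * (c0 ^ α * (lam * ((i : ℝ) + 1) ^ (-α))) := by gcongr
      _ = _ := by ring
  have e3 : η⁻¹ * c * ∑ k ∈ Finset.Ioc (t i) i, ((k : ℝ) + 1) ^ (α / 2 - 1)
      ≤ η⁻¹ * c * c0 ^ (1 - α / 2) * (lam * ((i : ℝ) + 1) ^ (α / 2 - 1)) := by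
    calc _ ≤ η⁻¹ * c * (c0 ^ (1 - α / 2) * (lam * ((i : ℝ) + 1) ^ (α / 2 - 1))) := by gcongr
      _ = _ := by ring
  refine (add_le_add (add_le_add e1 e2) e3).trans ?_
  unfold remRate
  set A := √(c * c0 ^ α)
  set A' := c * c0 ^ α
  set A'' := η⁻¹ * c * c0 ^ (1 - α / 2)
  have hA : 0 ≤ A := Real.sqrt_nonneg _
  have hA' : 0 ≤ A' := by positivity
  have hA'' : 0 ≤ A'' := by positivity
  set u := √lam * ((i : ℝ) + 1) ^ (-(α / 2))
  set v := lam * ((i : ℝ) + 1) ^ (-α)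
  set w := lam * ((i : ℝ) + 1) ^ (α / 2 - 1)
  have hu : 0 ≤ u := by positivity
  have hv : 0 ≤ v := by positivity
  have hw : 0 ≤ w := by positivity
  nlinarith [mul_nonneg hA hv, mul_nonneg hA hw, mul_nonneg hA' hu, mul_nonneg hA' hw,
    mul_nonneg hA'' hu, mul_nonneg hA'' hv]

omit [IsProbabilityMeasure P] in
-- The inverse step grows like `j^α` and `y` decays like `j^(-α/2)`, so an end term has order
-- `i^(α/2)`.
lemma Component.n2_scaled_le (h : Component P 𝓕 α η c x y r δ ξ) (hη : 0 < η) (h0 : 0 < α)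
    {j k i : ℕ} (hjk : j ≤ k) (hji : j ≤ i) :
    n2 P (fun ω => invStep η α j * y k ω) ≤ η⁻¹ * c * ((i : ℝ) + 1) ^ (α / 2) := by
  have hc := h.c_nonneg
  have hj : (j : ℝ) ≤ k := by exact_mod_cast hjk
  have hi : (j : ℝ) ≤ i := by exact_mod_cast hji
  rw [n2_const_mul, abs_of_pos (invStep_pos hη j)]
  calc _ ≤ invStep η α j * (c * ((k : ℝ) + 1) ^ (-(α / 2))) := by
        have := (invStep_pos (α := α) hη j).le
        gcongr; exact h.n2_y k
    _ ≤ invStep η α j * (c * ((j : ℝ) + 1) ^ (-(α / 2))) := by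
        have h1 := (invStep_pos (α := α) hη j).le
        have h2 : ((k : ℝ) + 1) ^ (-(α / 2)) ≤ ((j : ℝ) + 1) ^ (-(α / 2)) :=
          Real.rpow_le_rpow_of_nonpos (by positivity) (by linarith) (by linarith)
        gcongr
    _ = η⁻¹ * c * (((j : ℝ) + 1) ^ α * ((j : ℝ) + 1) ^ (-(α / 2))) := by unfold invStep; ring
    _ = η⁻¹ * c * ((j : ℝ) + 1) ^ (α / 2) := by
        rw [← Real.rpow_add (by positivity)]; congr 2; ring
    _ ≤ _ := by gcongr

lemma Component.n2_bdry_le (h : Component P 𝓕 α η c x y r δ ξ) (hη : 0 < η) (h0 : 0 < α)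
    {a b : ℕ} (hab : a ≤ b) :
    n2 P (bdry η α y r δ a b)
      ≤ n2 P (rem η α y r δ a b) + 2 * (η⁻¹ * c) * ((b : ℝ) + 1) ^ (α / 2) := by
  refine (n2_add_le (h.memLp_rem a b)
    (((h.memLp_y a).const_mul _).sub ((h.memLp_y (b + 1)).const_mul _))).trans ?_
  have h2 := n2_sub_le ((h.memLp_y a).const_mul (invStep η α a))
    ((h.memLp_y (b + 1)).const_mul (invStep η α b))
  have h3 := h.n2_scaled_le hη h0 le_rfl hab
  have h4 := h.n2_scaled_le (i := b) hη h0 (Nat.le_succ b) le_rfl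
  refine add_le_add_right (h2.trans ?_) _
  linarith

end Component

/-! ### The leading martingale part, and sums of the remainder orders. -/

section Main

variable {Ω : Type*} {mΩ : MeasurableSpace Ω} {P : Measure Ω} {𝓕 : Filtration ℕ mΩ}
  {α η c s B c0 : ℝ} {x y r δ ξ : ℕ → Ω → ℝ} {t : ℕ → ℕ}

/-- The block sums of the innovations. -/
noncomputable def blockSum (t : ℕ → ℕ) (ξ : ℕ → Ω → ℝ) (i : ℕ) (ω : Ω) : ℝ :=
  ∑ k ∈ Finset.Icc (t i) i, ξ k ω

variable [IsProbabilityMeasure P]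

omit [IsProbabilityMeasure P] in
lemma Innovation.memLp_blockSum (h : Innovation P 𝓕 s B ξ) (i : ℕ) :
    MemLp (blockSum t ξ i) 4 P := h.memLp_sum _

lemma Innovation.memLp_two_blockSum (h : Innovation P 𝓕 s B ξ) (i : ℕ) :
    MemLp (blockSum t ξ i) 2 P := memLp_two_of_four (h.memLp_blockSum i)

lemma Innovation.integral_blockSum_sq_le (h : Innovation P 𝓕 s B ξ) (hb : Blocks t c0)
    {i lam : ℕ} (hi : len t i ≤ lam) : ∫ ω, blockSum t ξ i ω ^ 2 ∂P ≤ lam * B := by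
  have h2 : (len t i : ℝ) ≤ lam := by exact_mod_cast hi
  unfold blockSum
  rw [h.integral_sum_sq, hb.card_Icc]
  exact mul_le_mul h2 h.s_le h.s_nonneg (by positivity)

lemma Innovation.n2_blockSum_le (h : Innovation P 𝓕 s B ξ) (hb : Blocks t c0) {i lam : ℕ}
    (hi : len t i ≤ lam) : n2 P (blockSum t ξ i) ≤ √lam * √B := by
  rw [n2, ← Real.sqrt_mul (by positivity)]
  exact Real.sqrt_le_sqrt (h.integral_blockSum_sq_le hb hi)

/-- The main, martingale, part of the error. -/
lemma Innovation.integral_abs_sum_blockSum_sq_le (h : Innovation P 𝓕 s B ξ) (hb : Blocks t c0)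
    {n lam : ℕ} (hn : 1 ≤ n) (hlam : ∀ i ≤ n, len t i ≤ lam) :
    Integrable (fun ω => ∑ i ∈ Finset.Icc 1 n, (blockSum t ξ i ω ^ 2 - len t i * s)) P ∧
    ∫ ω, |∑ i ∈ Finset.Icc 1 n, (blockSum t ξ i ω ^ 2 - len t i * s)| ∂P
      ≤ 5 * B * (lam * √lam * √n) := by
  have hB := h.B_nonneg
  set Y : ℕ → Ω → ℝ := fun k ω => 2 * ∑ j ∈ Finset.Ico (t k) k, ξ j ω with hY
  have hYm : ∀ k, Measurable[𝓕 k] (Y k) := fun k =>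
    (measurable_sum_of_lt h.meas fun j hj => (Finset.mem_Ico.1 hj).2).const_mul 2
  have hY2 : ∀ k, MemLp (Y k) 2 P := fun k =>
    (memLp_two_of_four (h.memLp_sum _)).const_mul 2
  set d : ℕ → Ω → ℝ := fun k ω => Y k ω * ξ k ω + (ξ k ω ^ 2 - s) with hd
  have md : MDiff P 𝓕 d := (h.mdiff_mul hYm hY2).add h.mdiff_sq
  -- Each compensated square is a sum of martingale increments `d k` that do not depend on the cut
  -- `i`; exchanging the sums weights `d k` by `mult t n k ≤ lam`.
  have e : ∀ ω, ∑ i ∈ Finset.Icc 1 n, (blockSum t ξ i ω ^ 2 - len t i * s)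
      = ∑ k ∈ Finset.range (n + 1), mult t n k * d k ω := by
    intro ω
    rw [← sum_blocks]
    refine Finset.sum_congr rfl fun i _ => ?_
    have h1 := sq_sum_sub_eq (fun k => ξ k ω) s (hb.le i)
    have h2 : (len t i : ℝ) = (i : ℝ) - t i + 1 := by
      have := hb.le i
      unfold len; push_cast [this]; ring
    rw [h2]
    refine h1.trans (Finset.sum_congr rfl fun k hk => ?_)
    simp only [hd, hY]
    rw [hb.const i k (Finset.mem_Icc.1 hk).1 (Finset.mem_Icc.1 hk).2]
    ring
  have hm : MemLp (fun ω => ∑ k ∈ Finset.range (n + 1), mult t n k * d k ω) 2 P :=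
    memLp_finsetSum _ fun k _ => (md.memLp k).const_mul _
  simp only [e]
  refine ⟨hm.integrable one_le_two, (integral_abs_le_n2 hm).trans ?_⟩
  have hs := h.s_le
  have hs0 := h.s_nonneg
  refine (md.n2_sum_smul_le _ _ (fun _ => (lam : ℝ) ^ 2 * (10 * lam * B ^ 2))
    fun k hk => ?_).trans ?_
  · have hkn : k ≤ n := Nat.lt_succ_iff.1 (Finset.mem_range.1 hk)
    have hl1 : 1 ≤ lam := le_trans (by unfold len; omega) (hlam k hkn)
    have hl1' : (1 : ℝ) ≤ lam := by exact_mod_cast hl1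
    have i1 : Integrable (fun ω => 2 * (Y k ω * ξ k ω) ^ 2) P :=
      (integrable_pow_two (h.memLp_mul (hYm k) (hY2 k))).const_mul 2
    have i2 : Integrable (fun ω => 2 * ξ k ω ^ 4) P :=
      (integrable_pow_four (h.memLp k)).const_mul 2
    have i3 : Integrable (fun ω => 2 * (Y k ω * ξ k ω) ^ 2 + 2 * ξ k ω ^ 4) P := i1.add i2
    have i4 : Integrable (fun ω => 4 * s * ξ k ω ^ 2) P :=
      (integrable_pow_two (memLp_two_of_four (h.memLp k))).const_mul _
    have i5 : Integrable (fun _ : Ω => 2 * s ^ 2) P := integrable_const _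
    have i6 : Integrable (fun ω => 2 * s ^ 2 - 4 * s * ξ k ω ^ 2) P := i5.sub i4
    -- By `(a + b)² ≤ 2a² + 2b²`, the mean of `Y_k²` being at most `4 lam s`: in all `8 lam s² + 2B²
    -- ≤ 10 lam B²`.
    have hd2 : ∫ ω, d k ω ^ 2 ∂P ≤ 10 * lam * B ^ 2 := by
      calc ∫ ω, d k ω ^ 2 ∂P ≤ ∫ ω, ((2 * (Y k ω * ξ k ω) ^ 2 + 2 * ξ k ω ^ 4)
            + (2 * s ^ 2 - 4 * s * ξ k ω ^ 2)) ∂P := by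
            refine integral_mono (integrable_pow_two (md.memLp k)) (i3.add i6) fun ω => ?_
            simp only [hd]
            nlinarith [sq_nonneg (Y k ω * ξ k ω - (ξ k ω ^ 2 - s))]
        _ = 2 * ((∫ ω, Y k ω ^ 2 ∂P) * s) + 2 * (∫ ω, ξ k ω ^ 4 ∂P)
            + (2 * s ^ 2 - 4 * s * s) := by
            rw [integral_add i3 i6, integral_add i1 i2, integral_sub i5 i4, integral_const_mul,
              integral_const_mul, integral_const_mul (4 * s), h.integral_mul_sq' (hYm k), h.var]
            simp
        _ ≤ 2 * ((4 * (lam * s)) * s) + 2 * B ^ 2 := by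
            have hY3 : ∫ ω, Y k ω ^ 2 ∂P ≤ 4 * (lam * s) := by
              simp only [hY, mul_pow]
              rw [integral_const_mul, h.integral_sum_sq, Nat.card_Ico]
              have : ((k - t k : ℕ) : ℝ) ≤ lam := by
                have := hlam k hkn
                unfold len at this
                exact_mod_cast (by omega : k - t k ≤ lam)
              norm_num
              gcongr
            have := h.fourth k
            have h7 : 0 ≤ s ^ 2 := sq_nonneg s
            have h8 : (∫ ω, Y k ω ^ 2 ∂P) * s ≤ (4 * (lam * s)) * s := by gcongr
            nlinarith
        _ ≤ _ := by
            have h9 : s * s ≤ B * B := by gcongr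
            have h10 : (lam : ℝ) * (s * s) ≤ lam * (B * B) := by gcongr
            have h11 : B * B ≤ lam * (B * B) := le_mul_of_one_le_left (by positivity) hl1'
            nlinarith
    have hmu : mult t n k ^ 2 ≤ (lam : ℝ) ^ 2 :=
      pow_le_pow_left₀ (mult_nonneg t n k) (mult_le hlam k) 2
    exact mul_le_mul hmu hd2 (integral_nonneg fun _ => sq_nonneg _) (by positivity)
  · rw [Finset.sum_const, Finset.card_range, nsmul_eq_mul]
    refine Real.sqrt_le_iff.2 ⟨by positivity, ?_⟩
    -- The sum has `n + 1 ≤ 2n` terms of size `10 lam³ B²`, and `20 ≤ 5²`.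
    have e2 : (5 * B * (lam * √lam * √n)) ^ 2 = 25 * n * ((lam : ℝ) ^ 2 * (lam * B ^ 2)) := by
      have h1 : √(lam : ℝ) ^ 2 = lam := Real.sq_sqrt (by positivity)
      have h2 : √(n : ℝ) ^ 2 = n := Real.sq_sqrt (by positivity)
      calc _ = 25 * B ^ 2 * lam ^ 2 * √(lam : ℝ) ^ 2 * √(n : ℝ) ^ 2 := by ring
        _ = _ := by rw [h1, h2]; ring
    rw [e2]
    have hn' : (1 : ℝ) ≤ n := by exact_mod_cast hn
    have h0 : 0 ≤ (lam : ℝ) ^ 2 * (lam * B ^ 2) := by positivity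
    push_cast
    nlinarith

lemma sum_Icc_rpow_bound {s : ℝ} (hs : -1 < s) :
    ∃ c : ℝ, 0 ≤ c ∧ ∀ n : ℕ, 1 ≤ n →
      ∑ k ∈ Finset.Icc 1 n, ((k : ℝ) + 1) ^ s ≤ c * (n : ℝ) ^ (1 + s) := by
  obtain ⟨c, hc, h⟩ := exists_sum_rpow_le hs
  refine ⟨c, hc, fun n hn => h n hn _ fun k hk => ?_⟩
  simp only [Finset.mem_Icc, Finset.mem_range] at *
  omega

lemma exists_sum_remRate_le (h0 : 0 < α) (h1 : α < 1) :
    ∃ K, 0 ≤ K ∧ ∀ n lam : ℕ, 1 ≤ n → ∑ i ∈ Finset.Icc 1 n, remRate α lam i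
      ≤ K * (√lam * (n : ℝ) ^ (1 - α / 2) + lam * (n : ℝ) ^ (1 - α) + lam * (n : ℝ) ^ (α / 2)) := by
  obtain ⟨c1, hc1, b1⟩ := sum_Icc_rpow_bound (s := -(α / 2)) (by linarith)
  obtain ⟨c2, hc2, b2⟩ := sum_Icc_rpow_bound (s := -α) (by linarith)
  obtain ⟨c3, hc3, b3⟩ := sum_Icc_rpow_bound (s := α / 2 - 1) (by linarith)
  refine ⟨c1 + c2 + c3, by positivity, fun n lam hn => ?_⟩
  unfold remRate
  rw [Finset.sum_add_distrib, Finset.sum_add_distrib, ← Finset.mul_sum, ← Finset.mul_sum,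
    ← Finset.mul_sum]
  have a1 := mul_le_mul_of_nonneg_left (b1 n hn) (Real.sqrt_nonneg lam)
  have a2 := mul_le_mul_of_nonneg_left (b2 n hn) (Nat.cast_nonneg (α := ℝ) lam)
  have a3 := mul_le_mul_of_nonneg_left (b3 n hn) (Nat.cast_nonneg (α := ℝ) lam)
  rw [← sub_eq_add_neg] at a1 a2
  rw [add_sub_cancel] at a3
  set u := √lam * (n : ℝ) ^ (1 - α / 2)
  set v := lam * (n : ℝ) ^ (1 - α)
  set w := lam * (n : ℝ) ^ (α / 2)
  have hu : 0 ≤ u := by positivity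
  have hv : 0 ≤ v := by positivity
  have hw : 0 ≤ w := by positivity
  have a1' : √lam * (c1 * (n : ℝ) ^ (1 - α / 2)) = c1 * u := by ring
  have a2' : lam * (c2 * (n : ℝ) ^ (1 - α)) = c2 * v := by ring
  have a3' : lam * (c3 * (n : ℝ) ^ (α / 2)) = c3 * w := by ring
  rw [a1'] at a1; rw [a2'] at a2; rw [a3'] at a3
  nlinarith [mul_nonneg hc1 hv, mul_nonneg hc1 hw, mul_nonneg hc2 hu, mul_nonneg hc2 hw,
    mul_nonneg hc3 hu, mul_nonneg hc3 hv]

/-- Here `α > 1/2` makes `i^(-2α)` summable and `α < 1` makes `i^(α - 2)` summable, so these two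
squares contribute only `lam²`. -/
lemma exists_sum_remRate_sq_le (h0 : 1 / 2 < α) (h1 : α < 1) :
    ∃ K, 0 ≤ K ∧ ∀ n lam : ℕ, 1 ≤ n → ∑ i ∈ Finset.Icc 1 n, remRate α lam i ^ 2
      ≤ K * (lam * (n : ℝ) ^ (1 - α) + (lam : ℝ) ^ 2) := by
  obtain ⟨c1, hc1, b1⟩ := sum_Icc_rpow_bound (s := -α) (by linarith)
  obtain ⟨c2, hc2, b2⟩ := exists_sum_rpow_le_const (s := -(2 * α)) (by linarith)
  obtain ⟨c3, hc3, b3⟩ := exists_sum_rpow_le_const (s := α - 2) (by linarith)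
  refine ⟨3 * (c1 + c2 + c3), by positivity, fun n lam hn => ?_⟩
  have key : ∀ i : ℕ, remRate α lam i ^ 2 ≤ 3 * (lam * ((i : ℝ) + 1) ^ (-α)
      + (lam : ℝ) ^ 2 * ((i : ℝ) + 1) ^ (-(2 * α)) + (lam : ℝ) ^ 2 * ((i : ℝ) + 1) ^ (α - 2)) := by
    intro i
    have hi : (0 : ℝ) < (i : ℝ) + 1 := by positivity
    have e1 : (√lam * ((i : ℝ) + 1) ^ (-(α / 2))) ^ 2 = lam * ((i : ℝ) + 1) ^ (-α) := by
      rw [mul_pow, Real.sq_sqrt (by positivity), ← Real.rpow_mul_natCast hi.le]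
      congr 2; push_cast; ring
    have e2 : (lam * ((i : ℝ) + 1) ^ (-α)) ^ 2 = (lam : ℝ) ^ 2 * ((i : ℝ) + 1) ^ (-(2 * α)) := by
      rw [mul_pow, ← Real.rpow_mul_natCast hi.le]
      congr 2; push_cast; ring
    have e3 : (lam * ((i : ℝ) + 1) ^ (α / 2 - 1)) ^ 2
        = (lam : ℝ) ^ 2 * ((i : ℝ) + 1) ^ (α - 2) := by
      rw [mul_pow, ← Real.rpow_mul_natCast hi.le]
      congr 2; push_cast; ring
    rw [← e1, ← e2, ← e3]
    unfold remRate
    set u := √lam * ((i : ℝ) + 1) ^ (-(α / 2))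
    set v := lam * ((i : ℝ) + 1) ^ (-α)
    set w := lam * ((i : ℝ) + 1) ^ (α / 2 - 1)
    nlinarith [sq_nonneg (u - v), sq_nonneg (v - w), sq_nonneg (u - w)]
  refine (Finset.sum_le_sum fun i _ => key i).trans ?_
  rw [← Finset.mul_sum, Finset.sum_add_distrib, Finset.sum_add_distrib, ← Finset.mul_sum,
    ← Finset.mul_sum, ← Finset.mul_sum]
  have a1 := mul_le_mul_of_nonneg_left (b1 n hn) (Nat.cast_nonneg (α := ℝ) lam)
  have a2 := mul_le_mul_of_nonneg_left (b2 (Finset.Icc 1 n)) (sq_nonneg (lam : ℝ))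
  have a3 := mul_le_mul_of_nonneg_left (b3 (Finset.Icc 1 n)) (sq_nonneg (lam : ℝ))
  rw [← sub_eq_add_neg] at a1
  have hu : 0 ≤ lam * (n : ℝ) ^ (1 - α) := by positivity
  have hv : 0 ≤ (lam : ℝ) ^ 2 := by positivity
  nlinarith [mul_nonneg hc1 hv, mul_nonneg hc2 hu, mul_nonneg hc3 hu]

end Main


/-! ### `L¹` bounds for the corrections to the leading part. -/

section L1

variable {Ω : Type*} {mΩ : MeasurableSpace Ω} {P : Measure Ω}

/-- `X` is integrable and its `L¹` norm is at most `b`. -/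
def L1le (P : Measure Ω) (X : Ω → ℝ) (b : ℝ) : Prop := Integrable X P ∧ ∫ ω, |X ω| ∂P ≤ b

lemma L1le.mono {X : Ω → ℝ} {b b' : ℝ} (h : L1le P X b) (hb : b ≤ b') : L1le P X b' :=
  ⟨h.1, h.2.trans hb⟩

lemma L1le.add {X Y : Ω → ℝ} {b b' : ℝ} (h : L1le P X b) (h' : L1le P Y b') :
    L1le P (fun ω => X ω + Y ω) (b + b') :=
  ⟨h.1.add h'.1, (integral_abs_add_le h.1 h'.1).trans (add_le_add h.2 h'.2)⟩

lemma L1le.neg {X : Ω → ℝ} {b : ℝ} (h : L1le P X b) : L1le P (fun ω => -X ω) b :=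
  ⟨h.1.neg, by simpa using h.2⟩

lemma L1le.sub {X Y : Ω → ℝ} {b b' : ℝ} (h : L1le P X b) (h' : L1le P Y b') :
    L1le P (fun ω => X ω - Y ω) (b + b') := by
  simpa only [sub_eq_add_neg] using h.add h'.neg

lemma L1le.const_mul {X : Ω → ℝ} {b : ℝ} (h : L1le P X b) (a : ℝ) :
    L1le P (fun ω => a * X ω) (|a| * b) := by
  refine ⟨h.1.const_mul a, ?_⟩
  simp only [abs_mul]
  rw [integral_const_mul]
  exact mul_le_mul_of_nonneg_left h.2 (abs_nonneg a)

lemma L1le.congr {X Y : Ω → ℝ} {b : ℝ} (h : L1le P X b) (e : ∀ ω, Y ω = X ω) : L1le P Y b := by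
  rwa [show Y = X from funext e]

lemma l1le_mul {X Y : Ω → ℝ} (hX : MemLp X 2 P) (hY : MemLp Y 2 P) :
    L1le P (fun ω => X ω * Y ω) (n2 P X * n2 P Y) :=
  ⟨integrable_mul_of_memLp hX hY, integral_abs_mul_le hX hY⟩

lemma l1le_of_memLp [IsProbabilityMeasure P] {X : Ω → ℝ} (hX : MemLp X 2 P) {b : ℝ}
    (hb : n2 P X ≤ b) : L1le P X b :=
  ⟨hX.integrable one_le_two, (integral_abs_le_n2 hX).trans hb⟩

lemma l1le_sum {ι : Type*} (S : Finset ι) {X : ι → Ω → ℝ} {b : ι → ℝ}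
    (h : ∀ i ∈ S, L1le P (X i) (b i)) : L1le P (fun ω => ∑ i ∈ S, X i ω) (∑ i ∈ S, b i) :=
  ⟨integrable_finsetSum S fun i hi => (h i hi).1,
    (integral_abs_sum_le S fun i hi => (h i hi).1).trans (Finset.sum_le_sum fun i hi => (h i hi).2)⟩

lemma l1le_sum_mul {ι : Type*} (S : Finset ι) (a : ι → ℝ) {X Y : ι → Ω → ℝ} {b : ι → ℝ}
    (hX : ∀ i ∈ S, MemLp (X i) 2 P) (hY : ∀ i ∈ S, MemLp (Y i) 2 P)
    (hb : ∀ i ∈ S, |a i| * (n2 P (X i) * n2 P (Y i)) ≤ b i) :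
    L1le P (fun ω => ∑ i ∈ S, a i * (X i ω * Y i ω)) (∑ i ∈ S, b i) :=
  l1le_sum S fun i hi => ((l1le_mul (hX i hi) (hY i hi)).const_mul (a i)).mono (hb i hi)

lemma MDiff.n2_sum_smul_succ_le {𝓕 : Filtration ℕ mΩ} {d : ℕ → Ω → ℝ} (hd : MDiff P 𝓕 d)
    (S : Finset ℕ) (a b : ℕ → ℝ)
    (hb : ∀ k ∈ S, a k ^ 2 * ∫ ω, d (k + 1) ω ^ 2 ∂P ≤ b k) :
    n2 P (fun ω => ∑ k ∈ S, a k * d (k + 1) ω) ≤ √(∑ k ∈ S, b k) := by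
  have h := hd.n2_sum_smul_le (S.image (· + 1)) (fun k => a (k - 1)) (fun k => b (k - 1))
    (fun k hk => by
      obtain ⟨j, hj, rfl⟩ := Finset.mem_image.1 hk
      simpa using hb j hj)
  have hinj : ∀ f : ℕ → ℝ, ∑ k ∈ S.image (· + 1), f k = ∑ k ∈ S, f (k + 1) := fun f =>
    Finset.sum_image fun i _ j _ h => by simpa using h
  simpa [hinj] using h

end L1

section Core

variable {Ω : Type*} {mΩ : MeasurableSpace Ω} {P : Measure Ω} {𝓕 : Filtration ℕ mΩ}
  {α η c s B s' B' c0 : ℝ} {x y z r δ ξ r' δ' ξ' : ℕ → Ω → ℝ} {t : ℕ → ℕ}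

/-- The orders of the negligible parts of the error, for `n` steps in `Nb` blocks of length at
most `lam`. -/
noncomputable def rest (α : ℝ) (lam n : ℕ) (Nb : ℝ) : ℝ :=
  lam * (n : ℝ) ^ (1 - α / 2) + (lam : ℝ) ^ 2 + (n : ℝ) ^ (1 + α)
    + lam * √lam * (n : ℝ) ^ (1 - α) + lam * √lam * (n : ℝ) ^ (α / 2)
    + lam * (n : ℝ) ^ ((1 + α) / 2) + √lam * (n : ℝ) ^ (3 * α / 2) * (1 + Nb)
    + (n : ℝ) ^ ((1 + 3 * α) / 2) + √lam * n + √lam * (n : ℝ) ^ (α + 1 / 2)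

lemma rest_bounds (α : ℝ) (lam n : ℕ) {Nb : ℝ} (hN : 0 ≤ Nb) :
    lam * (n : ℝ) ^ (1 - α / 2) ≤ rest α lam n Nb ∧ (lam : ℝ) ^ 2 ≤ rest α lam n Nb ∧
    (n : ℝ) ^ (1 + α) ≤ rest α lam n Nb ∧ lam * √lam * (n : ℝ) ^ (1 - α) ≤ rest α lam n Nb ∧
    lam * √lam * (n : ℝ) ^ (α / 2) ≤ rest α lam n Nb ∧
    lam * (n : ℝ) ^ ((1 + α) / 2) ≤ rest α lam n Nb ∧
    √lam * (n : ℝ) ^ (3 * α / 2) * (1 + Nb) ≤ rest α lam n Nb ∧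
    (n : ℝ) ^ ((1 + 3 * α) / 2) ≤ rest α lam n Nb ∧ √lam * n ≤ rest α lam n Nb ∧
    √lam * (n : ℝ) ^ (α + 1 / 2) ≤ rest α lam n Nb ∧ 0 ≤ rest α lam n Nb := by
  unfold rest
  have h1 : 0 ≤ lam * (n : ℝ) ^ (1 - α / 2) := by positivity
  have h2 : 0 ≤ (lam : ℝ) ^ 2 := by positivity
  have h3 : 0 ≤ (n : ℝ) ^ (1 + α) := by positivity
  have h4 : 0 ≤ lam * √lam * (n : ℝ) ^ (1 - α) := by positivity
  have h5 : 0 ≤ lam * √lam * (n : ℝ) ^ (α / 2) := by positivity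
  have h6 : 0 ≤ lam * (n : ℝ) ^ ((1 + α) / 2) := by positivity
  have h7 : 0 ≤ √lam * (n : ℝ) ^ (3 * α / 2) * (1 + Nb) := by positivity
  have h8 : 0 ≤ (n : ℝ) ^ ((1 + 3 * α) / 2) := by positivity
  have h9 : 0 ≤ √lam * (n : ℝ) := by positivity
  have h10 : 0 ≤ √lam * (n : ℝ) ^ (α + 1 / 2) := by positivity
  refine ⟨?_, ?_, ?_, ?_, ?_, ?_, ?_, ?_, ?_, ?_, ?_⟩ <;> linarith

variable [IsProbabilityMeasure P]

/-- The squares of the boundary terms. -/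
lemma Component.exists_l1le_bdry_sq (h : Component P 𝓕 α η c x y r δ ξ) (hη : 0 < η)
    (h0 : 1 / 2 < α) (h1 : α < 1) (hb : Blocks t c0) :
    ∃ K, 0 ≤ K ∧ ∀ n lam : ℕ, ∀ Nb : ℝ, 0 ≤ Nb → 1 ≤ n → (∀ i ≤ n + 1, len t i ≤ lam) →
      L1le P (fun ω => ∑ i ∈ Finset.Icc 1 n, bdry η α y r δ (t i) i ω ^ 2)
        (K * rest α lam n Nb) := by
  have hc := h.c_nonneg
  obtain ⟨K1, hK1, b1⟩ := h.exists_n2_rem_le hη (by linarith) h1.le hb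
  obtain ⟨K2, hK2, b2⟩ := exists_sum_remRate_sq_le h0 h1
  obtain ⟨K3, hK3, b3⟩ := sum_Icc_rpow_bound (s := α) (by linarith)
  set A := 2 * (η⁻¹ * c) with hA
  have hA0 : 0 ≤ A := by positivity
  refine ⟨2 * K1 ^ 2 * (2 * K2) + 2 * A ^ 2 * K3, by positivity, fun n lam Nb hN hn hlam => ?_⟩
  obtain ⟨r1, r2, r3, -⟩ := rest_bounds α lam n hN
  have hpt : ∀ i ∈ Finset.Icc 1 n, L1le P (fun ω => bdry η α y r δ (t i) i ω ^ 2)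
      (2 * K1 ^ 2 * remRate α lam i ^ 2 + 2 * A ^ 2 * ((i : ℝ) + 1) ^ α) := by
    intro i hi
    have hi' : len t i ≤ lam := hlam i (by have := (Finset.mem_Icc.1 hi).2; omega)
    have hm := h.memLp_bdry (t i) i
    refine ((l1le_mul hm hm).congr fun ω => pow_two _).mono ?_
    have e1 := (h.n2_bdry_le hη (by linarith) (hb.le i)).trans
      (add_le_add_left (b1 i lam hi') _)
    have e2 : (((i : ℝ) + 1) ^ (α / 2)) ^ 2 = ((i : ℝ) + 1) ^ α := by
      rw [← Real.rpow_mul_natCast (by positivity)]; congr 1; push_cast; ring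
    rw [← e2]
    have e3 := n2_nonneg (P := P) (bdry η α y r δ (t i) i)
    have e4 := pow_le_pow_left₀ e3 e1 2
    rw [← pow_two]
    refine e4.trans ?_
    rw [← hA]
    nlinarith [sq_nonneg (K1 * remRate α lam i - A * ((i : ℝ) + 1) ^ (α / 2))]
  refine (l1le_sum _ hpt).mono ?_
  rw [Finset.sum_add_distrib, ← Finset.mul_sum, ← Finset.mul_sum]
  have q1 := b2 n lam hn
  have q2 := b3 n hn
  have hn' : (1 : ℝ) ≤ n := by exact_mod_cast hn
  have q3 : lam * (n : ℝ) ^ (1 - α) ≤ lam * (n : ℝ) ^ (1 - α / 2) := by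
    exact mul_le_mul_of_nonneg_left (Real.rpow_le_rpow_of_exponent_le hn' (by linarith))
      (by positivity)
  calc _ ≤ 2 * K1 ^ 2 * (K2 * (2 * rest α lam n Nb)) + 2 * A ^ 2 * (K3 * rest α lam n Nb) := by
        gcongr
        · exact q1.trans (by gcongr; linarith)
        · exact q2.trans (by gcongr)
    _ = _ := by ring

/-- The products of innovation sums with the negligible parts. -/
lemma exists_l1le_blockSum_mul_rem (h : Component P 𝓕 α η c x y r δ ξ)
    (hi : Innovation P 𝓕 s B ξ) (hη : 0 < η)
    (h0 : 1 / 2 < α) (h1 : α < 1) (hb : Blocks t c0) :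
    ∃ K, 0 ≤ K ∧ ∀ n lam : ℕ, ∀ Nb : ℝ, 0 ≤ Nb → 1 ≤ n → (∀ i ≤ n + 1, len t i ≤ lam) →
      L1le P (fun ω => ∑ i ∈ Finset.Icc 1 n, blockSum t ξ i ω * rem η α y r δ (t i) i ω)
        (K * rest α lam n Nb) := by
  have hc := h.c_nonneg
  obtain ⟨K1, hK1, b1⟩ := h.exists_n2_rem_le hη (by linarith) h1.le hb
  obtain ⟨K2, hK2, b2⟩ := exists_sum_remRate_le (α := α) (by linarith) h1
  refine ⟨√B * K1 * (K2 * 3), by positivity, fun n lam Nb hN hn hlam => ?_⟩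
  obtain ⟨r1, r2, r3, r4, r5, -⟩ := rest_bounds α lam n hN
  have hpt : ∀ i ∈ Finset.Icc 1 n,
      L1le P (fun ω => blockSum t ξ i ω * rem η α y r δ (t i) i ω)
      (√B * K1 * (√lam * remRate α lam i)) := by
    intro i hi'
    have hi' : len t i ≤ lam := hlam i (by have := (Finset.mem_Icc.1 hi').2; omega)
    refine (l1le_mul (hi.memLp_two_blockSum i) (h.memLp_rem (t i) i)).mono ?_
    calc _ ≤ (√lam * √B) * (K1 * remRate α lam i) :=
          mul_le_mul (hi.n2_blockSum_le hb hi') (b1 i lam hi') (n2_nonneg _) (by positivity)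
      _ = _ := by ring
  refine (l1le_sum _ hpt).mono ?_
  rw [← Finset.mul_sum, ← Finset.mul_sum, mul_assoc (√B * K1)]
  refine mul_le_mul_of_nonneg_left ?_ (by positivity)
  have hs : √(lam : ℝ) * √lam = lam := Real.mul_self_sqrt (by positivity)
  calc √lam * ∑ i ∈ Finset.Icc 1 n, remRate α lam i
      ≤ √lam * (K2 * (√lam * (n : ℝ) ^ (1 - α / 2) + lam * (n : ℝ) ^ (1 - α)
        + lam * (n : ℝ) ^ (α / 2))) := by gcongr; exact b2 n lam hn
    _ = K2 * ((√lam * √lam) * (n : ℝ) ^ (1 - α / 2) + lam * √lam * (n : ℝ) ^ (1 - α)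
        + lam * √lam * (n : ℝ) ^ (α / 2)) := by ring
    _ ≤ K2 * (rest α lam n Nb + rest α lam n Nb + rest α lam n Nb) := by
        rw [hs]; gcongr
    _ = _ := by ring

lemma sum_range_rpow_bound {s : ℝ} (hs : -1 < s) :
    ∃ c : ℝ, 0 ≤ c ∧ ∀ n : ℕ, 1 ≤ n →
      ∑ k ∈ Finset.range (n + 1), ((k : ℝ) + 1) ^ s ≤ c * (n : ℝ) ^ (1 + s) := by
  obtain ⟨c, hc, h⟩ := exists_sum_rpow_le hs
  exact ⟨c, hc, fun n hn => h n hn _ (Finset.Subset.refl _)⟩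

lemma sqrt_mul_rpow_le {K n e e' S : ℝ} (hn : 0 ≤ n) (he : e = 2 * e')
    (hS : S ≤ K * n ^ e) (hK : 0 ≤ K) : √S ≤ √K * n ^ e' := by
  refine Real.sqrt_le_iff.2 ⟨by positivity, ?_⟩
  rw [mul_pow, Real.sq_sqrt hK, ← Real.rpow_mul_natCast hn]
  refine hS.trans_eq ?_
  rw [he]; congr 2; push_cast; ring

/-- The products of innovation sums with the boundary terms at the beginnings of the blocks. -/
lemma exists_l1le_blockSum_mul_start (h : Component P 𝓕 α η c x y r δ ξ)
    (hi : Innovation P 𝓕 s B ξ) (hη : 0 < η)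
    (h0 : 1 / 2 < α) (hb : Blocks t c0) :
    ∃ K, 0 ≤ K ∧ ∀ n lam : ℕ, ∀ Nb : ℝ, 0 ≤ Nb → 1 ≤ n → (∀ i ≤ n + 1, len t i ≤ lam) →
      L1le P (fun ω => ∑ i ∈ Finset.Icc 1 n,
        blockSum t ξ i ω * (invStep η α (t i) * y (t i) ω)) (K * rest α lam n Nb) := by
  have hc := h.c_nonneg
  obtain ⟨K1, hK1, b1⟩ := sum_range_rpow_bound (s := α) (by linarith)
  refine ⟨√((η⁻¹ * c) ^ 2 * s * K1), by positivity, fun n lam Nb hN hn hlam => ?_⟩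
  obtain ⟨r1, r2, r3, r4, r5, r6, -⟩ := rest_bounds α lam n hN
  -- The start term of a block is known at time `t k ≤ k` and constant along the block. It can be
  -- moved inside the innovation sum, which becomes a martingale transform.
  set Y : ℕ → Ω → ℝ := fun k ω => invStep η α (t k) * y (t k) ω with hY
  have hYm : ∀ k, Measurable[𝓕 k] (Y k) := fun k =>
    ((h.meas (t k)).mono (𝓕.mono (hb.le k)) le_rfl).const_mul _
  have hY2 : ∀ k, MemLp (Y k) 2 P := fun k => (h.memLp_y (t k)).const_mul _
  have md := hi.mdiff_mul hYm hY2
  have e : ∀ ω, ∑ i ∈ Finset.Icc 1 n, blockSum t ξ i ω * (invStep η α (t i) * y (t i) ω)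
      = ∑ k ∈ Finset.range (n + 1), mult t n k * (Y k ω * ξ k ω) := by
    intro ω
    rw [← sum_blocks]
    refine Finset.sum_congr rfl fun i _ => ?_
    rw [blockSum, Finset.sum_mul]
    refine Finset.sum_congr rfl fun k hk => ?_
    simp only [hY]
    rw [hb.const i k (Finset.mem_Icc.1 hk).1 (Finset.mem_Icc.1 hk).2]
    ring
  have hs := hi.s_nonneg
  refine L1le.congr (l1le_of_memLp (memLp_finsetSum _ fun k _ => (md.memLp k).const_mul _)
    ((md.n2_sum_smul_le _ _ (fun k => (lam : ℝ) ^ 2 * ((η⁻¹ * c) ^ 2 * s * ((k : ℝ) + 1) ^ α))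
      fun k hk => ?_).trans ?_)) e
  · have hkn : k ≤ n := Nat.lt_succ_iff.1 (Finset.mem_range.1 hk)
    have hmu : mult t n k ^ 2 ≤ (lam : ℝ) ^ 2 :=
      pow_le_pow_left₀ (mult_nonneg t n k) (mult_le (fun i hi => hlam i (by omega)) k) 2
    refine mul_le_mul hmu ?_ (integral_nonneg fun _ => sq_nonneg _) (by positivity)
    rw [hi.integral_mul_sq' (hYm k), ← n2_sq]
    have e1 := h.n2_scaled_le hη (by linarith) (le_refl (t k)) (hb.le k)
    have e2 := pow_le_pow_left₀ (n2_nonneg (P := P) (Y k)) e1 2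
    have e3 : (((k : ℝ) + 1) ^ (α / 2)) ^ 2 = ((k : ℝ) + 1) ^ α := by
      rw [← Real.rpow_mul_natCast (by positivity)]; congr 1; push_cast; ring
    rw [mul_pow, e3] at e2
    calc _ ≤ ((η⁻¹ * c) ^ 2 * ((k : ℝ) + 1) ^ α) * s := by gcongr
      _ = _ := by ring
  · rw [← Finset.mul_sum, Real.sqrt_mul (by positivity), Real.sqrt_sq (by positivity)]
    have e1 : ∑ k ∈ Finset.range (n + 1), (η⁻¹ * c) ^ 2 * s * ((k : ℝ) + 1) ^ α
        ≤ ((η⁻¹ * c) ^ 2 * s * K1) * (n : ℝ) ^ (1 + α) := by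
      rw [← Finset.mul_sum, mul_assoc _ K1]
      gcongr
      exact b1 n hn
    have e2 := sqrt_mul_rpow_le (e' := (1 + α) / 2) (by positivity) (by ring) e1 (by positivity)
    calc _ ≤ lam * (√((η⁻¹ * c) ^ 2 * s * K1) * (n : ℝ) ^ ((1 + α) / 2)) := by gcongr
      _ = √((η⁻¹ * c) ^ 2 * s * K1) * (lam * (n : ℝ) ^ ((1 + α) / 2)) := by ring
      _ ≤ _ := by gcongr

end Core


/-! ### Boundary terms at the current index, through a second component. -/

section Blocks

variable {Ω : Type*} {t : ℕ → ℕ} {c0 : ℝ}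

/-- The indicator of the indices that precede the beginning of a block. -/
def blockEnd (t : ℕ → ℕ) (i : ℕ) : ℝ := if t (i + 1) = i + 1 then 1 else 0

lemma blockEnd_nonneg (t : ℕ → ℕ) (i : ℕ) : 0 ≤ blockEnd t i := by
  unfold blockEnd; split_ifs <;> norm_num

/-- Within a block the sum grows by one innovation; at the end of a block the last term discards the
old sum. This is the recursion required by `sum_mul_sub_eq`. -/
lemma Blocks.blockSum_succ (hb : Blocks t c0) (ξ : ℕ → Ω → ℝ) (i : ℕ) (ω : Ω) :
    blockSum t ξ (i + 1) ω
      = blockSum t ξ i ω + ξ (i + 1) ω - blockEnd t i * blockSum t ξ i ω := by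
  have hle := hb.le i
  unfold blockSum blockEnd
  split_ifs with h
  · rw [h]; simp
  · have h1 : t (i + 1) ≤ i := by have := hb.le (i + 1); omega
    rw [← hb.const (i + 1) i h1 i.le_succ, Finset.sum_Icc_succ_top (by omega)]
    ring

end Blocks

section Steps

variable {η α : ℝ}

lemma invStep_mul_succ_le (hη : 0 < η) (h0 : 0 < α) (h1 : α ≤ 1) (i : ℕ) :
    invStep η α i * invStep η α (i + 1) ≤ 2 * η⁻¹ ^ 2 * ((i : ℝ) + 1) ^ (2 * α) := by
  have e : (((i + 1 : ℕ) : ℝ) + 1) ^ α ≤ 2 * ((i : ℝ) + 1) ^ α := by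
    calc (((i + 1 : ℕ) : ℝ) + 1) ^ α ≤ (2 * ((i : ℝ) + 1)) ^ α := by
          gcongr; push_cast; linarith [i.cast_nonneg (α := ℝ)]
      _ = 2 ^ α * ((i : ℝ) + 1) ^ α := Real.mul_rpow (by norm_num) (by positivity)
      _ ≤ 2 ^ (1 : ℝ) * ((i : ℝ) + 1) ^ α := by gcongr; norm_num
      _ = _ := by rw [Real.rpow_one]
  unfold invStep
  calc _ ≤ (η⁻¹ * ((i : ℝ) + 1) ^ α) * (η⁻¹ * (2 * ((i : ℝ) + 1) ^ α)) := by gcongr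
    _ = 2 * η⁻¹ ^ 2 * (((i : ℝ) + 1) ^ α * ((i : ℝ) + 1) ^ α) := by ring
    _ = _ := by rw [← Real.rpow_add (by positivity), two_mul α]

lemma invStep_mul_succ_sub_le (hη : 0 < η) (h0 : 0 < α) (h1 : α ≤ 1) {i : ℕ} (hi : 1 ≤ i) :
    |invStep η α i * invStep η α (i + 1) - invStep η α (i - 1) * invStep η α (i - 1 + 1)|
      ≤ 2 * η⁻¹ ^ 2 * ((i : ℝ) + 1) ^ (2 * α - 1) := by
  rw [Nat.sub_add_cancel hi]
  have e1 := invStep_sub_le hη h0 h1 hi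
  have e2 := invStep_sub_le hη h0 h1 (Nat.le_add_left 1 i)
  rw [Nat.add_sub_cancel] at e2
  have e3 : (((i + 1 : ℕ) : ℝ) + 1) ^ (α - 1) ≤ ((i : ℝ) + 1) ^ (α - 1) :=
    Real.rpow_le_rpow_of_nonpos (by positivity) (by push_cast; linarith) (by linarith)
  have e4 : |invStep η α (i + 1) - invStep η α (i - 1)| ≤ 2 * η⁻¹ * ((i : ℝ) + 1) ^ (α - 1) := by
    have := abs_sub_le (invStep η α (i + 1)) (invStep η α i) (invStep η α (i - 1))
    have e5 : η⁻¹ * (((i + 1 : ℕ) : ℝ) + 1) ^ (α - 1) ≤ η⁻¹ * ((i : ℝ) + 1) ^ (α - 1) := by gcongr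
    linarith
  rw [show invStep η α i * invStep η α (i + 1) - invStep η α (i - 1) * invStep η α i
    = invStep η α i * (invStep η α (i + 1) - invStep η α (i - 1)) by ring, abs_mul,
    abs_of_pos (invStep_pos hη i)]
  calc _ ≤ invStep η α i * (2 * η⁻¹ * ((i : ℝ) + 1) ^ (α - 1)) :=
        mul_le_mul_of_nonneg_left e4 (invStep_pos hη i).le
    _ = 2 * η⁻¹ ^ 2 * (((i : ℝ) + 1) ^ α * ((i : ℝ) + 1) ^ (α - 1)) := by unfold invStep; ring
    _ = _ := by rw [← Real.rpow_add (by positivity)]; congr 2; ring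

end Steps

section Core

variable {Ω : Type*} {mΩ : MeasurableSpace Ω} {P : Measure Ω} {𝓕 : Filtration ℕ mΩ}
  {α η c s B c' s' B' c0 : ℝ} {x y z r δ ξ r' δ' ξ' : ℕ → Ω → ℝ} {t : ℕ → ℕ}

lemma Component.n2_y_le (h : Component P 𝓕 α η c x y r δ ξ) (h0 : 0 < α) {i k : ℕ} (hik : i ≤ k) :
    n2 P (y k) ≤ c * ((i : ℝ) + 1) ^ (-(α / 2)) := by
  have hc := h.c_nonneg
  have hk : (i : ℝ) ≤ k := by exact_mod_cast hik
  refine (h.n2_y k).trans (mul_le_mul_of_nonneg_left ?_ hc)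
  exact Real.rpow_le_rpow_of_nonpos (by positivity) (by linarith) (by linarith)

lemma Component.n2_r_le (h : Component P 𝓕 α η c x y r δ ξ) (h0 : 0 < α) {i k : ℕ} (hik : i ≤ k) :
    n2 P (r k) ≤ c * ((i : ℝ) + 1) ^ (-α) := by
  have hc := h.c_nonneg
  have hk : (i : ℝ) ≤ k := by exact_mod_cast hik
  refine (h.n2_r k).trans (mul_le_mul_of_nonneg_left ?_ hc)
  exact Real.rpow_le_rpow_of_nonpos (by positivity) (by linarith) (by linarith)

variable [IsProbabilityMeasure P]

lemma Innovation.n2_le (h : Innovation P 𝓕 s B ξ) (k : ℕ) : n2 P (ξ k) ≤ √B := by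
  rw [n2, h.var]; exact Real.sqrt_le_sqrt h.s_le

/-- The products of innovation sums with increments of another component. -/
lemma exists_l1le_blockSum_mul_increment (h2 : Component P 𝓕 α η c' y z r' δ' ξ')
    (hi : Innovation P 𝓕 s B ξ) (hi' : Innovation P 𝓕 s' B' ξ') (hη : 0 < η)
    (h0 : 1 / 2 < α) (h1 : α < 1) (hb : Blocks t c0) :
    ∃ K, 0 ≤ K ∧ ∀ n lam : ℕ, ∀ Nb : ℝ, 0 ≤ Nb → 1 ≤ n → (∀ i ≤ n + 1, len t i ≤ lam) →
      (∑ i ∈ Finset.Icc 1 n, blockEnd t i ≤ Nb) →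
      L1le P (fun ω => ∑ i ∈ Finset.Icc 1 n,
        (invStep η α i * invStep η α (i + 1)) * blockSum t ξ i ω * (z (i + 1) ω - z (i + 2) ω))
        (K * rest α lam n Nb) := by
  have hc := h2.c_nonneg
  have hB := hi.B_nonneg
  have hs := hi.s_nonneg
  have α0 : 0 < α := by linarith
  -- One inverse step comes from the boundary term, the other from solving the second recursion for
  -- its drift `y`.
  set κ : ℕ → ℝ := fun i => invStep η α i * invStep η α (i + 1) with hκ
  have κ0 : ∀ i, 0 ≤ κ i := fun i => (mul_pos (invStep_pos hη _) (invStep_pos hη _)).le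
  set D := 2 * η⁻¹ ^ 2 with hD
  have hD0 : 0 ≤ D := by positivity
  have κle : ∀ i : ℕ, κ i ≤ D * ((i : ℝ) + 1) ^ (2 * α) := invStep_mul_succ_le hη α0 h1.le
  have κz : ∀ i k : ℕ, i ≤ k → κ i * n2 P (z k) ≤ D * c' * ((i : ℝ) + 1) ^ (3 * α / 2) := by
    intro i k hik
    calc _ ≤ (D * ((i : ℝ) + 1) ^ (2 * α)) * (c' * ((i : ℝ) + 1) ^ (-(α / 2))) :=
          mul_le_mul (κle i) (h2.n2_y_le α0 hik) (n2_nonneg _) (by positivity)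
      _ = D * c' * (((i : ℝ) + 1) ^ (2 * α) * ((i : ℝ) + 1) ^ (-(α / 2))) := by ring
      _ = _ := by rw [← Real.rpow_add (by positivity)]; congr 2; ring
  obtain ⟨K1, hK1, b1⟩ := sum_Icc_rpow_bound (s := 3 * α / 2 - 1) (by linarith)
  obtain ⟨K2, hK2, b2⟩ := sum_Icc_rpow_bound (s := 3 * α) (by linarith)
  obtain ⟨K3, hK3, b3⟩ := sum_Icc_rpow_bound (s := α) (by linarith)
  set E := D * c' * √B with hE
  have hE0 : 0 ≤ E := by positivity
  set W := c' + c' + √c' + √B' with hW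
  have hW0 : 0 ≤ W := by positivity
  refine ⟨E * K1 + κ 0 * (√B * c') + E * 4 + √((D * c') ^ 2 * s * K2) + η⁻¹ * √B * W * K3 + E * 4,
    by have := κ0 0; positivity, fun n lam Nb hN hn hlam hNb => ?_⟩
  obtain ⟨r1, r2, r3, r4, r5, r6, r7, r8, r9, r10, r11⟩ := rest_bounds α lam n hN
  have hn' : (1 : ℝ) ≤ n := by exact_mod_cast hn
  have hlam1 : 1 ≤ lam := le_trans (by unfold len; omega) (hlam 0 (by omega))
  have r7' : √lam * (n : ℝ) ^ (3 * α / 2) ≤ rest α lam n Nb := by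
    refine le_trans ?_ r7
    exact le_mul_of_one_le_right (by positivity) (by linarith)
  have r7'' : √lam * (n : ℝ) ^ (3 * α / 2) * Nb ≤ rest α lam n Nb := by
    refine le_trans ?_ r7
    gcongr; linarith
  have m2 : ∀ i ≤ n + 1, n2 P (blockSum t ξ i) ≤ √lam * √B :=
    fun i hi' => hi.n2_blockSum_le hb (hlam i hi')
  have mm : ∀ i, MemLp (blockSum t ξ i) 2 P := fun i => hi.memLp_two_blockSum i
  have mz := h2.memLp_y
  have growth : ∀ i ≤ n, ((i : ℝ) + 1) ^ (3 * α / 2) ≤ 4 * (n : ℝ) ^ (3 * α / 2) := by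
    intro i hin
    have hin' : (i : ℝ) ≤ n := by exact_mod_cast hin
    calc ((i : ℝ) + 1) ^ (3 * α / 2) ≤ (2 * (n : ℝ)) ^ (3 * α / 2) := by gcongr; linarith
      _ = 2 ^ (3 * α / 2) * (n : ℝ) ^ (3 * α / 2) := Real.mul_rpow (by norm_num) (by positivity)
      _ ≤ 2 ^ (2 : ℝ) * (n : ℝ) ^ (3 * α / 2) := by
          gcongr
          · norm_num
          · linarith
      _ = _ := by norm_num
  -- Variation of the weights: `κ` has order `i^(2α)`, hence increments of order `i^(2α - 1)`.
  have p1 : L1le P (fun ω => ∑ i ∈ Finset.Icc 1 n,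
      (κ i - κ (i - 1)) * (blockSum t ξ i ω * z (i + 1) ω)) (E * K1 * rest α lam n Nb) := by
    refine (l1le_sum_mul _ (fun i => κ i - κ (i - 1)) (fun i _ => mm i) (fun i _ => mz (i + 1))
      (b := fun i : ℕ => E * √lam * ((i : ℝ) + 1) ^ (3 * α / 2 - 1)) fun i hi' => ?_).mono ?_
    · obtain ⟨hi1, hin⟩ := Finset.mem_Icc.1 hi'
      have e1 := invStep_mul_succ_sub_le hη α0 h1.le hi1
      calc _ ≤ (D * ((i : ℝ) + 1) ^ (2 * α - 1))
            * ((√lam * √B) * (c' * ((i : ℝ) + 1) ^ (-(α / 2)))) := by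
            refine mul_le_mul e1 (mul_le_mul (m2 i (by omega))
              (h2.n2_y_le α0 (by omega)) (n2_nonneg _) (by positivity))
              (mul_nonneg (n2_nonneg _) (n2_nonneg _)) (by positivity)
        _ = E * √lam * (((i : ℝ) + 1) ^ (2 * α - 1) * ((i : ℝ) + 1) ^ (-(α / 2))) := by
            rw [hE]; ring
        _ = _ := by rw [← Real.rpow_add (by positivity)]; congr 2; ring
    · rw [← Finset.mul_sum]
      calc _ ≤ E * √lam * (K1 * (n : ℝ) ^ (1 + (3 * α / 2 - 1))) := by gcongr; exact b1 n hn
        _ = E * K1 * (√lam * (n : ℝ) ^ (3 * α / 2)) := by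
            rw [show 1 + (3 * α / 2 - 1) = 3 * α / 2 by ring]; ring
        _ ≤ _ := by gcongr
  have p2 : L1le P (fun ω => κ 0 * (blockSum t ξ 1 ω * z 2 ω))
      (κ 0 * (√B * c') * rest α lam n Nb) := by
    refine ((l1le_mul (mm 1) (mz 2)).const_mul (κ 0)).mono ?_
    rw [abs_of_nonneg (κ0 0), mul_assoc (κ 0)]
    refine mul_le_mul_of_nonneg_left ?_ (κ0 0)
    have e1 : n2 P (z 2) ≤ c' := by simpa using h2.n2_y_le α0 (Nat.zero_le 2)
    calc _ ≤ (√lam * √B) * c' :=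
          mul_le_mul (m2 1 (by omega)) e1 (n2_nonneg _) (by positivity)
      _ = √B * c' * (√lam * 1) := by ring
      _ ≤ √B * c' * (√lam * n) := by gcongr
      _ ≤ _ := by gcongr
  have p3 : L1le P (fun ω => κ n * (blockSum t ξ (n + 1) ω * z (n + 2) ω))
      (E * 4 * rest α lam n Nb) := by
    refine ((l1le_mul (mm (n + 1)) (mz (n + 2))).const_mul (κ n)).mono ?_
    rw [abs_of_nonneg (κ0 n)]
    calc _ = n2 P (blockSum t ξ (n + 1)) * (κ n * n2 P (z (n + 2))) := by ring
      _ ≤ (√lam * √B) * (D * c' * (4 * (n : ℝ) ^ (3 * α / 2))) := by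
          refine mul_le_mul (m2 _ le_rfl) ((κz n (n + 2) (by omega)).trans ?_)
            (mul_nonneg (κ0 n) (n2_nonneg _)) (by positivity)
          gcongr
          exact growth n le_rfl
      _ = E * 4 * (√lam * (n : ℝ) ^ (3 * α / 2)) := by rw [hE]; ring
      _ ≤ _ := by gcongr
  -- `z (i + 1)` is known before `ξ (i + 1)`, so this is a martingale transform and only a square
  -- root of the sum of variances is lost.
  have p4 : L1le P (fun ω => ∑ i ∈ Finset.Icc 1 n, κ i * (ξ (i + 1) ω * z (i + 1) ω))
      (√((D * c') ^ 2 * s * K2) * rest α lam n Nb) := by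
    have md := hi.mdiff_mul h2.meas mz
    refine L1le.congr (X := fun ω => ∑ i ∈ Finset.Icc 1 n, κ i * (z (i + 1) ω * ξ (i + 1) ω))
      (l1le_of_memLp (memLp_finsetSum _ fun k _ => (md.memLp _).const_mul _)
      ((md.n2_sum_smul_succ_le _ _ (fun k : ℕ => (D * c') ^ 2 * s * ((k : ℝ) + 1) ^ (3 * α))
        fun k _ => ?_).trans ?_)) (fun ω => by simp only [mul_comm])
    · rw [hi.integral_mul_sq' (h2.meas (k + 1)), ← n2_sq, ← mul_assoc, ← mul_pow]
      have e1 := pow_le_pow_left₀ (mul_nonneg (κ0 k) (n2_nonneg _)) (κz k (k + 1) (by omega)) 2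
      calc _ ≤ (D * c' * ((k : ℝ) + 1) ^ (3 * α / 2)) ^ 2 * s := by gcongr
        _ = (D * c') ^ 2 * s * (((k : ℝ) + 1) ^ (3 * α / 2)) ^ 2 := by ring
        _ = _ := by
            rw [← Real.rpow_mul_natCast (by positivity)]; congr 2; push_cast; ring
    · rw [← Finset.mul_sum]
      have e1 : (D * c') ^ 2 * s * ∑ k ∈ Finset.Icc 1 n, ((k : ℝ) + 1) ^ (3 * α)
          ≤ ((D * c') ^ 2 * s * K2) * (n : ℝ) ^ (1 + 3 * α) := by
        rw [mul_assoc _ K2]; gcongr; exact b2 n hn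
      refine (sqrt_mul_rpow_le (e' := (1 + 3 * α) / 2) (by positivity) (by ring) e1
        (by positivity)).trans ?_
      gcongr
  -- An increment of `z` is a step size times a bounded quantity `V`; the step size cancels one
  -- factor of `κ`, which leaves order `i^α`.
  have p5 : L1le P (fun ω => ∑ i ∈ Finset.Icc 1 n, κ i * (ξ (i + 1) ω * (z (i + 1) ω - z (i + 2) ω)))
      (η⁻¹ * √B * W * K3 * rest α lam n Nb) := by
    set V : ℕ → Ω → ℝ := fun k ω => y k ω + (r' k ω + δ' k ω + ξ' k ω) with hV
    have mδ := h2.pert.mdiff.memLp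
    have mξ' : ∀ k, MemLp (ξ' k) 2 P := fun k => memLp_two_of_four (hi'.memLp k)
    have mV : ∀ k, MemLp (V k) 2 P := fun k =>
      (h2.memLp_x k).add (((h2.memLp_r k).add (mδ k)).add (mξ' k))
    have nV : ∀ k, n2 P (V k) ≤ W := by
      intro k
      have a1 : n2 P (y k) ≤ c' := by
        refine (h2.n2_x k).trans (mul_le_of_le_one_right hc ?_)
        exact Real.rpow_le_one_of_one_le_of_nonpos (by linarith [k.cast_nonneg (α := ℝ)])
          (by linarith)
      have a2 : n2 P (r' k) ≤ c' := by simpa using h2.n2_r_le α0 (Nat.zero_le k)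
      have a3 : n2 P (δ' k) ≤ √c' := by
        refine Real.sqrt_le_sqrt ((h2.pert.integral_sq_le k).trans (mul_le_of_le_one_right hc ?_))
        exact Real.rpow_le_one_of_one_le_of_nonpos (by linarith [k.cast_nonneg (α := ℝ)])
          (by linarith)
      have a4 := hi'.n2_le k
      have q1 : n2 P (V k) ≤ n2 P (y k) + n2 P (fun ω => r' k ω + δ' k ω + ξ' k ω) :=
        n2_add_le (h2.memLp_x k) (((h2.memLp_r k).add (mδ k)).add (mξ' k))
      have q2 : n2 P (fun ω => r' k ω + δ' k ω + ξ' k ω)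
          ≤ n2 P (fun ω => r' k ω + δ' k ω) + n2 P (ξ' k) :=
        n2_add_le ((h2.memLp_r k).add (mδ k)) (mξ' k)
      have q3 := n2_add_le (h2.memLp_r k) (mδ k)
      linarith
    refine L1le.congr (X := fun ω => ∑ i ∈ Finset.Icc 1 n, invStep η α i *
        (ξ (i + 1) ω * V (i + 1) ω))
      ((l1le_sum_mul _ _ (fun i _ => memLp_two_of_four (hi.memLp (i + 1))) (fun i _ => mV (i + 1))
      (b := fun i : ℕ => η⁻¹ * √B * W * ((i : ℝ) + 1) ^ α) fun i _ => ?_).mono ?_) fun ω => ?_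
    · rw [abs_of_pos (invStep_pos hη i)]
      calc _ ≤ invStep η α i * (√B * W) :=
            mul_le_mul_of_nonneg_left (mul_le_mul (hi.n2_le _) (nV _) (n2_nonneg _)
              (by positivity)) (invStep_pos hη i).le
        _ = _ := by unfold invStep; ring
    · rw [← Finset.mul_sum]
      calc _ ≤ η⁻¹ * √B * W * (K3 * (n : ℝ) ^ (1 + α)) := by gcongr; exact b3 n hn
        _ = η⁻¹ * √B * W * K3 * (n : ℝ) ^ (1 + α) := by ring
        _ ≤ _ := by gcongr
    · refine Finset.sum_congr rfl fun i _ => ?_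
      have e1 := h2.drift_eq hη (i + 1) ω
      simp only [hV, hκ, e1]
      ring
  -- The restarts of the block sum: at most `Nb` of the summands are nonzero.
  have p6 : L1le P (fun ω => ∑ i ∈ Finset.Icc 1 n,
      κ i * (blockEnd t i * blockSum t ξ i ω * z (i + 2) ω)) (E * 4 * rest α lam n Nb) := by
    refine L1le.congr (X := fun ω => ∑ i ∈ Finset.Icc 1 n,
        (κ i * blockEnd t i) * (blockSum t ξ i ω * z (i + 2) ω))
      ((l1le_sum_mul _ _ (fun i _ => mm i) (fun i _ => mz (i + 2))
      (b := fun i : ℕ => E * 4 * (√lam * (n : ℝ) ^ (3 * α / 2)) * blockEnd t i)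
        fun i hi' => ?_).mono ?_) fun ω => Finset.sum_congr rfl fun i _ => by ring
    · obtain ⟨hi1, hin⟩ := Finset.mem_Icc.1 hi'
      rw [abs_of_nonneg (mul_nonneg (κ0 i) (blockEnd_nonneg t i))]
      have hbe := blockEnd_nonneg t i
      calc _ = n2 P (blockSum t ξ i) * (κ i * n2 P (z (i + 2))) * blockEnd t i := by ring
        _ ≤ (√lam * √B) * (D * c' * (4 * (n : ℝ) ^ (3 * α / 2))) * blockEnd t i := by
            refine mul_le_mul_of_nonneg_right (mul_le_mul (m2 _ (by omega))
              ((κz i (i + 2) (by omega)).trans ?_)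
              (mul_nonneg (κ0 i) (n2_nonneg _)) (by positivity)) hbe
            gcongr
            exact growth i hin
        _ = _ := by rw [hE]; ring
    · rw [← Finset.mul_sum]
      calc _ ≤ E * 4 * (√lam * (n : ℝ) ^ (3 * α / 2)) * Nb := by gcongr
        _ = E * 4 * (√lam * (n : ℝ) ^ (3 * α / 2) * Nb) := by ring
        _ ≤ _ := by gcongr
  refine L1le.congr ((((((p1.add p2).sub p3).add p4).sub p5).sub p6).mono (le_of_eq (by ring)))
    fun ω => ?_
  exact sum_mul_sub_eq (m := fun i => blockSum t ξ i ω) (z := fun i => z i ω) (κ := κ)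
    (ξ := fun i => ξ i ω) (θ := blockEnd t) (fun i => hb.blockSum_succ ξ i ω) n

/-- The products of innovation sums with the boundary terms at the current index. -/
lemma exists_l1le_blockSum_mul_end (h2 : Component P 𝓕 α η c' y z r' δ' ξ')
    (hi : Innovation P 𝓕 s B ξ) (hi' : Innovation P 𝓕 s' B' ξ') (hη : 0 < η)
    (h0 : 1 / 2 < α) (h1 : α < 1) (hb : Blocks t c0) :
    ∃ K, 0 ≤ K ∧ ∀ n lam : ℕ, ∀ Nb : ℝ, 0 ≤ Nb → 1 ≤ n → (∀ i ≤ n + 1, len t i ≤ lam) →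
      (∑ i ∈ Finset.Icc 1 n, blockEnd t i ≤ Nb) →
      L1le P (fun ω => ∑ i ∈ Finset.Icc 1 n,
        blockSum t ξ i ω * (invStep η α i * y (i + 1) ω)) (K * rest α lam n Nb) := by
  have hc := h2.c_nonneg
  have hB := hi.B_nonneg
  have hB' := hi'.B_nonneg
  have hs := hi.s_nonneg
  have hs' := hi'.s_nonneg
  have α0 : 0 < α := by linarith
  -- `y (i + 1)` depends on the same innovations as the block sum, so this is not a martingale
  -- transform, and Cauchy-Schwarz gives `√lam n^(1 + α/2)`, exactly the order of the third term of
  -- the rate. Writing `y (i + 1)` as the drift of the component `z` yields increments of `z`, a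
  -- small remainder, and noise revealed after the block sum is known.
  obtain ⟨K0, hK0, b0⟩ := exists_l1le_blockSum_mul_increment h2 hi hi' hη h0 h1 hb
  obtain ⟨K1, hK1, b1⟩ := sum_Icc_rpow_bound (s := 2 * α) (by linarith)
  refine ⟨K0 + η⁻¹ * √B * c' + √(η⁻¹ ^ 2 * (B * s') * K1) + √(η⁻¹ ^ 2 * (2 * c' * B) * K1),
    by positivity, fun n lam Nb hN hn hlam hNb => ?_⟩
  obtain ⟨r1, r2, r3, r4, r5, r6, r7, r8, r9, r10, r11⟩ := rest_bounds α lam n hN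
  have m2 : ∀ i ≤ n + 1, n2 P (blockSum t ξ i) ≤ √lam * √B :=
    fun i hi' => hi.n2_blockSum_le hb (hlam i hi')
  -- Shifted by one so that the block sum cut at `i` appears at time `i + 1`, when it is known. At
  -- `k = 0` the sum is empty.
  set Y : ℕ → Ω → ℝ := fun k ω => ∑ j ∈ Finset.Ico (t (k - 1)) k, ξ j ω with hY
  have hYm : ∀ k, Measurable[𝓕 k] (Y k) := fun k =>
    measurable_sum_of_lt hi.meas fun j hj => (Finset.mem_Ico.1 hj).2
  have hY4 : ∀ k, MemLp (Y k) 4 P := fun k => hi.memLp_sum _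
  have hYs : ∀ i, Y (i + 1) = blockSum t ξ i := by
    intro i; funext ω
    simp only [hY, blockSum, Nat.add_sub_cancel]
    congr 1
  have hcard : ∀ i ≤ n + 1, ((Finset.Icc (t i) i).card : ℝ) ≤ lam := by
    intro i hi; rw [hb.card_Icc]; exact_mod_cast hlam i hi
  have hinv : ∀ k : ℕ, invStep η α k ^ 2 = η⁻¹ ^ 2 * ((k : ℝ) + 1) ^ (2 * α) := by
    intro k
    rw [invStep, mul_pow, ← Real.rpow_mul_natCast (by positivity)]; congr 2; push_cast; ring
  have mart : ∀ d : ℕ → Ω → ℝ, MDiff P 𝓕 d → ∀ b : ℝ, 0 ≤ b →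
      (∀ i ≤ n, ∫ ω, d (i + 1) ω ^ 2 ∂P ≤ lam * b) →
      L1le P (fun ω => ∑ i ∈ Finset.Icc 1 n, invStep η α i * d (i + 1) ω)
        (√(η⁻¹ ^ 2 * b * K1) * rest α lam n Nb) := by
    intro d md b hb0 hbd
    refine l1le_of_memLp (memLp_finsetSum _ fun k _ => (md.memLp _).const_mul _)
      ((md.n2_sum_smul_succ_le _ _
      (fun k : ℕ => lam * (η⁻¹ ^ 2 * b * ((k : ℝ) + 1) ^ (2 * α))) fun k hk => ?_).trans ?_)
    · rw [hinv]
      calc _ ≤ η⁻¹ ^ 2 * ((k : ℝ) + 1) ^ (2 * α) * (lam * b) := by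
            gcongr; exact hbd k (Finset.mem_Icc.1 hk).2
        _ = _ := by ring
    · rw [← Finset.mul_sum, ← Finset.mul_sum, Real.sqrt_mul (by positivity)]
      have e1 : η⁻¹ ^ 2 * b * ∑ k ∈ Finset.Icc 1 n, ((k : ℝ) + 1) ^ (2 * α)
          ≤ (η⁻¹ ^ 2 * b * K1) * (n : ℝ) ^ (1 + 2 * α) := by
        rw [mul_assoc _ K1]; gcongr; exact b1 n hn
      have e2 := sqrt_mul_rpow_le (e' := α + 1 / 2) (by positivity) (by ring) e1 (by positivity)
      calc _ ≤ √lam * (√(η⁻¹ ^ 2 * b * K1) * (n : ℝ) ^ (α + 1 / 2)) := by gcongr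
        _ = √(η⁻¹ ^ 2 * b * K1) * (√lam * (n : ℝ) ^ (α + 1 / 2)) := by ring
        _ ≤ _ := by gcongr
  have q1 : L1le P (fun ω => ∑ i ∈ Finset.Icc 1 n, invStep η α i *
      (blockSum t ξ i ω * r' (i + 1) ω)) (η⁻¹ * √B * c' * rest α lam n Nb) := by
    refine (l1le_sum_mul _ _ (fun i _ => hi.memLp_two_blockSum i) (fun i _ => h2.memLp_r (i + 1))
      (b := fun i : ℕ => η⁻¹ * √B * c' * √lam) fun i hi' => ?_).mono ?_
    · obtain ⟨hi1, hin⟩ := Finset.mem_Icc.1 hi'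
      rw [abs_of_pos (invStep_pos hη i)]
      calc _ ≤ invStep η α i * ((√lam * √B) * (c' * ((i : ℝ) + 1) ^ (-α))) := by
            refine mul_le_mul_of_nonneg_left (mul_le_mul (m2 i (by omega))
              (h2.n2_r_le α0 (by omega)) (n2_nonneg _) (by positivity)) (invStep_pos hη i).le
        _ = η⁻¹ * √B * c' * √lam * (((i : ℝ) + 1) ^ α * ((i : ℝ) + 1) ^ (-α)) := by
            unfold invStep; ring
        _ = _ := by rw [← Real.rpow_add (by positivity)]; simp
    · simp only [Finset.sum_const, Nat.card_Icc, Nat.add_sub_cancel, nsmul_eq_mul]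
      calc _ = η⁻¹ * √B * c' * (√lam * n) := by ring
        _ ≤ _ := by gcongr
  have q2 := mart _ (hi'.mdiff_mul hYm fun k => memLp_two_of_four (hY4 k)) (B * s') (by positivity)
    (fun i hin => by
      rw [hi'.integral_mul_sq' (hYm _), hYs]
      have := hi.integral_blockSum_sq_le hb (hlam i (by omega))
      calc _ ≤ (lam * B) * s' := by gcongr
        _ = _ := by ring)
  have q3 := mart _ (h2.pert.mdiff_mul hYm hY4) (2 * c' * B) (by positivity)
    (fun i hin => by
      refine (h2.pert.sq_le _ _ (hYm _) (hY4 _)).trans ?_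
      have e1 : √(∫ ω, Y (i + 1) ω ^ 4 ∂P) ≤ 2 * lam * B := by
        refine Real.sqrt_le_iff.2 ⟨by positivity, ?_⟩
        rw [hYs]
        refine (hi.integral_sum_pow_four_le _).trans ?_
        have := hcard i (by omega)
        calc _ ≤ 4 * (lam : ℝ) ^ 2 * B ^ 2 := by gcongr
          _ = _ := by ring
      have e2 : (((i + 1 : ℕ) : ℝ) + 1) ^ (-α) ≤ 1 :=
        Real.rpow_le_one_of_one_le_of_nonpos (by push_cast; linarith [i.cast_nonneg (α := ℝ)])
          (by linarith)
      calc _ ≤ c' * (2 * lam * B) * 1 := by gcongr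
        _ = _ := by ring)
  refine L1le.congr ((((b0 n lam Nb hN hn hlam hNb).sub q1).sub (q2.add q3)).mono
    (le_of_eq (by ring))) fun ω => ?_
  simp only [hYs]
  rw [← Finset.sum_add_distrib, ← Finset.sum_sub_distrib, ← Finset.sum_sub_distrib]
  refine Finset.sum_congr rfl fun i _ => ?_
  rw [h2.drift_eq hη (i + 1) ω]
  ring

end Core


/-! ### Centring at the empirical mean, and assembly of the scalar estimate. -/

section Core

variable {Ω : Type*} {mΩ : MeasurableSpace Ω} {P : Measure Ω} {𝓕 : Filtration ℕ mΩ}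
  {α η c s B c' s' B' c0 : ℝ} {x y z r δ ξ r' δ' ξ' : ℕ → Ω → ℝ} {t : ℕ → ℕ}

variable [IsProbabilityMeasure P]

/-- Mean square of the sum of the first drifts. -/
lemma Component.exists_n2_sum_range_le (h : Component P 𝓕 α η c x y r δ ξ)
    (hi : Innovation P 𝓕 s B ξ) (hη : 0 < η) (h0 : 1 / 2 < α) (h1 : α < 1) :
    ∃ K, 0 ≤ K ∧ ∀ n : ℕ, 1 ≤ n →
      n2 P (fun ω => ∑ k ∈ Finset.range n, x k ω)
        ≤ √n * √B + K * ((n : ℝ) ^ (1 - α) + (n : ℝ) ^ (α / 2)) := by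
  have hc := h.c_nonneg
  have α0 : 0 < α := by linarith
  obtain ⟨K1, hK1, b1⟩ := exists_sum_rpow_le (s := -α) (by linarith)
  obtain ⟨K2, hK2, b2⟩ := exists_sum_rpow_le (s := α / 2 - 1) (by linarith)
  set K3 := √(c * K1) + c * K1 with hK3
  set K4 := η⁻¹ * c * K2 + 2 * (η⁻¹ * c) * 2 with hK4
  have hK3' : 0 ≤ K3 := by positivity
  have hK4' : 0 ≤ K4 := by positivity
  refine ⟨K3 + K4, by positivity, fun n hn => ?_⟩
  have hn' : (1 : ℝ) ≤ n := by exact_mod_cast hn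
  have e0 : Finset.range n = Finset.Icc 0 (n - 1) := by
    ext k; simp only [Finset.mem_range, Finset.mem_Icc]; omega
  have e1 : (fun ω => ∑ k ∈ Finset.range n, x k ω)
      = fun ω => -(∑ k ∈ Finset.range n, ξ k ω) + bdry η α y r δ 0 (n - 1) ω := by
    funext ω; rw [e0]; exact h.sum_drift_eq hη (Nat.zero_le _) ω
  have mξ : MemLp (fun ω => ∑ k ∈ Finset.range n, ξ k ω) 2 P := memLp_two_of_four (hi.memLp_sum _)
  have q1 : n2 P (fun ω => ∑ k ∈ Finset.range n, ξ k ω) ≤ √n * √B := by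
    rw [n2, hi.integral_sum_sq, Finset.card_range, ← Real.sqrt_mul (by positivity)]
    exact Real.sqrt_le_sqrt (mul_le_mul_of_nonneg_left hi.s_le (by positivity))
  have q2 := h.n2_bdry_le hη α0 (Nat.zero_le (n - 1))
  have q3 := h.n2_rem_le hη α0 h1.le 0 (n - 1)
  have sub : Finset.Icc 0 (n - 1) ⊆ Finset.range (n + 1) := by
    intro k; simp only [Finset.mem_range, Finset.mem_Icc]; omega
  have s1 := b1 n hn _ sub
  have s2 := b2 n hn _ (Finset.Ioc_subset_Icc_self.trans sub)
  rw [show 1 + -α = 1 - α by ring] at s1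
  rw [show 1 + (α / 2 - 1) = α / 2 by ring] at s2
  have hp : (1 : ℝ) ≤ (n : ℝ) ^ (1 - α) := Real.one_le_rpow hn' (by linarith)
  -- The square root of `n^(1 - α)` is enlarged to `n^(1 - α) ≥ 1`, so that it merges with the
  -- remainder bound.
  have t1 : √(c * ∑ k ∈ Finset.Icc 0 (n - 1), ((k : ℝ) + 1) ^ (-α)) ≤ √(c * K1) * (n : ℝ) ^ (1 - α) := by
    rw [← Real.sqrt_sq (show 0 ≤ (n : ℝ) ^ (1 - α) by positivity), ← Real.sqrt_mul (by positivity)]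
    refine Real.sqrt_le_sqrt ?_
    calc _ ≤ c * (K1 * (n : ℝ) ^ (1 - α)) := by gcongr
      _ = c * K1 * ((n : ℝ) ^ (1 - α) * 1) := by ring
      _ ≤ c * K1 * ((n : ℝ) ^ (1 - α) * (n : ℝ) ^ (1 - α)) := by gcongr
      _ = _ := by ring
  have t2 : c * ∑ k ∈ Finset.Icc 0 (n - 1), ((k : ℝ) + 1) ^ (-α) ≤ c * K1 * (n : ℝ) ^ (1 - α) := by
    rw [mul_assoc]; gcongr
  have t3 : η⁻¹ * c * ∑ k ∈ Finset.Ioc 0 (n - 1), ((k : ℝ) + 1) ^ (α / 2 - 1)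
      ≤ η⁻¹ * c * K2 * (n : ℝ) ^ (α / 2) := by
    rw [mul_assoc _ K2]; gcongr
  have t4 : 2 * (η⁻¹ * c) * (((n - 1 : ℕ) : ℝ) + 1) ^ (α / 2) ≤ 2 * (η⁻¹ * c) * 2 * (n : ℝ) ^ (α / 2) := by
    rw [Nat.cast_sub hn, Nat.cast_one, sub_add_cancel]
    have : 0 ≤ (n : ℝ) ^ (α / 2) := by positivity
    have : 0 ≤ η⁻¹ * c := by positivity
    nlinarith
  have q4 : n2 P (bdry η α y r δ 0 (n - 1)) ≤ K3 * (n : ℝ) ^ (1 - α) + K4 * (n : ℝ) ^ (α / 2) := by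
    rw [hK3, hK4]; linarith
  rw [e1]
  refine (n2_add_le (X := fun ω => -(∑ k ∈ Finset.range n, ξ k ω)) mξ.neg
    (h.memLp_bdry 0 (n - 1))).trans ?_
  rw [n2_neg]
  have f1 : 0 ≤ K3 * (n : ℝ) ^ (α / 2) := by positivity
  have f2 : 0 ≤ K4 * (n : ℝ) ^ (1 - α) := by positivity
  linarith

set_option maxHeartbeats 1000000 in
/-- The part of the error that comes from centring at the empirical mean. -/
lemma exists_l1le_centring (h : Component P 𝓕 α η c x y r δ ξ)
    (hi : Innovation P 𝓕 s B ξ) (hη : 0 < η) (h0 : 1 / 2 < α) (h1 : α < 1) (hb : Blocks t c0) :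
    ∃ K, 0 ≤ K ∧ ∀ n lam : ℕ, ∀ Nb : ℝ, 0 ≤ Nb → 1 ≤ n → (∀ i ≤ n + 1, len t i ≤ lam) →
      L1le P (fun ω => -(2 * ((n : ℝ)⁻¹ * ∑ k ∈ Finset.range n, x k ω)
          * ∑ i ∈ Finset.Icc 1 n, (len t i : ℝ) * ∑ k ∈ Finset.Icc (t i) i, x k ω)
          + ((n : ℝ)⁻¹ * ∑ k ∈ Finset.range n, x k ω) ^ 2
            * ∑ i ∈ Finset.Icc 1 n, (len t i : ℝ) ^ 2)
        (2 * B * (lam * √lam * √n) + K * rest α lam n Nb) := by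
  have hc := h.c_nonneg
  have hB := hi.B_nonneg
  have α0 : 0 < α := by linarith
  obtain ⟨K1, hK1, b1⟩ := h.exists_n2_sum_range_le hi hη h0 h1
  obtain ⟨K2, hK2, b2⟩ := h.exists_n2_rem_le hη α0 h1.le hb
  obtain ⟨K3, hK3, b3⟩ := exists_sum_remRate_le (α := α) α0 h1
  obtain ⟨K4, hK4, b4⟩ := sum_Icc_rpow_bound (s := α / 2) (by linarith)
  set A := 2 * (η⁻¹ * c) with hA
  have hA0 : 0 ≤ A := by positivity
  set G := √B + 2 * K1 with hG
  have hG0 : 0 ≤ G := by positivity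
  refine ⟨2 * (2 * K1 * √B + G * (K2 * K3 * 3 + A * K4)) + G ^ 2, by positivity,
    fun n lam Nb hN hn hlam => ?_⟩
  obtain ⟨r1, r2, r3, r4, r5, r6, r7, r8, r9, r10, r11⟩ := rest_bounds α lam n hN
  have hn' : (1 : ℝ) ≤ n := by exact_mod_cast hn
  have hn0 : (0 : ℝ) < n := by linarith
  have mx : MemLp (fun ω => (n : ℝ)⁻¹ * ∑ k ∈ Finset.range n, x k ω) 2 P :=
    (memLp_finsetSum _ fun k _ => h.memLp_x k).const_mul _
  set X := n2 P (fun ω => (n : ℝ)⁻¹ * ∑ k ∈ Finset.range n, x k ω) with hX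
  have hX0 : 0 ≤ X := n2_nonneg _
  set ρ := (n : ℝ) ^ (1 - α) + (n : ℝ) ^ (α / 2) with hρ
  have hsn : 0 < √(n : ℝ) := Real.sqrt_pos.2 hn0
  have hss : √(n : ℝ) * √n = n := Real.mul_self_sqrt hn0.le
  have hρs : ρ ≤ 2 * √n := by
    have a1 : (n : ℝ) ^ (1 - α) ≤ (n : ℝ) ^ (1 / 2 : ℝ) :=
      Real.rpow_le_rpow_of_exponent_le hn' (by linarith)
    have a2 : (n : ℝ) ^ (α / 2) ≤ (n : ℝ) ^ (1 / 2 : ℝ) :=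
      Real.rpow_le_rpow_of_exponent_le hn' (by linarith)
    rw [Real.sqrt_eq_rpow]; linarith
  have hX1 : n * X ≤ √n * √B + K1 * ρ := by
    rw [hX, n2_const_mul, abs_of_nonneg (by positivity), mul_inv_cancel_left₀ hn0.ne']
    exact b1 n hn
  have hX2 : √n * X ≤ G := by
    have : √n * (√n * X) ≤ √n * G := by
      rw [← mul_assoc, hss]
      calc _ ≤ √n * √B + K1 * (2 * √n) := hX1.trans (by gcongr)
        _ = _ := by rw [hG]; ring
    exact le_of_mul_le_mul_left this hsn
  set w : ℕ → Ω → ℝ := fun i ω => ∑ k ∈ Finset.Icc (t i) i, x k ω with hw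
  have mw : ∀ i, MemLp (w i) 2 P := fun i => memLp_finsetSum _ fun k _ => h.memLp_x k
  have nw : ∀ i ∈ Finset.Icc 1 n, n2 P (w i)
      ≤ √lam * √B + (K2 * remRate α lam i + A * ((i : ℝ) + 1) ^ (α / 2)) := by
    intro i hi'
    have hil : len t i ≤ lam := hlam i (by have := (Finset.mem_Icc.1 hi').2; omega)
    have e1 : w i = fun ω => -(blockSum t ξ i ω) + bdry η α y r δ (t i) i ω := by
      funext ω; exact h.sum_drift_eq hη (hb.le i) ω
    rw [e1]
    refine (n2_add_le (X := fun ω => -(blockSum t ξ i ω)) (hi.memLp_two_blockSum i).neg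
      (h.memLp_bdry _ _)).trans ?_
    rw [n2_neg]
    have q1 := hi.n2_blockSum_le hb hil
    have q2 := h.n2_bdry_le hη α0 (hb.le i)
    have q3 := b2 i lam hil
    linarith
  have mW : MemLp (fun ω => ∑ i ∈ Finset.Icc 1 n, (len t i : ℝ) * w i ω) 2 P :=
    memLp_finsetSum _ fun i _ => (mw i).const_mul _
  set V := K2 * (K3 * (√lam * (n : ℝ) ^ (1 - α / 2) + lam * (n : ℝ) ^ (1 - α)
    + lam * (n : ℝ) ^ (α / 2))) + A * (K4 * (n : ℝ) ^ (1 + α / 2)) with hV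
  have hlen : ∀ i ∈ Finset.Icc 1 n, (len t i : ℝ) ≤ lam := by
    intro i hi'
    exact_mod_cast hlam i (by have := (Finset.mem_Icc.1 hi').2; omega)
  have nW : n2 P (fun ω => ∑ i ∈ Finset.Icc 1 n, (len t i : ℝ) * w i ω)
      ≤ lam * (√lam * √B * n + V) := by
    refine (n2_sum_le _ fun i _ => (mw i).const_mul _).trans ?_
    calc _ ≤ ∑ i ∈ Finset.Icc 1 n, lam * (√lam * √B
          + (K2 * remRate α lam i + A * ((i : ℝ) + 1) ^ (α / 2))) := by
          refine Finset.sum_le_sum fun i hi' => ?_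
          rw [n2_const_mul, abs_of_nonneg (by positivity)]
          exact mul_le_mul (hlen i hi') (nw i hi') (n2_nonneg _) (by positivity)
      _ = lam * (√lam * √B * n + (K2 * ∑ i ∈ Finset.Icc 1 n, remRate α lam i
          + A * ∑ i ∈ Finset.Icc 1 n, ((i : ℝ) + 1) ^ (α / 2))) := by
          rw [← Finset.mul_sum, Finset.sum_add_distrib, Finset.sum_add_distrib, Finset.mul_sum,
            Finset.mul_sum]
          simp only [Finset.sum_const, Nat.card_Icc, Nat.add_sub_cancel, nsmul_eq_mul]
          ring
      _ ≤ _ := by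
          rw [hV]
          gcongr
          · exact b3 n lam hn
          · exact b4 n hn
  have hV0 : 0 ≤ V := by positivity
  -- The mean has size `√B / √n` and the weighted block sums `lam^(3/2) √B n`. Their product is of
  -- leading order, so its constant `B` is kept exact; all else goes to `rest`.
  have cross : X * (lam * (√lam * √B * n + V))
      ≤ B * (lam * √lam * √n) + (2 * K1 * √B + G * (K2 * K3 * 3 + A * K4)) * rest α lam n Nb := by
    have u1 : X * (lam * (√lam * √B * n)) ≤ B * (lam * √lam * √n) + 2 * K1 * √B * rest α lam n Nb := by
      calc _ = lam * √lam * √B * (n * X) := by ring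
        _ ≤ lam * √lam * √B * (√n * √B + K1 * ρ) := by gcongr
        _ = (√B * √B) * (lam * √lam * √n) + K1 * √B * (lam * √lam * (n : ℝ) ^ (1 - α)
            + lam * √lam * (n : ℝ) ^ (α / 2)) := by rw [hρ]; ring
        _ ≤ B * (lam * √lam * √n) + K1 * √B * (rest α lam n Nb + rest α lam n Nb) := by
            rw [Real.mul_self_sqrt hB]; gcongr
        _ = _ := by ring
    -- One factor `√n` makes `X` bounded, which lowers the exponent `e` by `1/2`.
    have key : ∀ (a e : ℝ), 0 ≤ a → a * (n : ℝ) ^ (e - 1 / 2) ≤ rest α lam n Nb →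
        X * (a * (n : ℝ) ^ e) ≤ G * rest α lam n Nb := by
      intro a e ha hle
      have : (n : ℝ) ^ e = √n * (n : ℝ) ^ (e - 1 / 2) := by
        rw [Real.sqrt_eq_rpow, ← Real.rpow_add hn0]; congr 1; ring
      calc _ = (√n * X) * (a * (n : ℝ) ^ (e - 1 / 2)) := by rw [this]; ring
        _ ≤ _ := by gcongr
    have hexp : ∀ e e' : ℝ, e ≤ e' → (n : ℝ) ^ e ≤ (n : ℝ) ^ e' := fun e e' h =>
      Real.rpow_le_rpow_of_exponent_le hn' h
    have hexp0 : ∀ e : ℝ, e ≤ 0 → (n : ℝ) ^ e ≤ 1 := fun e h =>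
      Real.rpow_le_one_of_one_le_of_nonpos hn' h
    have v1 := key (lam * √lam) (1 - α / 2) (by positivity)
      (le_trans (mul_le_mul_of_nonneg_left (hexp _ (1 - α) (by linarith)) (by positivity)) r4)
    have v2 := key ((lam : ℝ) ^ 2) (1 - α) (by positivity)
      (le_trans (mul_le_of_le_one_right (by positivity) (hexp0 _ (by linarith))) r2)
    have v3 := key ((lam : ℝ) ^ 2) (α / 2) (by positivity)
      (le_trans (mul_le_of_le_one_right (by positivity) (hexp0 _ (by linarith))) r2)
    have v4 := key (lam : ℝ) (1 + α / 2) (by positivity)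
      (le_trans (mul_le_mul_of_nonneg_left (hexp _ ((1 + α) / 2) (by linarith)) (by positivity)) r6)
    calc X * (lam * (√lam * √B * n + V))
        = X * (lam * (√lam * √B * n)) + (K2 * K3 * (X * (lam * √lam * (n : ℝ) ^ (1 - α / 2))
          + X * ((lam : ℝ) ^ 2 * (n : ℝ) ^ (1 - α)) + X * ((lam : ℝ) ^ 2 * (n : ℝ) ^ (α / 2)))
          + A * K4 * (X * (lam * (n : ℝ) ^ (1 + α / 2)))) := by rw [hV]; ring
      _ ≤ (B * (lam * √lam * √n) + 2 * K1 * √B * rest α lam n Nb)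
          + (K2 * K3 * (G * rest α lam n Nb + G * rest α lam n Nb + G * rest α lam n Nb)
          + A * K4 * (G * rest α lam n Nb)) := by gcongr
      _ = _ := by ring
  have hsq : ∑ i ∈ Finset.Icc 1 n, (len t i : ℝ) ^ 2 ≤ n * (lam : ℝ) ^ 2 := by
    calc _ ≤ ∑ i ∈ Finset.Icc 1 n, (lam : ℝ) ^ 2 :=
          Finset.sum_le_sum fun i hi' => pow_le_pow_left₀ (by positivity) (hlen i hi') 2
      _ = _ := by simp
  have sq : (∑ i ∈ Finset.Icc 1 n, (len t i : ℝ) ^ 2) * (X * X) ≤ G ^ 2 * rest α lam n Nb := by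
    calc _ ≤ (n * (lam : ℝ) ^ 2) * (X * X) := by gcongr
      _ = (√n * X) ^ 2 * (lam : ℝ) ^ 2 := by rw [mul_pow, pow_two (√(n : ℝ)), hss]; ring
      _ ≤ _ := by gcongr
  have L1 := (l1le_mul mx mW).const_mul (-2)
  have L2 := (l1le_mul mx mx).const_mul (∑ i ∈ Finset.Icc 1 n, (len t i : ℝ) ^ 2)
  refine L1le.congr ((L1.add L2).mono ?_) fun ω => by ring
  have hS : 0 ≤ ∑ i ∈ Finset.Icc 1 n, (len t i : ℝ) ^ 2 := Finset.sum_nonneg fun i _ => sq_nonneg _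
  rw [abs_of_nonneg hS, ← hX]
  have e2 : |(-2 : ℝ)| = 2 := by norm_num
  rw [e2]
  have e3 := mul_le_mul_of_nonneg_left nW hX0
  calc _ ≤ 2 * (B * (lam * √lam * √n)
        + (2 * K1 * √B + G * (K2 * K3 * 3 + A * K4)) * rest α lam n Nb)
        + G ^ 2 * rest α lam n Nb :=
        add_le_add (mul_le_mul_of_nonneg_left (e3.trans cross) zero_le_two) sq
    _ = _ := by ring

/-- The error of the batch-means estimator of the variance of a component. -/
theorem exists_l1le_batchMeans (h : Component P 𝓕 α η c x y r δ ξ)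
    (h2 : Component P 𝓕 α η c' y z r' δ' ξ')
    (hi : Innovation P 𝓕 s B ξ) (hi' : Innovation P 𝓕 s' B' ξ') (hη : 0 < η)
    (h0 : 1 / 2 < α) (h1 : α < 1) (hb : Blocks t c0) :
    ∃ K, 0 ≤ K ∧ ∀ n lam : ℕ, ∀ Nb : ℝ, 0 ≤ Nb → 1 ≤ n → (∀ i ≤ n + 1, len t i ≤ lam) →
      (∑ i ∈ Finset.Icc 1 n, blockEnd t i ≤ Nb) →
      L1le P (fun ω => ∑ i ∈ Finset.Icc 1 n, ((∑ k ∈ Finset.Icc (t i) i, x k ω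
          - len t i * ((n : ℝ)⁻¹ * ∑ k ∈ Finset.range n, x k ω)) ^ 2 - len t i * s))
        (7 * B * (lam * √lam * √n) + K * rest α lam n Nb) := by
  obtain ⟨K1, hK1, b1⟩ := h.exists_l1le_bdry_sq hη h0 h1 hb
  obtain ⟨K2, hK2, b2⟩ := exists_l1le_blockSum_mul_rem h hi hη h0 h1 hb
  obtain ⟨K3, hK3, b3⟩ := exists_l1le_blockSum_mul_start h hi hη h0 hb
  obtain ⟨K4, hK4, b4⟩ := exists_l1le_blockSum_mul_end h2 hi hi' hη h0 h1 hb
  obtain ⟨K5, hK5, b5⟩ := exists_l1le_centring h hi hη h0 h1 hb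
  refine ⟨K1 + 2 * (K2 + K3 + K4) + K5, by positivity, fun n lam Nb hN hn hlam hNb => ?_⟩
  -- A block sum of drifts is `-S + bdry`, and `bdry` splits into `rem`, a start term and an end
  -- term. Thus the square is `S²`, three cross products with factor `-2`, and `bdry²`. The leading
  -- constants are `5B` from `S²` and `2B` from the centring.
  have T1 : L1le P _ _ := hi.integral_abs_sum_blockSum_sq_le hb hn fun i hin => hlam i (by omega)
  have T2 := (((b2 n lam Nb hN hn hlam).add (b3 n lam Nb hN hn hlam)).sub
    (b4 n lam Nb hN hn hlam hNb)).const_mul (-2)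
  have T3 := b1 n lam Nb hN hn hlam
  have T4 := b5 n lam Nb hN hn hlam
  refine L1le.congr (((T1.add T2).add (T3.add T4)).mono (le_of_eq ?_)) fun ω => ?_
  · rw [show |(-2 : ℝ)| = 2 by norm_num]; ring
  · generalize (n : ℝ)⁻¹ * ∑ k ∈ Finset.range n, x k ω = X
    rw [Finset.mul_sum, Finset.mul_sum, ← Finset.sum_neg_distrib, ← Finset.sum_add_distrib,
      ← Finset.sum_sub_distrib, Finset.mul_sum, ← Finset.sum_add_distrib,
      ← Finset.sum_add_distrib, ← Finset.sum_add_distrib, ← Finset.sum_add_distrib]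
    refine Finset.sum_congr rfl fun i _ => ?_
    have e1 : ∑ k ∈ Finset.Icc (t i) i, x k ω = -blockSum t ξ i ω + bdry η α y r δ (t i) i ω :=
      h.sum_drift_eq hη (hb.le i) ω
    rw [e1, bdry]
    ring

end Core


/-! ### Independent inputs and their filtration. -/

section Inputs

variable {Ω S : Type*} {mΩ : MeasurableSpace Ω} [MeasurableSpace S]

/-- Independent inputs with common law `N`. -/
structure Inputs (P : Measure Ω) (N : Measure S) (X : ℕ → Ω → S) : Prop where
  meas : ∀ i, Measurable (X i)
  law : ∀ i, P.map (X i) = N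
  indep : iIndepFun X P

/-- The information in the inputs up to an index. -/
def inputFiltration {X : ℕ → Ω → S} (hX : ∀ i, Measurable (X i)) : Filtration ℕ mΩ where
  seq k := ⨆ i ∈ Set.Iic k, MeasurableSpace.comap (X i) inferInstance
  mono' _ _ hab := biSup_mono fun _ hi => le_trans hi hab
  le' _ := iSup₂_le fun i _ => (hX i).comap_le

variable {P : Measure Ω} {N : Measure S} {X : ℕ → Ω → S} {E : Type*} [MeasurableSpace E]

lemma Inputs.measurable_input (h : Inputs P N X) (k : ℕ) :
    Measurable[inputFiltration h.meas k] (X k) :=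
  Measurable.mono (comap_measurable (X k))
    (le_biSup (fun i => MeasurableSpace.comap (X i) inferInstance) (Set.mem_Iic.2 le_rfl)) le_rfl

lemma Inputs.indepFun (h : Inputs P N X) {k : ℕ} {Y : Ω → E}
    (hY : Measurable[inputFiltration h.meas k] Y) : IndepFun Y (X (k + 1)) P := by
  rw [IndepFun_iff_Indep]
  have h1 := indep_iSup_of_disjoint (fun i => (h.meas i).comap_le) h.indep.iIndep
    (S := Set.Iic k) (T := {k + 1}) (by simp)
  refine indep_of_indep_of_le_left ?_ hY.comap_le
  refine indep_of_indep_of_le_right h1 ?_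
  simp

lemma Inputs.ae_input (h : Inputs P N X) (k : ℕ) {p : S → Prop} (hp : ∀ᵐ a ∂N, p a) :
    ∀ᵐ ω ∂P, p (X k ω) := by
  rw [← h.law k] at hp
  exact ae_of_ae_map (h.meas k).aemeasurable hp

lemma Inputs.integrable_comp (h : Inputs P N X) (k : ℕ) {ψ : S → ℝ} (hψ : Integrable ψ N) :
    Integrable (fun ω => ψ (X k ω)) P := by
  rw [← h.law k] at hψ
  exact hψ.comp_measurable (h.meas k)

lemma Inputs.integral_comp (h : Inputs P N X) (k : ℕ) {ψ : S → ℝ}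
    (hψ : AEStronglyMeasurable ψ N) : ∫ ω, ψ (X k ω) ∂P = ∫ a, ψ a ∂N := by
  rw [← h.law k] at hψ ⊢
  exact (integral_map (h.meas k).aemeasurable hψ).symm

variable [IsProbabilityMeasure P]

lemma Inputs.isProbabilityMeasure (h : Inputs P N X) : IsProbabilityMeasure N := by
  rw [← h.law 0]; exact Measure.isProbabilityMeasure_map (h.meas 0).aemeasurable

/-- The next input can be integrated out first. -/
lemma Inputs.integral_next (h : Inputs P N X) {k : ℕ} {Y : Ω → E}
    (hY : Measurable[inputFiltration h.meas k] Y) {Ψ : E × S → ℝ} (hΨ : Measurable Ψ)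
    (hi : Integrable (fun ω => Ψ (Y ω, X (k + 1) ω)) P) :
    ∫ ω, Ψ (Y ω, X (k + 1) ω) ∂P = ∫ ω, ∫ a, Ψ (Y ω, a) ∂N ∂P := by
  have := h.isProbabilityMeasure
  have hYm : Measurable Y := hY.mono ((inputFiltration h.meas).le k) le_rfl
  have hp : Measurable fun ω => (Y ω, X (k + 1) ω) := hYm.prodMk (h.meas _)
  have e := (indepFun_iff_map_prod_eq_prod_map_map hYm.aemeasurable
    (h.meas (k + 1)).aemeasurable).1 (h.indepFun hY)
  rw [h.law] at e
  have := Measure.isProbabilityMeasure_map (μ := P) hYm.aemeasurable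
  have hi2 : Integrable Ψ ((P.map Y).prod N) := by
    rw [← e]
    exact (integrable_map_measure hΨ.aestronglyMeasurable hp.aemeasurable).2 hi
  calc _ = ∫ q, Ψ q ∂(P.map fun ω => (Y ω, X (k + 1) ω)) :=
        (integral_map hp.aemeasurable hΨ.aestronglyMeasurable).symm
    _ = ∫ y, ∫ a, Ψ (y, a) ∂N ∂(P.map Y) := by rw [e]; exact integral_prod Ψ hi2
    _ = _ := integral_map hYm.aemeasurable
        hΨ.stronglyMeasurable.integral_prod_right'.aestronglyMeasurable

omit [IsProbabilityMeasure P] in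
lemma Inputs.integrable_mul (h : Inputs P N X) {k : ℕ} {Y : Ω → ℝ}
    (hY : Measurable[inputFiltration h.meas k] Y) (hYi : Integrable Y P) {ψ : S → ℝ}
    (hψ : Measurable ψ) (hψi : Integrable ψ N) :
    Integrable (fun ω => Y ω * ψ (X (k + 1) ω)) P :=
  ((h.indepFun hY).comp measurable_id hψ).integrable_mul hYi (h.integrable_comp _ hψi)

omit [IsProbabilityMeasure P] in
lemma Inputs.integral_mul (h : Inputs P N X) {k : ℕ} {Y : Ω → ℝ}
    (hY : Measurable[inputFiltration h.meas k] Y) {ψ : S → ℝ} (hψ : Measurable ψ) :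
    ∫ ω, Y ω * ψ (X (k + 1) ω) ∂P = (∫ ω, Y ω ∂P) * ∫ a, ψ a ∂N := by
  have hYm : Measurable Y := hY.mono ((inputFiltration h.meas).le k) le_rfl
  rw [← h.integral_comp (k + 1) hψ.aestronglyMeasurable]
  exact ((h.indepFun hY).comp measurable_id hψ).integral_fun_mul_eq_mul_integral
    hYm.aestronglyMeasurable (hψ.comp (h.meas _)).aestronglyMeasurable

end Inputs

/-! ### Decay of the fourth moments of the iterates. -/

section Recursion

/-- From `(1 + 1/m)^(-p) ≥ exp(-p/m) ≥ 1 - p/m`. -/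
lemma rpow_neg_sub_le {p m : ℝ} (hp : 0 ≤ p) (hm : 0 < m) :
    m ^ (-p) - (m + 1) ^ (-p) ≤ p * m ^ (-p - 1) := by
  have e1 : (m + 1) ^ (-p) = m ^ (-p) * (1 + 1 / m) ^ (-p) := by
    rw [← Real.mul_rpow hm.le (by positivity)]; congr 1; field_simp
  have e2 : 1 - p / m ≤ (1 + 1 / m) ^ (-p) := by
    have h1 : (1 + 1 / m) ^ p ≤ Real.exp (p / m) := by
      calc (1 + 1 / m) ^ p ≤ (Real.exp (1 / m)) ^ p := by
            gcongr; linarith [Real.add_one_le_exp (1 / m)]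
        _ = _ := by rw [← Real.exp_mul]; congr 1; ring
    have h2 : 1 - p / m ≤ Real.exp (-(p / m)) := by linarith [Real.add_one_le_exp (-(p / m))]
    rw [Real.rpow_neg (by positivity)]
    refine h2.trans ?_
    rw [Real.exp_neg]
    exact inv_anti₀ (by positivity) h1
  rw [e1, Real.rpow_sub_one hm.ne']
  have h3 : 0 < m ^ (-p) := by positivity
  have := mul_le_mul_of_nonneg_left e2 h3.le
  calc _ ≤ m ^ (-p) - m ^ (-p) * (1 - p / m) := by linarith
    _ = _ := by ring

/-- A stable recursion with a third-order source term. -/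
lemma exists_le_rpow_of_recursion {a : ℕ → ℝ} {η α m C : ℝ} (hη : 0 < η) (h0 : 0 < α) (h1 : α < 1)
    (hm : 0 < m) (hC : 0 ≤ C)
    (hrec : ∀ᶠ k : ℕ in atTop, a (k + 1) ≤ (1 - 2 * m * (η * ((k : ℝ) + 1) ^ (-α))) * a k
      + C * (η * ((k : ℝ) + 1) ^ (-α)) ^ 3) :
    ∃ c, 0 ≤ c ∧ ∀ k : ℕ, a k ≤ c * ((k : ℝ) + 1) ^ (-(2 * α)) := by
  have hcast : Tendsto (fun k : ℕ => (k : ℝ) + 1) atTop atTop :=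
    tendsto_atTop_add_const_right _ _ tendsto_natCast_atTop_atTop
  have t1 : Tendsto (fun k : ℕ => 2 * m * (η * ((k : ℝ) + 1) ^ (-α))) atTop (𝓝 0) := by
    have := ((tendsto_rpow_neg_atTop h0).comp hcast).const_mul η |>.const_mul (2 * m)
    simpa using this
  have t2 : Tendsto (fun k : ℕ => 2 * α * ((k : ℝ) + 1) ^ (-(1 - α))) atTop (𝓝 0) := by
    have := ((tendsto_rpow_neg_atTop (show 0 < 1 - α by linarith)).comp hcast).const_mul (2 * α)
    simpa using this
  obtain ⟨k0, hk0⟩ := eventually_atTop.1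
    (hrec.and ((t1.eventually_lt_const one_pos).and
      (t2.eventually_lt_const (show 0 < m * η by positivity))))
  -- The first summand dominates the source term, the second the finitely many values before the
  -- recursion becomes contracting.
  set c := C * η ^ 2 / m + ∑ k ∈ Finset.range (k0 + 1), |a k| * ((k : ℝ) + 1) ^ (2 * α) with hc
  have hc0 : 0 ≤ c := by positivity
  refine ⟨c, hc0, fun k => ?_⟩
  have small : ∀ k ≤ k0, a k ≤ c * ((k : ℝ) + 1) ^ (-(2 * α)) := by
    intro k hk
    have e1 : |a k| * ((k : ℝ) + 1) ^ (2 * α) ≤ c := by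
      have := Finset.single_le_sum (f := fun k : ℕ => |a k| * ((k : ℝ) + 1) ^ (2 * α))
        (fun _ _ => by positivity) (Finset.mem_range.2 (Nat.lt_succ_of_le hk))
      refine this.trans (le_add_of_nonneg_left (by positivity))
    calc a k ≤ |a k| := le_abs_self _
      _ = |a k| * ((k : ℝ) + 1) ^ (2 * α) * ((k : ℝ) + 1) ^ (-(2 * α)) := by
          rw [mul_assoc, ← Real.rpow_add (by positivity)]; simp
      _ ≤ _ := by gcongr
  rcases le_total k k0 with hk | hk
  · exact small k hk
  induction k, hk using Nat.le_induction with
  | base => exact small k0 le_rfl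
  | succ k hk ih =>
    obtain ⟨g1, g2, g3⟩ := hk0 k hk
    have hx : (0 : ℝ) < (k : ℝ) + 1 := by positivity
    set x := (k : ℝ) + 1 with hxdef
    have hcast1 : ((k + 1 : ℕ) : ℝ) + 1 = x + 1 := by push_cast; ring
    rw [hcast1]
    have f1 := rpow_neg_sub_le (p := 2 * α) (by linarith) hx
    have f2 : 2 * α * x ^ (-(2 * α) - 1) ≤ m * η * x ^ (-(3 * α)) := by
      have : x ^ (-(2 * α) - 1) = x ^ (-(1 - α)) * x ^ (-(3 * α)) := by
        rw [← Real.rpow_add hx]; congr 1; ring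
      rw [this, ← mul_assoc]
      gcongr
    have f3 : (x ^ (-α)) ^ 3 = x ^ (-(3 * α)) := by
      rw [← Real.rpow_mul_natCast hx.le]; congr 1; push_cast; ring
    have f4 : x ^ (-α) * x ^ (-(2 * α)) = x ^ (-(3 * α)) := by
      rw [← Real.rpow_add hx]; congr 1; ring
    have f5 : C * η ^ 2 ≤ c * m := by
      have h5 : C * η ^ 2 / m ≤ c := le_add_of_nonneg_right (Finset.sum_nonneg fun _ _ => by positivity)
      rwa [div_le_iff₀ hm] at h5
    have hpos : 0 < x ^ (-(3 * α)) := by positivity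
    -- Of the gain `2mηc x^(-3α)` from the contraction, half pays for the source by `f5` and half
    -- for the decrease of `x^(-2α)` by `f1` and `f2`.
    calc a (k + 1) ≤ (1 - 2 * m * (η * x ^ (-α))) * (c * x ^ (-(2 * α)))
          + C * (η * x ^ (-α)) ^ 3 := by
          refine g1.trans ?_
          have : 0 ≤ 1 - 2 * m * (η * x ^ (-α)) := by linarith
          gcongr
      _ = c * x ^ (-(2 * α)) - 2 * m * η * c * (x ^ (-α) * x ^ (-(2 * α)))
          + C * η ^ 2 * η * (x ^ (-α)) ^ 3 := by ring
      _ ≤ c * x ^ (-(2 * α)) - 2 * m * η * c * x ^ (-(3 * α)) + c * m * η * x ^ (-(3 * α)) := by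
          rw [f3, f4]; gcongr
      _ = c * x ^ (-(2 * α)) - c * (m * η * x ^ (-(3 * α))) := by ring
      _ ≤ c * x ^ (-(2 * α)) - c * (x ^ (-(2 * α)) - (x + 1) ^ (-(2 * α))) := by
          have := mul_le_mul_of_nonneg_left (f1.trans f2) hc0
          linarith
      _ = _ := by ring

end Recursion


/-- A random field `G` with mean `g`, random Lipschitz constant `Φ`, and finite fourth moments,
such that `g` is strongly monotone around its zero `xs`, where its derivative is `A`. -/
structure StochasticField {d : ℕ} {S : Type*} [MeasurableSpace S] (N : Measure S)
    (G : Vec d → S → Vec d) (g : Vec d → Vec d) (A : Mat d) (xs : Vec d) (Φ : S → ℝ)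
    (μ L c : ℝ) : Prop where
  meas : Measurable fun q : Vec d × S => G q.1 q.2
  meas_env : Measurable Φ
  memLp_env : MemLp Φ 4 N
  lip : ∀ᵐ a ∂N, ∀ x y, ‖G x a - G y a‖ ≤ Φ a * ‖x - y‖
  memLp : MemLp (G xs) 4 N
  mean : ∀ x, ∫ a, G x a ∂N = g x
  mono : ∀ x, μ * ‖x - xs‖ ^ 2 ≤ inner ℝ (g x) (x - xs)
  norm_le : ∀ x, ‖g x‖ ≤ L * ‖x - xs‖
  taylor : ∀ x, ‖g x - A (x - xs)‖ ≤ c * ‖x - xs‖ ^ 2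
  symm : ∀ v w, inner ℝ (A v) w = inner ℝ v (A w)
  mu_pos : 0 < μ
  L_nonneg : 0 ≤ L
  c_nonneg : 0 ≤ c

section Iterates

variable {d : ℕ} {Ω S : Type*} {mΩ : MeasurableSpace Ω} [MeasurableSpace S]
  {P : Measure Ω} {N : Measure S} {X : ℕ → Ω → S}
  {G : Vec d → S → Vec d} {g : Vec d → Vec d} {A : Mat d} {xs : Vec d} {Φ : S → ℝ}
  {μ L c η α : ℝ} {W : ℕ → Ω → Vec d}

lemma StochasticField.measurable_field (hG : StochasticField N G g A xs Φ μ L c) (x : Vec d) :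
    Measurable (G x) := hG.meas.comp measurable_prodMk_left

lemma StochasticField.memLp_field (hG : StochasticField N G g A xs Φ μ L c) (x : Vec d) :
    MemLp (G x) 4 N := by
  have h1 : MemLp (fun a => G x a - G xs a) 4 N := by
    refine MemLp.mono (hG.memLp_env.mul_const ‖x - xs‖)
      ((hG.measurable_field x).sub (hG.measurable_field xs)).aestronglyMeasurable ?_
    filter_upwards [hG.lip] with a ha
    exact (ha x xs).trans (Real.le_norm_self _)
  convert h1.add hG.memLp using 1
  ext a : 1
  simp

lemma StochasticField.integrable_field [IsProbabilityMeasure N]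
    (hG : StochasticField N G g A xs Φ μ L c) (x : Vec d) : Integrable (G x) N :=
  (hG.memLp_field x).integrable (by norm_num)

/-- The stochastic approximation recursion driven by the field `G`. -/
structure Iterates (X : ℕ → Ω → S) (G : Vec d → S → Vec d) (η α : ℝ) (W : ℕ → Ω → Vec d) :
    Prop where
  init : ∃ x0, ∀ ω, W 0 ω = x0
  step : ∀ k ω, W (k + 1) ω = W k ω - (η * ((k : ℝ) + 1) ^ (-α)) • G (W k ω) (X (k + 1) ω)

lemma Iterates.measurable (hW : Iterates X G η α W) (hX : Inputs P N X)
    (hG : StochasticField N G g A xs Φ μ L c) (k : ℕ) :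
    Measurable[inputFiltration hX.meas k] (W k) := by
  induction k with
  | zero =>
    obtain ⟨x0, h⟩ := hW.init
    rw [show W 0 = fun _ => x0 from funext h]
    exact measurable_const
  | succ k ih =>
    rw [show W (k + 1) = _ from funext (hW.step k)]
    have h1 := ih.mono ((inputFiltration hX.meas).mono k.le_succ) le_rfl
    have h2 : Measurable[inputFiltration hX.meas (k + 1)] fun ω => G (W k ω) (X (k + 1) ω) :=
      hG.meas.comp (h1.prodMk (hX.measurable_input (k + 1)))
    have h3 : Measurable[inputFiltration hX.meas (k + 1)]
        fun ω => (η * ((k : ℝ) + 1) ^ (-α)) • G (W k ω) (X (k + 1) ω) :=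
      (measurable_const_smul (η * ((k : ℝ) + 1) ^ (-α))).comp h2
    exact h1.sub h3

lemma Iterates.measurable' (hW : Iterates X G η α W) (hX : Inputs P N X)
    (hG : StochasticField N G g A xs Φ μ L c) (k : ℕ) : Measurable (W k) :=
  (hW.measurable hX hG k).mono ((inputFiltration hX.meas).le k) le_rfl

variable [IsProbabilityMeasure P]

lemma Inputs.integrable_env_mul (hX : Inputs P N X) (hG : StochasticField N G g A xs Φ μ L c)
    {k : ℕ} {Y : Ω → ℝ} (hY : Measurable[inputFiltration hX.meas k] Y) (hYi : Integrable Y P) :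
    Integrable (fun ω => Y ω * Φ (X (k + 1) ω) ^ 4) P ∧
    Integrable (fun ω => Y ω * Φ (X (k + 1) ω) ^ 2) P ∧
    Integrable (fun ω => Y ω * ‖G xs (X (k + 1) ω)‖ ^ 2) P := by
  have := hX.isProbabilityMeasure
  refine ⟨?_, ?_, ?_⟩
  · exact hX.integrable_mul hY hYi (hG.meas_env.pow_const 4) (integrable_pow_four hG.memLp_env)
  · exact hX.integrable_mul hY hYi (hG.meas_env.pow_const 2)
      (integrable_pow_two (memLp_two_of_four hG.memLp_env))
  · exact hX.integrable_mul hY hYi ((hG.measurable_field xs).norm.pow_const 2)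
      (integrable_pow_two (memLp_two_of_four hG.memLp.norm))

/-- The field at the current iterate is as integrable as the iterate. -/
lemma Iterates.memLp_increment (hW : Iterates X G η α W) (hX : Inputs P N X)
    (hG : StochasticField N G g A xs Φ μ L c) {k : ℕ} (h : MemLp (fun ω => W k ω - xs) 4 P) :
    MemLp (fun ω => G (W k ω) (X (k + 1) ω)) 4 P := by
  have := hX.isProbabilityMeasure
  have hWm := hW.measurable hX hG k
  have hWm' := hW.measurable' hX hG k
  have hX' := hX.meas (k + 1)
  have m1 : MemLp (fun ω => ‖W k ω - xs‖ * Φ (X (k + 1) ω)) 4 P := by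
    refine (memLp_four_iff ((hWm'.sub_const xs).norm.mul
      (hG.meas_env.comp hX')).aestronglyMeasurable).2 ?_
    have hY : Measurable[inputFiltration hX.meas k] fun ω => ‖W k ω - xs‖ ^ 4 :=
      (measurable_norm.comp (hWm.sub_const xs)).pow_const 4
    refine (hX.integrable_env_mul hG hY
      ((memLp_four_iff h.aestronglyMeasurable).1 h)).1.congr (ae_of_all _ fun ω => ?_)
    change ‖W k ω - xs‖ ^ 4 * Φ (X (k + 1) ω) ^ 4 = ‖‖W k ω - xs‖ * Φ (X (k + 1) ω)‖ ^ 4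
    rw [norm_mul, norm_norm, mul_pow, Real.norm_eq_abs, Even.pow_abs (by decide)]
  have m2 : MemLp (fun ω => G xs (X (k + 1) ω)) 4 P := by
    have h1 := hG.memLp
    rw [← hX.law (k + 1)] at h1
    exact h1.comp_of_map hX'.aemeasurable
  have hm : Measurable fun ω => G (W k ω) (X (k + 1) ω) := hG.meas.comp (hWm'.prodMk hX')
  have m3 : MemLp (fun ω => G (W k ω) (X (k + 1) ω) - G xs (X (k + 1) ω)) 4 P := by
    refine MemLp.mono m1 (hm.sub ((hG.measurable_field xs).comp hX')).aestronglyMeasurable ?_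
    filter_upwards [hX.ae_input (k + 1) hG.lip] with ω hω
    refine (hω _ _).trans ?_
    rw [mul_comm]
    exact Real.le_norm_self _
  convert m3.add m2 using 1
  ext ω : 1
  simp

lemma Iterates.memLp_sub (hW : Iterates X G η α W) (hX : Inputs P N X)
    (hG : StochasticField N G g A xs Φ μ L c) (k : ℕ) : MemLp (fun ω => W k ω - xs) 4 P := by
  induction k with
  | zero =>
    obtain ⟨x0, h⟩ := hW.init
    simp only [h]
    exact memLp_const _
  | succ k ih =>
    have h1 := ih.sub ((hW.memLp_increment hX hG ih).const_smul (η * ((k : ℝ) + 1) ^ (-α)))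
    rw [show (fun ω => W (k + 1) ω - xs) = fun ω => (W k ω - xs)
      - (η * ((k : ℝ) + 1) ^ (-α)) • G (W k ω) (X (k + 1) ω) from
      funext fun ω => by rw [hW.step k ω]; abel]
    exact h1

omit [IsProbabilityMeasure P] in
-- Expand the square of `‖D - γv‖²` with `b = ⟨v, D⟩`. Both `b² ≤ ‖v‖²‖D‖²` and `-4γ³b‖v‖² ≤ 2γ²b² +
-- 2γ⁴‖v‖⁴` are used; the term linear in `γ` is kept because its mean is the contraction.
lemma norm_sub_smul_pow_four_le (D v : Vec d) (γ : ℝ) :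
    ‖D - γ • v‖ ^ 4 ≤ ‖D‖ ^ 4 - 4 * γ * (‖D‖ ^ 2 * inner ℝ v D) + 8 * γ ^ 2 * (‖D‖ ^ 2 * ‖v‖ ^ 2)
      + 3 * γ ^ 4 * ‖v‖ ^ 4 := by
  have e1 : ‖D - γ • v‖ ^ 2 = ‖D‖ ^ 2 - 2 * γ * inner ℝ v D + γ ^ 2 * ‖v‖ ^ 2 := by
    rw [norm_sub_sq_real, inner_smul_right, real_inner_comm, norm_smul, mul_pow, Real.norm_eq_abs,
      sq_abs]
    ring
  have e2 : ‖D - γ • v‖ ^ 4 = (‖D - γ • v‖ ^ 2) ^ 2 := by ring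
  have hb : |inner ℝ v D| ≤ ‖v‖ * ‖D‖ := abs_real_inner_le_norm v D
  rw [e2, e1]
  set b : ℝ := inner ℝ v D
  set p := ‖D‖
  set q := ‖v‖
  have hp : 0 ≤ p := norm_nonneg _
  have hq : 0 ≤ q := norm_nonneg _
  have hb2 : b ^ 2 ≤ q ^ 2 * p ^ 2 := by
    rw [← sq_abs, ← mul_pow]; exact pow_le_pow_left₀ (abs_nonneg _) hb 2
  have h1 : γ ^ 2 * b ^ 2 ≤ γ ^ 2 * (q ^ 2 * p ^ 2) := mul_le_mul_of_nonneg_left hb2 (sq_nonneg γ)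
  nlinarith [mul_nonneg (sq_nonneg γ) (sq_nonneg (b + γ * q ^ 2))]

set_option maxHeartbeats 1600000 in
/-- The fourth moments of the iterates. -/
lemma Iterates.exists_fourth_moment_le (hW : Iterates X G η α W) (hX : Inputs P N X)
    (hG : StochasticField N G g A xs Φ μ L c) (hη : 0 < η) (h0 : 0 < α) (h1 : α < 1) :
    ∃ C, 0 ≤ C ∧ ∀ k : ℕ, ∫ ω, ‖W k ω - xs‖ ^ 4 ∂P ≤ C * ((k : ℝ) + 1) ^ (-(2 * α)) := by
  have := hX.isProbabilityMeasure
  set s2 := ∫ a, ‖G xs a‖ ^ 2 ∂N with hs2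
  set s4 := ∫ a, ‖G xs a‖ ^ 4 ∂N with hs4
  set f2 := ∫ a, Φ a ^ 2 ∂N with hf2
  set f4 := ∫ a, Φ a ^ 4 ∂N with hf4
  have hs2' : 0 ≤ s2 := integral_nonneg fun _ => by positivity
  have hs4' : 0 ≤ s4 := integral_nonneg fun _ => by positivity
  have hf2' : 0 ≤ f2 := integral_nonneg fun _ => by positivity
  have hf4' : 0 ≤ f4 := integral_nonneg fun _ => by positivity
  have hμ := hG.mu_pos
  set a : ℕ → ℝ := fun k => ∫ ω, ‖W k ω - xs‖ ^ 4 ∂P with ha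
  have ha0 : ∀ k, 0 ≤ a k := fun k => integral_nonneg fun _ => by positivity
  -- The field at the iterate is bounded by its value at `xs` plus `Φ‖D‖`. Squaring and taking the
  -- fourth power cost factors `2` and `8`, so `8` and `3` in `norm_sub_smul_pow_four_le` become
  -- `16` and `24`.
  have key : ∀ (k : ℕ) (γ : ℝ), 0 ≤ γ → γ = η * ((k : ℝ) + 1) ^ (-α) →
      a (k + 1) ≤ a k - 4 * γ * (μ * a k) + 16 * γ ^ 2 * (√(a k) * s2) + 16 * γ ^ 2 * (a k * f2)
        + 24 * γ ^ 4 * s4 + 24 * γ ^ 4 * (a k * f4) := by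
    intro k γ hγ hγe
    have mD := hW.memLp_sub hX hG k
    have hWm := hW.measurable hX hG k
    have hWm' := hW.measurable' hX hG k
    have hX' := hX.meas (k + 1)
    set D : Ω → Vec d := fun ω => W k ω - xs with hD
    have hDm : Measurable[inputFiltration hX.meas k] fun ω => ‖D ω‖ :=
      measurable_norm.comp (hWm.sub_const xs)
    have iD4 : Integrable (fun ω => ‖D ω‖ ^ 4) P := integrable_pow_four mD.norm
    have iD2 : Integrable (fun ω => ‖D ω‖ ^ 2) P := integrable_pow_two (memLp_two_of_four mD.norm)
    obtain ⟨i44, i42, -⟩ := hX.integrable_env_mul hG (hDm.pow_const 4) iD4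
    obtain ⟨-, -, i22⟩ := hX.integrable_env_mul hG (hDm.pow_const 2) iD2
    have i04 : Integrable (fun ω => ‖G xs (X (k + 1) ω)‖ ^ 4) P :=
      hX.integrable_comp (k + 1) (ψ := fun a => ‖G xs a‖ ^ 4) (integrable_pow_four hG.memLp.norm)
    have mG := hW.memLp_increment hX hG mD
    set V : Ω → Vec d := fun ω => G (W k ω) (X (k + 1) ω) with hV
    have iV : Integrable (fun ω => ‖D ω‖ ^ 2 * inner ℝ (V ω) (D ω)) P := by
      refine integrable_monomial mD.norm mG.norm
        ((mD.aestronglyMeasurable.norm.pow 2).mul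
          (mG.aestronglyMeasurable.inner mD.aestronglyMeasurable)) (c := 1) fun ω => ?_
      rw [abs_mul, abs_of_nonneg (by positivity : (0 : ℝ) ≤ ‖D ω‖ ^ 2)]
      have h1 := abs_real_inner_le_norm (V ω) (D ω)
      have h2 := mul_le_mul_of_nonneg_left h1 (sq_nonneg ‖D ω‖)
      refine h2.trans ?_
      nlinarith [sq_nonneg (‖D ω‖ ^ 2 - ‖V ω‖ ^ 2), sq_nonneg (‖D ω‖ * ‖V ω‖ - ‖D ω‖ ^ 2)]
    -- Integrating out the next input replaces the field by its mean `g`, to which strong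
    -- monotonicity applies.
    have eV : μ * a k ≤ ∫ ω, ‖D ω‖ ^ 2 * inner ℝ (V ω) (D ω) ∂P := by
      have h1 := hX.integral_next hWm
        (Ψ := fun q => ‖q.1 - xs‖ ^ 2 * inner ℝ (G q.1 q.2) (q.1 - xs))
        (((measurable_fst.sub_const xs).norm.pow_const 2).mul
          (hG.meas.inner (measurable_fst.sub_const xs))) iV
      rw [h1, ha, ← integral_const_mul]
      have h2 : ∀ ω, ∫ a, ‖W k ω - xs‖ ^ 2 * inner ℝ (G (W k ω) a) (W k ω - xs) ∂N
          = ‖W k ω - xs‖ ^ 2 * inner ℝ (g (W k ω)) (W k ω - xs) := by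
        intro ω
        rw [integral_const_mul]
        congr 1
        simp only [real_inner_comm (W k ω - xs)]
        rw [integral_inner (hG.integrable_field _), hG.mean]
      simp only [h2]
      have hgm : Measurable fun ω => g (W k ω) := by
        have h3 : Measurable g := by
          rw [show g = fun x => ∫ a, G x a ∂N from funext fun x => (hG.mean x).symm]
          exact hG.meas.stronglyMeasurable.integral_prod_right'.measurable
        exact h3.comp hWm'
      have hL := hG.L_nonneg
      refine integral_mono (iD4.const_mul μ) ?_ fun ω => ?_
      · refine Integrable.mono' (iD4.const_mul L) (((hWm'.sub_const xs).norm.pow_const 2).mul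
          (hgm.inner (hWm'.sub_const xs))).aestronglyMeasurable (ae_of_all _ fun ω => ?_)
        rw [norm_mul, Real.norm_eq_abs, Real.norm_eq_abs,
          abs_of_nonneg (by positivity : (0 : ℝ) ≤ ‖W k ω - xs‖ ^ 2)]
        calc _ ≤ ‖W k ω - xs‖ ^ 2 * (L * ‖W k ω - xs‖ * ‖W k ω - xs‖) := by
              gcongr
              exact (abs_real_inner_le_norm _ _).trans (by gcongr; exact hG.norm_le _)
          _ = _ := by simp only [hD]; ring
      · have h4 := mul_le_mul_of_nonneg_left (hG.mono (W k ω)) (sq_nonneg ‖W k ω - xs‖)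
        calc _ = ‖W k ω - xs‖ ^ 2 * (μ * ‖W k ω - xs‖ ^ 2) := by ring
          _ ≤ _ := h4
    have i1 : Integrable (fun ω => ‖D ω‖ ^ 4 - 4 * γ * (‖D ω‖ ^ 2 * inner ℝ (V ω) (D ω))) P :=
      iD4.sub (iV.const_mul _)
    have i2 := i22.const_mul (16 * γ ^ 2)
    have i3 := i42.const_mul (16 * γ ^ 2)
    have i4 := i04.const_mul (24 * γ ^ 4)
    have i5 := i44.const_mul (24 * γ ^ 4)
    have i12 : Integrable (fun ω => ‖D ω‖ ^ 4 - 4 * γ * (‖D ω‖ ^ 2 * inner ℝ (V ω) (D ω))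
      + 16 * γ ^ 2 * (‖D ω‖ ^ 2 * ‖G xs (X (k + 1) ω)‖ ^ 2)) P := i1.add i2
    have i13 : Integrable (fun ω => ‖D ω‖ ^ 4 - 4 * γ * (‖D ω‖ ^ 2 * inner ℝ (V ω) (D ω))
      + 16 * γ ^ 2 * (‖D ω‖ ^ 2 * ‖G xs (X (k + 1) ω)‖ ^ 2)
      + 16 * γ ^ 2 * (‖D ω‖ ^ 4 * Φ (X (k + 1) ω) ^ 2)) P := i12.add i3
    have i14 : Integrable (fun ω => ‖D ω‖ ^ 4 - 4 * γ * (‖D ω‖ ^ 2 * inner ℝ (V ω) (D ω))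
      + 16 * γ ^ 2 * (‖D ω‖ ^ 2 * ‖G xs (X (k + 1) ω)‖ ^ 2)
      + 16 * γ ^ 2 * (‖D ω‖ ^ 4 * Φ (X (k + 1) ω) ^ 2)
      + 24 * γ ^ 4 * ‖G xs (X (k + 1) ω)‖ ^ 4) P := i13.add i4
    have main : a (k + 1) ≤ ∫ ω, (‖D ω‖ ^ 4 - 4 * γ * (‖D ω‖ ^ 2 * inner ℝ (V ω) (D ω))
      + 16 * γ ^ 2 * (‖D ω‖ ^ 2 * ‖G xs (X (k + 1) ω)‖ ^ 2)
      + 16 * γ ^ 2 * (‖D ω‖ ^ 4 * Φ (X (k + 1) ω) ^ 2)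
      + 24 * γ ^ 4 * ‖G xs (X (k + 1) ω)‖ ^ 4
      + 24 * γ ^ 4 * (‖D ω‖ ^ 4 * Φ (X (k + 1) ω) ^ 4)) ∂P := by
      refine integral_mono_ae (integrable_pow_four (hW.memLp_sub hX hG (k + 1)).norm)
        (i14.add i5) ?_
      filter_upwards [hX.ae_input (k + 1) hG.lip] with ω hω
      have e1 : W (k + 1) ω - xs = D ω - γ • V ω := by
        rw [hW.step k ω, hγe]; simp only [hD, hV]; abel
      have hle := hω (W k ω) xs
      have hV1 : ‖V ω‖ ≤ ‖G xs (X (k + 1) ω)‖ + Φ (X (k + 1) ω) * ‖D ω‖ := by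
        have := norm_sub_norm_le (V ω) (G xs (X (k + 1) ω))
        have h3 : ‖V ω - G xs (X (k + 1) ω)‖ ≤ Φ (X (k + 1) ω) * ‖D ω‖ := hle
        linarith
      have hV0 := norm_nonneg (V ω)
      rw [e1]
      refine (norm_sub_smul_pow_four_le _ _ _).trans ?_
      set s := ‖G xs (X (k + 1) ω)‖
      set f := Φ (X (k + 1) ω)
      set p := ‖D ω‖
      have hV2 : ‖V ω‖ ^ 2 ≤ 2 * s ^ 2 + 2 * (f * p) ^ 2 := by
        have := pow_le_pow_left₀ hV0 hV1 2
        nlinarith [sq_nonneg (s - f * p)]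
      have hV4 : ‖V ω‖ ^ 4 ≤ 8 * s ^ 4 + 8 * (f * p) ^ 4 := by
        have := pow_le_pow_left₀ (sq_nonneg _) hV2 2
        nlinarith [sq_nonneg (s ^ 2 - (f * p) ^ 2)]
      have h5 : 8 * γ ^ 2 * (p ^ 2 * ‖V ω‖ ^ 2) ≤ 8 * γ ^ 2 * (p ^ 2 * (2 * s ^ 2 + 2 * (f * p) ^ 2)) := by
        gcongr
      have h6 : 3 * γ ^ 4 * ‖V ω‖ ^ 4 ≤ 3 * γ ^ 4 * (8 * s ^ 4 + 8 * (f * p) ^ 4) := by gcongr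
      calc _ ≤ p ^ 4 - 4 * γ * (p ^ 2 * inner ℝ (V ω) (D ω))
            + 8 * γ ^ 2 * (p ^ 2 * (2 * s ^ 2 + 2 * (f * p) ^ 2))
            + 3 * γ ^ 4 * (8 * s ^ 4 + 8 * (f * p) ^ 4) := by gcongr
        _ = _ := by ring
    rw [integral_add i14 i5, integral_add i13 i4, integral_add i12 i3, integral_add i1 i2,
      integral_sub iD4 (iV.const_mul _)] at main
    simp only [integral_const_mul] at main
    rw [hX.integral_mul (hDm.pow_const 4) (hG.meas_env.pow_const 4),
      hX.integral_mul (hDm.pow_const 4) (hG.meas_env.pow_const 2),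
      hX.integral_mul (hDm.pow_const 2) (ψ := fun a => ‖G xs a‖ ^ 2)
        ((hG.measurable_field xs).norm.pow_const 2),
      hX.integral_comp (k + 1) (ψ := fun a => ‖G xs a‖ ^ 4)
        ((hG.measurable_field xs).norm.pow_const 4).aestronglyMeasurable] at main
    have e2 : ∫ ω, ‖D ω‖ ^ 2 ∂P ≤ √(a k) := Real.le_sqrt_of_sq_le (sq_integral_sq_le mD.norm)
    have e3 : 16 * γ ^ 2 * ((∫ ω, ‖D ω‖ ^ 2 ∂P) * s2) ≤ 16 * γ ^ 2 * (√(a k) * s2) := by gcongr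
    have e4 : 4 * γ * (μ * a k) ≤ 4 * γ * ∫ ω, ‖D ω‖ ^ 2 * inner ℝ (V ω) (D ω) ∂P := by gcongr
    have e5 : (∫ ω, ‖D ω‖ ^ 4 ∂P) = a k := rfl
    rw [e5] at main
    linarith
  have hcast : Tendsto (fun k : ℕ => (k : ℝ) + 1) atTop atTop :=
    tendsto_atTop_add_const_right _ _ tendsto_natCast_atTop_atTop
  have t1 : Tendsto (fun k : ℕ => η * ((k : ℝ) + 1) ^ (-α)) atTop (𝓝 0) := by
    simpa using ((tendsto_rpow_neg_atTop h0).comp hcast).const_mul η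
  have t2 : Tendsto (fun k : ℕ => 16 * (η * ((k : ℝ) + 1) ^ (-α)) * f2
      + 24 * (η * ((k : ℝ) + 1) ^ (-α)) ^ 3 * f4) atTop (𝓝 0) := by
    have := ((t1.const_mul 16).mul_const f2).add (((t1.pow 3).const_mul 24).mul_const f4)
    simpa using this
  refine exists_le_rpow_of_recursion (a := a) hη h0 h1 (m := μ)
    (C := 64 * s2 ^ 2 / μ + 24 * s4) hμ (by positivity) ?_
  filter_upwards [t1.eventually_lt_const one_pos, t2.eventually_lt_const hμ] with k hk1 hk2
  have hk := key k _ (by positivity) rfl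
  have hγ : 0 < η * ((k : ℝ) + 1) ^ (-α) := by positivity
  set γ := η * ((k : ℝ) + 1) ^ (-α)
  -- Weighted arithmetic-geometric mean. Of the contraction `4γμ a k`, one quarter pays for this
  -- term and one for the terms with `f2` and `f4`, which leaves the `2μ` required by the recursion
  -- lemma.
  have f1 : 16 * γ ^ 2 * (√(a k) * s2) ≤ γ * μ * a k + 64 * s2 ^ 2 / μ * γ ^ 3 := by
    have hs : √(a k) ^ 2 = a k := Real.sq_sqrt (ha0 k)
    have h3 : 64 * s2 ^ 2 / μ * γ ^ 3 = γ * (64 * s2 ^ 2 * γ ^ 2 / μ) := by ring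
    have h4 : 16 * γ * (√(a k) * s2) ≤ μ * √(a k) ^ 2 + 64 * s2 ^ 2 * γ ^ 2 / μ := by
      rw [← sub_nonneg]
      have : μ * √(a k) ^ 2 + 64 * s2 ^ 2 * γ ^ 2 / μ - 16 * γ * (√(a k) * s2)
          = (μ * √(a k) - 8 * s2 * γ) ^ 2 / μ := by field_simp; ring
      rw [this]; positivity
    rw [hs] at h4
    rw [h3]
    nlinarith
  have f2' : (16 * γ ^ 2 * f2 + 24 * γ ^ 4 * f4) * a k ≤ γ * μ * a k := by
    refine mul_le_mul_of_nonneg_right ?_ (ha0 k)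
    nlinarith
  have f3 : 24 * γ ^ 4 * s4 ≤ 24 * s4 * γ ^ 3 := by
    have : γ ^ 4 ≤ γ ^ 3 := pow_le_pow_of_le_one hγ.le hk1.le (by norm_num)
    nlinarith
  linarith

end Iterates


/-! ### The vector recursion tested against a direction. -/

section Components

variable {d : ℕ} {Ω S : Type*} {mΩ : MeasurableSpace Ω} [MeasurableSpace S]
  {P : Measure Ω} {N : Measure S} {X : ℕ → Ω → S}
  {G : Vec d → S → Vec d} {g : Vec d → Vec d} {A : Mat d} {xs : Vec d} {Φ : S → ℝ}
  {μ L c η α : ℝ} {W : ℕ → Ω → Vec d} [IsProbabilityMeasure P]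

omit [IsProbabilityMeasure P] in
lemma StochasticField.zero (hG : StochasticField N G g A xs Φ μ L c) : g xs = 0 := by
  have := hG.norm_le xs
  simpa using this

lemma StochasticField.measurable_mean [IsProbabilityMeasure N]
    (hG : StochasticField N G g A xs Φ μ L c) : Measurable g := by
  rw [show g = fun x => ∫ a, G x a ∂N from funext fun x => (hG.mean x).symm]
  exact hG.meas.stronglyMeasurable.integral_prod_right'.measurable

/-- The innovations of a component of the recursion. -/
lemma Inputs.innovation (hX : Inputs P N X) (hG : StochasticField N G g A xs Φ μ L c) (p : Vec d) :
    Innovation P (inputFiltration hX.meas) (∫ a, inner ℝ p (G xs a) ^ 2 ∂N)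
      (‖p‖ ^ 2 * √(∫ a, ‖G xs a‖ ^ 4 ∂N)) (fun k ω => inner ℝ p (G xs (X (k + 1) ω))) := by
  have := hX.isProbabilityMeasure
  have hm : Measurable fun a => inner ℝ p (G xs a) := measurable_const.inner (hG.measurable_field xs)
  have hL : MemLp (fun a => inner ℝ p (G xs a)) 4 N := hG.memLp.const_inner p
  refine ⟨fun k => hm.comp (hX.measurable_input (k + 1)),
    fun k Y hY => (hX.indepFun hY).comp measurable_id hm, fun k => ?_, fun k => ?_, fun k => ?_,
    fun k => ?_, by positivity⟩
  · rw [← hX.law (k + 1)] at hL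
    exact hL.comp_of_map (hX.meas (k + 1)).aemeasurable
  · rw [hX.integral_comp (k + 1) (ψ := fun a => inner ℝ p (G xs a)) hm.aestronglyMeasurable,
      integral_inner (hG.integrable_field xs), hG.mean, hG.zero, inner_zero_right]
  · exact hX.integral_comp (k + 1) (ψ := fun a => inner ℝ p (G xs a) ^ 2)
      (hm.pow_const 2).aestronglyMeasurable
  · rw [hX.integral_comp (k + 1) (ψ := fun a => inner ℝ p (G xs a) ^ 4)
      (hm.pow_const 4).aestronglyMeasurable, mul_pow, Real.sq_sqrt (by positivity),
      ← integral_const_mul]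
    refine integral_mono (integrable_pow_four hL) ((integrable_pow_four hG.memLp.norm).const_mul _)
      fun a => ?_
    calc _ = |inner ℝ p (G xs a)| ^ 4 := (Even.pow_abs (by decide) _).symm
      _ ≤ (‖p‖ * ‖G xs a‖) ^ 4 := by gcongr; exact abs_real_inner_le_norm _ _
      _ = _ := by ring

/-- The deviation of the field from its mean and from its value at the zero of the mean. -/
noncomputable def fieldDev (G : Vec d → S → Vec d) (g : Vec d → Vec d) (xs p : Vec d)
    (q : Vec d × S) : ℝ := inner ℝ p (G q.1 q.2 - G xs q.2 - g q.1)

lemma StochasticField.measurable_fieldDev [IsProbabilityMeasure N]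
    (hG : StochasticField N G g A xs Φ μ L c) (p : Vec d) : Measurable (fieldDev G g xs p) :=
  measurable_const.inner ((hG.meas.sub ((hG.measurable_field xs).comp measurable_snd)).sub
    (hG.measurable_mean.comp measurable_fst))

lemma StochasticField.integral_fieldDev [IsProbabilityMeasure N]
    (hG : StochasticField N G g A xs Φ μ L c) (p w : Vec d) :
    ∫ a, fieldDev G g xs p (w, a) ∂N = 0 := by
  have i1 := hG.integrable_field w
  have i2 := hG.integrable_field xs
  have i12 : Integrable (fun a => G w a - G xs a) N := i1.sub i2
  unfold fieldDev
  rw [integral_inner (f := fun a => G w a - G xs a - g w) (i12.sub (integrable_const _)),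
    integral_sub i12 (integrable_const _), integral_sub i1 i2, hG.mean, hG.mean, hG.zero]
  simp

lemma StochasticField.ae_abs_fieldDev_le (hG : StochasticField N G g A xs Φ μ L c) (p : Vec d) :
    ∀ᵐ a ∂N, ∀ w, |fieldDev G g xs p (w, a)| ≤ ‖p‖ * ((Φ a + L) * ‖w - xs‖) := by
  filter_upwards [hG.lip] with a ha w
  refine (abs_real_inner_le_norm _ _).trans (mul_le_mul_of_nonneg_left ?_ (norm_nonneg p))
  refine (norm_sub_le _ _).trans ?_
  have h1 := ha w xs
  have h2 := hG.norm_le w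
  change ‖G w a - G xs a‖ + ‖g w‖ ≤ _
  linarith

/-- The perturbations of a component of the recursion. -/
lemma Iterates.perturbation (hW : Iterates X G η α W) (hX : Inputs P N X)
    (hG : StochasticField N G g A xs Φ μ L c) (p : Vec d) {C : ℝ} (hC : 0 ≤ C)
    (hD : ∀ k : ℕ, ∫ ω, ‖W k ω - xs‖ ^ 4 ∂P ≤ C * ((k : ℝ) + 1) ^ (-(2 * α))) :
    Perturbation P (inputFiltration hX.meas) α (‖p‖ ^ 2 * (∫ a, (Φ a + L) ^ 2 ∂N) * √C)
      (fun k ω => fieldDev G g xs p (W k ω, X (k + 1) ω)) := by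
  have := hX.isProbabilityMeasure
  have hWm := hW.measurable hX hG
  have hWm' := hW.measurable' hX hG
  have hFm := hG.measurable_fieldDev p
  have hmeas : ∀ k, Measurable fun ω => fieldDev G g xs p (W k ω, X (k + 1) ω) := fun k =>
    hFm.comp ((hWm' k).prodMk (hX.meas (k + 1)))
  have hψm : Measurable fun a => (Φ a + L) ^ 2 := (hG.meas_env.add_const L).pow_const 2
  have hψi : Integrable (fun a => (Φ a + L) ^ 2) N :=
    integrable_pow_two ((memLp_two_of_four hG.memLp_env).add (memLp_const L))
  have hZ : ∀ k (Y : Ω → ℝ), Measurable[inputFiltration hX.meas k] Y → MemLp Y 4 P →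
      Measurable[inputFiltration hX.meas k] (fun ω => (Y ω * ‖W k ω - xs‖) ^ 2) ∧
      MemLp (fun ω => Y ω * ‖W k ω - xs‖) 2 P := fun k Y hY hY4 =>
    ⟨(hY.mul (measurable_norm.comp ((hWm k).sub_const xs))).pow_const 2,
      memLp_two_mul hY4 (hW.memLp_sub hX hG k).norm⟩
  have hdom : ∀ k (Y : Ω → ℝ), ∀ᵐ ω ∂P, (Y ω * fieldDev G g xs p (W k ω, X (k + 1) ω)) ^ 2
      ≤ ‖p‖ ^ 2 * ((Y ω * ‖W k ω - xs‖) ^ 2 * (Φ (X (k + 1) ω) + L) ^ 2) := by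
    intro k Y
    filter_upwards [hX.ae_input (k + 1) (hG.ae_abs_fieldDev_le p)] with ω hω
    have h1 := pow_le_pow_left₀ (abs_nonneg _) (hω (W k ω)) 2
    rw [sq_abs] at h1
    calc _ = Y ω ^ 2 * fieldDev G g xs p (W k ω, X (k + 1) ω) ^ 2 := by ring
      _ ≤ Y ω ^ 2 * (‖p‖ * ((Φ (X (k + 1) ω) + L) * ‖W k ω - xs‖)) ^ 2 := by gcongr
      _ = _ := by ring
  have hdomi : ∀ k (Y : Ω → ℝ), Measurable[inputFiltration hX.meas k] Y → MemLp Y 4 P →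
      Integrable (fun ω => ‖p‖ ^ 2 * ((Y ω * ‖W k ω - xs‖) ^ 2 * (Φ (X (k + 1) ω) + L) ^ 2)) P :=
    fun k Y hY hY4 => (hX.integrable_mul (hZ k Y hY hY4).1 (integrable_pow_two (hZ k Y hY hY4).2)
      hψm hψi).const_mul _
  have hmem : ∀ k (Y : Ω → ℝ), Measurable[inputFiltration hX.meas k] Y → MemLp Y 4 P →
      MemLp (fun ω => Y ω * fieldDev G g xs p (W k ω, X (k + 1) ω)) 2 P := by
    intro k Y hY hY4
    have hYm : Measurable Y := hY.mono ((inputFiltration hX.meas).le k) le_rfl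
    refine (memLp_two_iff_integrable_sq (hYm.mul (hmeas k)).aestronglyMeasurable).2 ?_
    refine (hdomi k Y hY hY4).mono' ((hYm.mul (hmeas k)).pow_const 2).aestronglyMeasurable ?_
    filter_upwards [hdom k Y] with ω hω
    rw [Real.norm_of_nonneg (sq_nonneg _)]
    exact hω
  refine ⟨fun k => ?_, fun k Y hY hi => ?_, hmem, fun k Y hY hY4 => ?_⟩
  · exact hFm.comp (((hWm k).mono ((inputFiltration hX.meas).mono k.le_succ) le_rfl).prodMk
      (hX.measurable_input (k + 1)))
  -- The past enters through both `Y` and `W k`, so the pair is frozen while the next input is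
  -- integrated out.
  · rw [hX.integral_next (Y := fun ω => (Y ω, W k ω)) (hY.prodMk (hWm k))
      (Ψ := fun q : (ℝ × Vec d) × S => q.1.1 * fieldDev G g xs p (q.1.2, q.2))
      (measurable_fst.fst.mul (hFm.comp (measurable_fst.snd.prodMk measurable_snd))) hi]
    simp only [integral_const_mul, hG.integral_fieldDev, mul_zero, integral_zero]
  · have h1 := integral_mono_ae (integrable_pow_two (hmem k Y hY hY4)) (hdomi k Y hY hY4) (hdom k Y)
    rw [integral_const_mul, hX.integral_mul (hZ k Y hY hY4).1 hψm] at h1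
    refine h1.trans ?_
    have mD := (hW.memLp_sub hX hG k).norm
    -- Cauchy-Schwarz separates `Y²` from `‖W k - xs‖²`, whose mean square is the fourth moment
    -- already controlled.
    have h2 : ∫ ω, (Y ω * ‖W k ω - xs‖) ^ 2 ∂P
        ≤ √(∫ ω, Y ω ^ 4 ∂P) * (√C * ((k : ℝ) + 1) ^ (-α)) := by
      have a1 : MemLp (fun ω => Y ω ^ 2) 2 P := by simpa only [pow_two] using memLp_two_mul hY4 hY4
      have a2 : MemLp (fun ω => ‖W k ω - xs‖ ^ 2) 2 P := by
        simpa only [pow_two] using memLp_two_mul mD mD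
      have a3 := integral_abs_mul_le a1 a2
      have a4 : n2 P (fun ω => Y ω ^ 2) = √(∫ ω, Y ω ^ 4 ∂P) := by
        unfold n2; congr 2; ext ω; ring
      have a5 : n2 P (fun ω => ‖W k ω - xs‖ ^ 2) ≤ √C * ((k : ℝ) + 1) ^ (-α) := by
        refine n2_le_of_sq_le (by positivity) ?_
        rw [mul_pow, Real.sq_sqrt hC, ← Real.rpow_mul_natCast (by positivity)]
        convert hD k using 2
        · ext ω; ring
        · congr 1; push_cast; ring
      rw [a4] at a3
      calc _ = ∫ ω, |Y ω ^ 2 * ‖W k ω - xs‖ ^ 2| ∂P := by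
            congr 1; ext ω; rw [abs_of_nonneg (by positivity)]; ring
        _ ≤ _ := a3.trans (by gcongr)
    have h3 : 0 ≤ ∫ a, (Φ a + L) ^ 2 ∂N := integral_nonneg fun _ => sq_nonneg _
    calc _ ≤ ‖p‖ ^ 2 * ((√(∫ ω, Y ω ^ 4 ∂P) * (√C * ((k : ℝ) + 1) ^ (-α)))
          * ∫ a, (Φ a + L) ^ 2 ∂N) := by gcongr
      _ = _ := by ring

omit [IsProbabilityMeasure P] in
lemma Perturbation.weaken {𝓕 : Filtration ℕ mΩ} {c c' : ℝ} {δ : ℕ → Ω → ℝ}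
    (h : Perturbation P 𝓕 α c δ) (hc : c ≤ c') : Perturbation P 𝓕 α c' δ :=
  ⟨h.meas, h.orth, h.memLp, fun k Y hY hY4 => (h.sq_le k Y hY hY4).trans (by gcongr)⟩

/-- The components of the recursion. -/
lemma Iterates.exists_component (hW : Iterates X G η α W) (hX : Inputs P N X)
    (hG : StochasticField N G g A xs Φ μ L c) (hη : 0 < η) (h0 : 0 < α) (h1 : α < 1) (p : Vec d) :
    ∃ c', Component P (inputFiltration hX.meas) α η c' (fun k ω => inner ℝ (A p) (W k ω - xs))
      (fun k ω => inner ℝ p (W k ω - xs)) (fun k ω => inner ℝ p (g (W k ω) - A (W k ω - xs)))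
      (fun k ω => fieldDev G g xs p (W k ω, X (k + 1) ω))
      (fun k ω => inner ℝ p (G xs (X (k + 1) ω))) := by
  have := hX.isProbabilityMeasure
  obtain ⟨C, hC, hD⟩ := hW.exists_fourth_moment_le hX hG hη h0 h1
  have hc := hG.c_nonneg
  have hWm := hW.measurable hX hG
  have hWm' := hW.measurable' hX hG
  have mD := hW.memLp_sub hX hG
  have mD2 : ∀ k, MemLp (fun ω => ‖W k ω - xs‖) 2 P := fun k => memLp_two_of_four (mD k).norm
  have mDD : ∀ k, MemLp (fun ω => ‖W k ω - xs‖ ^ 2) 2 P := fun k => by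
    simpa only [pow_two] using memLp_two_mul (mD k).norm (mD k).norm
  have sq2 : ∀ k, n2 P (fun ω => ‖W k ω - xs‖ ^ 2) ≤ √C * ((k : ℝ) + 1) ^ (-α) := by
    intro k
    refine n2_le_of_sq_le (by positivity) ?_
    rw [mul_pow, Real.sq_sqrt hC, ← Real.rpow_mul_natCast (by positivity)]
    convert hD k using 2
    · ext ω; ring
    · congr 1; push_cast; ring
  have sq1 : ∀ k, n2 P (fun ω => ‖W k ω - xs‖) ≤ √(√C) * ((k : ℝ) + 1) ^ (-(α / 2)) := by
    intro k
    refine n2_le_of_sq_le (by positivity) ?_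
    rw [mul_pow, Real.sq_sqrt (Real.sqrt_nonneg C), ← Real.rpow_mul_natCast (by positivity)]
    have e1 := (integral_abs_le_n2 (mDD k)).trans (sq2 k)
    simp only [abs_pow, abs_norm] at e1
    convert e1 using 2
    congr 1; push_cast; ring_nf
  have mono2 : ∀ {f h : Ω → ℝ}, MemLp f 2 P → MemLp h 2 P → (∀ ω, |f ω| ≤ h ω) → n2 P f ≤ n2 P h := by
    intro f h hf hh hle
    refine Real.sqrt_le_sqrt (integral_mono (integrable_pow_two hf) (integrable_pow_two hh)
      fun ω => ?_)
    have := pow_le_pow_left₀ (abs_nonneg _) (hle ω) 2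
    rwa [sq_abs] at this
  have hin : ∀ (v : Vec d) k, MemLp (fun ω => inner ℝ v (W k ω - xs)) 2 P ∧
      n2 P (fun ω => inner ℝ v (W k ω - xs)) ≤ ‖v‖ * √(√C) * ((k : ℝ) + 1) ^ (-(α / 2)) := by
    intro v k
    have m1 : MemLp (fun ω => inner ℝ v (W k ω - xs)) 2 P :=
      ((mD k).mono_exponent (by norm_num)).const_inner v
    refine ⟨m1, (mono2 m1 ((mD2 k).const_mul ‖v‖) fun ω => abs_real_inner_le_norm _ _).trans ?_⟩
    rw [n2_const_mul, abs_norm, mul_assoc]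
    exact mul_le_mul_of_nonneg_left (sq1 k) (norm_nonneg v)
  have hr : ∀ k ω, |inner ℝ p (g (W k ω) - A (W k ω - xs))| ≤ ‖p‖ * c * ‖W k ω - xs‖ ^ 2 := by
    intro k ω
    refine (abs_real_inner_le_norm _ _).trans ?_
    rw [mul_assoc]
    exact mul_le_mul_of_nonneg_left (hG.taylor _) (norm_nonneg p)
  have mr : ∀ k, MemLp (fun ω => inner ℝ p (g (W k ω) - A (W k ω - xs))) 2 P := by
    intro k
    refine MemLp.mono ((mDD k).const_mul (‖p‖ * c)) (measurable_const.inner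
      ((hG.measurable_mean.comp (hWm' k)).sub (A.continuous.measurable.comp
        ((hWm' k).sub_const xs)))).aestronglyMeasurable (ae_of_all _ fun ω => ?_)
    exact (hr k ω).trans (Real.le_norm_self _)
  have hF : 0 ≤ ∫ a, (Φ a + L) ^ 2 ∂N := integral_nonneg fun _ => sq_nonneg _
  have q1 : 0 ≤ ‖A p‖ * √(√C) := by positivity
  have q2 : 0 ≤ ‖p‖ * √(√C) := by positivity
  have q3 : 0 ≤ ‖p‖ * c * √C := by positivity
  have q4 : 0 ≤ ‖p‖ ^ 2 * (∫ a, (Φ a + L) ^ 2 ∂N) * √C := by positivity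
  -- The sum of the constants for drift, state, remainder and perturbation, so that a single
  -- constant serves all four.
  refine ⟨‖A p‖ * √(√C) + ‖p‖ * √(√C) + ‖p‖ * c * √C + ‖p‖ ^ 2 * (∫ a, (Φ a + L) ^ 2 ∂N) * √C,
    fun k ω => ?_, fun k => ?_, fun k => (hin _ k).1, fun k => (hin _ k).1, mr, fun k => ?_,
    fun k => ?_, fun k => ?_, ?_, by positivity⟩
  · rw [hW.step k ω]
    -- Symmetry of `A` turns the linear part of the recursion along `p` into the drift along `A p`.
    have e1 : inner ℝ (A p) (W k ω - xs) = inner ℝ p (A (W k ω - xs)) := hG.symm _ _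
    rw [e1]
    simp only [fieldDev, inner_sub_right, inner_smul_right]
    ring
  · have : Measurable[inputFiltration hX.meas k] fun ω => W k ω - xs := (hWm k).sub_const xs
    exact (innerSL ℝ p).continuous.measurable.comp this
  · refine (hin (A p) k).2.trans ?_
    gcongr
    linarith
  · refine (hin p k).2.trans ?_
    gcongr
    linarith
  · refine (mono2 (mr k) ((mDD k).const_mul (‖p‖ * c)) (hr k)).trans ?_
    rw [n2_const_mul, abs_of_nonneg (by positivity)]
    calc _ ≤ ‖p‖ * c * (√C * ((k : ℝ) + 1) ^ (-α)) := by gcongr; exact sq2 k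
      _ = ‖p‖ * c * √C * ((k : ℝ) + 1) ^ (-α) := by ring
      _ ≤ _ := by gcongr; linarith
  · exact (hW.perturbation hX hG p hC hD).weaken (by linarith)

end Components


/-! ### From quadratic forms to the operator norm of the covariance error. -/

section Matrices

variable {d : ℕ}

lemma continuous_outer : Continuous (outer : Vec d → Mat d) := by
  have h : (outer : Vec d → Mat d)
      = fun v => ContinuousLinearMap.smulRightL ℝ (Vec d) (Vec d) (innerSL ℝ v) v := by
    funext v; rfl
  rw [h]
  exact ((ContinuousLinearMap.smulRightL ℝ (Vec d) (Vec d)).continuous.comp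
    (innerSL ℝ).continuous).clm_apply continuous_id

lemma inner_outer (v w : Vec d) : inner ℝ v (outer w v) = inner ℝ v w ^ 2 := by
  simp [outer, InnerProductSpace.rankOne_apply, inner_smul_right, real_inner_comm v w, pow_two]

lemma outer_symm (w v v' : Vec d) : inner ℝ (outer w v) v' = inner ℝ v (outer w v') := by
  simp [outer, InnerProductSpace.rankOne_apply, inner_smul_right, inner_smul_left,
    real_inner_comm v w, mul_comm]

lemma norm_outer (w : Vec d) : ‖outer w‖ = ‖w‖ ^ 2 := by
  simp [outer, pow_two]

/-- The operator norm of a symmetric matrix is controlled by finitely many values of its quadratic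
form. -/
lemma norm_le_sum_abs_quadratic {T : Mat d} (hT : ∀ v w, inner ℝ (T v) w = inner ℝ v (T w)) :
    ‖T‖ ≤ ∑ a : Fin d, ∑ b : Fin d,
      (|inner ℝ (EuclideanSpace.basisFun (Fin d) ℝ a + EuclideanSpace.basisFun (Fin d) ℝ b)
          (T (EuclideanSpace.basisFun (Fin d) ℝ a + EuclideanSpace.basisFun (Fin d) ℝ b))|
        + |inner ℝ (EuclideanSpace.basisFun (Fin d) ℝ a) (T (EuclideanSpace.basisFun (Fin d) ℝ a))|
        + |inner ℝ (EuclideanSpace.basisFun (Fin d) ℝ b)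
          (T (EuclideanSpace.basisFun (Fin d) ℝ b))|) := by
  set e := EuclideanSpace.basisFun (Fin d) ℝ with he
  have entry : ∀ a b, |inner ℝ (e a) (T (e b))| ≤ |inner ℝ (e a + e b) (T (e a + e b))|
      + |inner ℝ (e a) (T (e a))| + |inner ℝ (e b) (T (e b))| := by
    intro a b
    have h1 : inner ℝ (e a + e b) (T (e a + e b)) = inner ℝ (e a) (T (e a))
        + 2 * inner ℝ (e a) (T (e b)) + inner ℝ (e b) (T (e b)) := by
      rw [map_add, inner_add_left, inner_add_right, inner_add_right,
        show inner ℝ (e b) (T (e a)) = inner ℝ (e a) (T (e b)) by rw [← hT, real_inner_comm]]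
      ring
    have h2 : 2 * inner ℝ (e a) (T (e b)) = inner ℝ (e a + e b) (T (e a + e b))
        - inner ℝ (e a) (T (e a)) - inner ℝ (e b) (T (e b)) := by linarith
    have h3 := abs_sub (inner ℝ (e a + e b) (T (e a + e b)) - inner ℝ (e a) (T (e a)))
      (inner ℝ (e b) (T (e b)))
    have h4 := abs_sub (inner ℝ (e a + e b) (T (e a + e b))) (inner ℝ (e a) (T (e a)))
    rw [← h2, abs_mul, abs_two] at h3
    have := abs_nonneg (inner ℝ (e a) (T (e b)))
    linarith
  refine ContinuousLinearMap.opNorm_le_bound _ (Finset.sum_nonneg fun a _ =>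
    Finset.sum_nonneg fun b _ => by positivity) fun x => ?_
  have hx : T x = ∑ a, (∑ b, inner ℝ (e b) x * inner ℝ (e a) (T (e b))) • e a := by
    conv_lhs => rw [← e.sum_repr' (T x)]
    refine Finset.sum_congr rfl fun a _ => ?_
    congr 1
    conv_lhs => rw [← e.sum_repr' x]
    simp [inner_sum, inner_smul_right]
  rw [hx]
  refine (norm_sum_le _ _).trans ?_
  rw [Finset.sum_mul]
  refine Finset.sum_le_sum fun a _ => ?_
  rw [norm_smul, e.norm_eq_one, mul_one, Finset.sum_mul]
  refine (Finset.abs_sum_le_sum_abs _ _).trans (Finset.sum_le_sum fun b _ => ?_)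
  rw [abs_mul, mul_comm]
  refine mul_le_mul (entry a b) ?_ (abs_nonneg _) (by positivity)
  have := abs_real_inner_le_norm (e b) x
  rwa [e.norm_eq_one, one_mul] at this

/-- A symmetric coercive matrix is invertible. -/
lemma inverse_of_coercive {A : Mat d} {μ : ℝ} (hμ : 0 < μ)
    (hs : ∀ v w, inner ℝ (A v) w = inner ℝ v (A w))
    (hA : ∀ v, μ * ‖v‖ ^ 2 ≤ inner ℝ (A v) v) :
    (∀ v, A (A.inverse v) = v) ∧ (∀ v, ‖A.inverse v‖ ≤ ‖v‖ / μ) ∧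
      ∀ v w, inner ℝ (A.inverse v) w = inner ℝ v (A.inverse w) := by
  have hbd : ∀ v, μ * ‖v‖ ≤ ‖A v‖ := by
    intro v
    rcases eq_or_ne v 0 with rfl | hv
    · simp
    · have h1 := (hA v).trans (real_inner_le_norm (A v) v)
      have h2 : 0 < ‖v‖ := norm_pos_iff.2 hv
      rw [pow_two, ← mul_assoc] at h1
      exact le_of_mul_le_mul_right h1 h2
  have hinj : Function.Injective A.toLinearMap := by
    rw [← LinearMap.ker_eq_bot, LinearMap.ker_eq_bot']
    intro v hv
    have h1 := hbd v
    rw [show A v = 0 from hv, norm_zero] at h1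
    exact norm_eq_zero.1 (le_antisymm (by nlinarith [norm_nonneg v]) (norm_nonneg v))
  -- `ContinuousLinearMap.inverse` is zero at non-invertible maps, so an equivalence with underlying
  -- map `A` is exhibited; in finite dimension injectivity provides it.
  set e : Vec d ≃L[ℝ] Vec d := (LinearEquiv.ofInjectiveEndo A.toLinearMap hinj).toContinuousLinearEquiv
  have he : (e : Mat d) = A := by ext v : 1; rfl
  have hr : ∀ v, A (A.inverse v) = v := by
    intro v
    rw [← he, ContinuousLinearMap.inverse_equiv]
    exact e.apply_symm_apply v
  refine ⟨hr, fun v => ?_, fun v w => ?_⟩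
  · rw [le_div_iff₀' hμ]
    have := hbd (A.inverse v)
    rwa [hr] at this
  · conv_rhs => rw [← hr v]
    rw [hs, hr]

end Matrices

section Covariance

variable {d : ℕ} {Ω S : Type*} {mΩ : MeasurableSpace Ω} [MeasurableSpace S]
  {P : Measure Ω} {N : Measure S} {X : ℕ → Ω → S}
  {G : Vec d → S → Vec d} {g : Vec d → Vec d} {A : Mat d} {xs : Vec d} {Φ : S → ℝ}
  {μ L c η α C β c0 : ℝ} {W : ℕ → Ω → Vec d}

/-- The asymptotic covariance of the averaged iterates. -/
noncomputable def sandwich (N : Measure S) (G : Vec d → S → Vec d) (A : Mat d) (xs : Vec d) :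
    Mat d := A.inverse ∘L (∫ a, outer (G xs a) ∂N) ∘L A.inverse

lemma StochasticField.integrable_outer [IsProbabilityMeasure N]
    (hG : StochasticField N G g A xs Φ μ L c) : Integrable (fun a => outer (G xs a)) N := by
  refine (integrable_pow_two (memLp_two_of_four hG.memLp.norm)).mono'
    (continuous_outer.comp_aestronglyMeasurable hG.memLp.aestronglyMeasurable)
    (ae_of_all _ fun a => ?_)
  rw [norm_outer]

lemma StochasticField.inner_integral_outer [IsProbabilityMeasure N]
    (hG : StochasticField N G g A xs Φ μ L c) (v w : Vec d) :
    inner ℝ v ((∫ a, outer (G xs a) ∂N) w) = ∫ a, inner ℝ v (outer (G xs a) w) ∂N := by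
  have hi := hG.integrable_outer
  rw [ContinuousLinearMap.integral_apply hi,
    integral_inner (hi.apply_continuousLinearMap w)]

lemma stronglyMeasurable_covEst (hW : ∀ k, Measurable (W k)) (n : ℕ) :
    StronglyMeasurable fun ω => covEst C β (fun i => W i ω) n := by
  have hWm : ∀ k, StronglyMeasurable (W k) := fun k => (hW k).stronglyMeasurable
  have hav : StronglyMeasurable fun ω => average (fun i => W i ω) n := by
    unfold average
    exact (Finset.stronglyMeasurable_fun_sum _ fun k _ => hWm k).fun_const_smul _
  unfold covEst
  refine (Finset.stronglyMeasurable_fun_sum _ fun i _ =>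
    continuous_outer.comp_stronglyMeasurable ?_).fun_const_smul _
  exact (Finset.stronglyMeasurable_fun_sum _ fun k _ => hWm k).sub (hav.fun_const_smul _)

variable (hA : ∀ v, μ * ‖v‖ ^ 2 ≤ inner ℝ (A v) v)
include hA

lemma StochasticField.sandwich_symm [IsProbabilityMeasure N]
    (hG : StochasticField N G g A xs Φ μ L c) (v w : Vec d) :
    inner ℝ (sandwich N G A xs v) w = inner ℝ v (sandwich N G A xs w) := by
  obtain ⟨-, -, h3⟩ := inverse_of_coercive hG.mu_pos hG.symm hA
  simp only [sandwich, ContinuousLinearMap.comp_apply]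
  rw [h3, ← h3 v, real_inner_comm, hG.inner_integral_outer, hG.inner_integral_outer]
  congr 1; ext a
  rw [← outer_symm, real_inner_comm]

/-- Identifies the variance of the innovations along `A⁻¹v` with the target quadratic form at `v`.
-/
lemma StochasticField.inner_sandwich [IsProbabilityMeasure N]
    (hG : StochasticField N G g A xs Φ μ L c) (v : Vec d) :
    inner ℝ v (sandwich N G A xs v) = ∫ a, inner ℝ (A.inverse v) (G xs a) ^ 2 ∂N := by
  obtain ⟨-, -, h3⟩ := inverse_of_coercive hG.mu_pos hG.symm hA
  simp only [sandwich, ContinuousLinearMap.comp_apply]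
  rw [← h3, hG.inner_integral_outer]
  simp only [inner_outer]

variable [IsProbabilityMeasure P]

/-- The error of the quadratic form of the batch-means estimator. -/
lemma Iterates.exists_l1le_quadratic (hW : Iterates X G η α W) (hX : Inputs P N X)
    (hG : StochasticField N G g A xs Φ μ L c) (hη : 0 < η) (h0 : 1 / 2 < α) (h1 : α < 1)
    (hb : Blocks (blockStart C β) c0) (v : Vec d) :
    ∃ K, 0 ≤ K ∧ ∀ n lam : ℕ, ∀ Nb : ℝ, 0 ≤ Nb → 1 ≤ n →
      (∀ i ≤ n + 1, blockLen C β i ≤ lam) →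
      (∑ i ∈ Finset.Icc 1 n, blockEnd (blockStart C β) i ≤ Nb) →
      L1le P (fun ω => ∑ i ∈ Finset.Icc 1 n,
          (inner ℝ v ((∑ k ∈ Finset.Icc (blockStart C β i) i, W k ω)
            - (blockLen C β i : ℝ) • average (fun i => W i ω) n) ^ 2
          - blockLen C β i * inner ℝ v (sandwich N G A xs v)))
        (7 * ((‖v‖ / μ) ^ 2 * √(∫ a, ‖G xs a‖ ^ 4 ∂N)) * (lam * √lam * √n)
          + K * rest α lam n Nb) := by
  have := hX.isProbabilityMeasure
  have α0 : 0 < α := by linarith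
  obtain ⟨i1, i2, -⟩ := inverse_of_coercive hG.mu_pos hG.symm hA
  -- The component along `p` has drift `⟨v, W - xs⟩`, the quantity to be estimated. The component
  -- along `q` has drift `⟨p, W - xs⟩`, the state of the first, so it serves as the second
  -- component.
  set p := A.inverse v with hp
  set q := A.inverse p with hq
  obtain ⟨c1, C1⟩ := hW.exists_component hX hG hη α0 h1 p
  obtain ⟨c2, C2⟩ := hW.exists_component hX hG hη α0 h1 q
  rw [show A p = v from i1 v] at C1
  rw [show A q = p from i1 p] at C2
  obtain ⟨K, hK, hb'⟩ := exists_l1le_batchMeans C1 C2 (hX.innovation hG p) (hX.innovation hG q)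
    hη h0 h1 hb
  refine ⟨K, hK, fun n lam Nb hN hn hlam hNb => ?_⟩
  have hn0 : (n : ℝ) ≠ 0 := by
    have : n ≠ 0 := by omega
    exact_mod_cast this
  refine L1le.congr ((hb' n lam Nb hN hn hlam hNb).mono ?_) fun ω => ?_
  · have hpv : ‖p‖ ^ 2 ≤ (‖v‖ / μ) ^ 2 := pow_le_pow_left₀ (norm_nonneg _) (i2 v) 2
    gcongr
  · refine Finset.sum_congr rfl fun i _ => ?_
    have e1 : (blockLen C β i : ℝ) = len (blockStart C β) i := rfl
    -- Recentring at `xs` changes the block sum and the scaled average by the same amount, hence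
    -- leaves the estimator unchanged.
    have e2 : ∑ k ∈ Finset.Icc (blockStart C β i) i, inner ℝ v (W k ω - xs)
        = inner ℝ v (∑ k ∈ Finset.Icc (blockStart C β i) i, W k ω)
          - len (blockStart C β) i * inner ℝ v xs := by
      simp only [inner_sub_right, Finset.sum_sub_distrib, Finset.sum_const, hb.card_Icc,
        nsmul_eq_mul, inner_sum]
    have e3 : (n : ℝ)⁻¹ * ∑ k ∈ Finset.range n, inner ℝ v (W k ω - xs)
        = inner ℝ v (average (fun i => W i ω) n) - inner ℝ v xs := by
      simp only [inner_sub_right, Finset.sum_sub_distrib, Finset.sum_const, Finset.card_range,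
        nsmul_eq_mul, average, inner_smul_right, inner_sum]
      field_simp
    rw [e1, hG.inner_sandwich hA, e2, e3, inner_sub_right, inner_smul_right]
    ring

/-- The error of the batch-means estimator. -/
theorem Iterates.exists_l1le_covEst (hW : Iterates X G η α W) (hX : Inputs P N X)
    (hG : StochasticField N G g A xs Φ μ L c) (hη : 0 < η) (h0 : 1 / 2 < α) (h1 : α < 1)
    (hb : Blocks (blockStart C β) c0) :
    ∃ K, 0 ≤ K ∧ ∀ n lam : ℕ, ∀ Nb : ℝ, 0 ≤ Nb → 1 ≤ n →
      (∀ i ≤ n + 1, blockLen C β i ≤ lam) →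
      (∑ i ∈ Finset.Icc 1 n, blockEnd (blockStart C β) i ≤ Nb) →
      L1le P (fun ω => ‖covEst C β (fun i => W i ω) n - sandwich N G A xs‖)
        ((∑ i ∈ Finset.Icc 1 n, (blockLen C β i : ℝ))⁻¹ *
          (42 * (d : ℝ) ^ 2 / μ ^ 2 * √(∫ a, ‖G xs a‖ ^ 4 ∂N) * (lam * √lam * √n)
          + K * rest α lam n Nb)) := by
  have := hX.isProbabilityMeasure
  have hμ := hG.mu_pos
  choose K hK hq using hW.exists_l1le_quadratic hA hX hG hη h0 h1 hb
  set e := EuclideanSpace.basisFun (Fin d) ℝ with he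
  refine ⟨∑ a, ∑ b, (K (e a + e b) + K (e a) + K (e b)), Finset.sum_nonneg fun a _ =>
    Finset.sum_nonneg fun b _ => by have := hK (e a + e b); have := hK (e a); have := hK (e b); positivity,
    fun n lam Nb hN hn hlam hNb => ?_⟩
  set T : Ω → Mat d := fun ω => covEst C β (fun i => W i ω) n - sandwich N G A xs with hT
  set Λ : ℝ := ∑ i ∈ Finset.Icc 1 n, (blockLen C β i : ℝ) with hΛ
  set R := rest α lam n Nb with hR
  set s4 := √(∫ a, ‖G xs a‖ ^ 4 ∂N) with hs4
  set l := (lam : ℝ) * √lam * √n with hl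
  have hs40 : 0 ≤ s4 := Real.sqrt_nonneg _
  have hl0 : 0 ≤ l := by positivity
  have hΛ0 : 0 < Λ := by
    refine Finset.sum_pos (fun i _ => ?_) ⟨1, by simpa using hn⟩
    have : 0 < blockLen C β i := Nat.succ_pos _
    exact_mod_cast this
  have hcov : ∀ ω, covEst C β (fun i => W i ω) n = Λ⁻¹ • ∑ i ∈ Finset.Icc 1 n,
      outer ((∑ k ∈ Finset.Icc (blockStart C β i) i, W k ω)
        - (blockLen C β i : ℝ) • average (fun i => W i ω) n) := fun ω => rfl
  have hsymm : ∀ ω v w, inner ℝ (T ω v) w = inner ℝ v (T ω w) := by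
    intro ω v w
    simp only [hT, hcov, _root_.sub_apply, _root_.smul_apply,
      _root_.sum_apply, inner_sub_left, inner_sub_right, inner_smul_right, sum_inner,
      inner_sum, real_inner_smul_left, hG.sandwich_symm hA, outer_symm]
  have hquad : ∀ v, L1le P (fun ω => |inner ℝ v (T ω v)|)
      (Λ⁻¹ * (7 * ((‖v‖ / μ) ^ 2 * s4) * l + K v * R)) := by
    intro v
    have h2 := (hq v n lam Nb hN hn hlam hNb).const_mul Λ⁻¹
    rw [abs_of_pos (inv_pos.2 hΛ0)] at h2
    have h3 : L1le P (fun ω => inner ℝ v (T ω v)) (Λ⁻¹ * (7 * ((‖v‖ / μ) ^ 2 * s4) * l + K v * R)) := by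
      refine h2.congr fun ω => ?_
      simp only [hT, hcov, _root_.sub_apply, _root_.smul_apply,
        _root_.sum_apply, inner_sub_right, inner_smul_right, inner_sum, inner_outer]
      rw [Finset.sum_sub_distrib, ← Finset.sum_mul, ← hΛ, mul_sub]
      congr 1
      field_simp
    exact ⟨h3.1.abs, by simpa using h3.2⟩
  have hsum := l1le_sum Finset.univ fun a _ => l1le_sum (P := P) Finset.univ fun b _ =>
    ((hquad (e a + e b)).add (hquad (e a))).add (hquad (e b))
  have hTm : AEStronglyMeasurable T P := by
    refine StronglyMeasurable.aestronglyMeasurable (StronglyMeasurable.sub ?_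
      stronglyMeasurable_const)
    exact stronglyMeasurable_covEst (hW.measurable' hX hG) n
  have hle : ∀ ω, ‖T ω‖ ≤ _ := fun ω => norm_le_sum_abs_quadratic (hsymm ω)
  have hint : Integrable (fun ω => ‖T ω‖) P :=
    hsum.1.mono' hTm.norm (ae_of_all _ fun ω => by rw [norm_norm]; exact hle ω)
  refine ⟨hint, ?_⟩
  simp only [abs_norm]
  refine (integral_mono hint hsum.1 hle).trans ?_
  refine (integral_mono hsum.1 hsum.1.abs fun ω => le_abs_self _).trans (hsum.2.trans ?_)
  -- The squared norms of `e a + e b`, `e a` and `e b` are at most `4`, `1` and `1`, and `7 (4 + 1 +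
  -- 1) = 42`.
  have hterm : ∀ a b : Fin d, Λ⁻¹ * (7 * ((‖e a + e b‖ / μ) ^ 2 * s4) * l + K (e a + e b) * R)
      + Λ⁻¹ * (7 * ((‖e a‖ / μ) ^ 2 * s4) * l + K (e a) * R)
      + Λ⁻¹ * (7 * ((‖e b‖ / μ) ^ 2 * s4) * l + K (e b) * R)
      ≤ Λ⁻¹ * (42 / μ ^ 2 * s4 * l + (K (e a + e b) + K (e a) + K (e b)) * R) := by
    intro a b
    have n1 : ‖e a + e b‖ ^ 2 ≤ 4 := by
      have h2 := norm_add_le (e a) (e b)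
      rw [e.norm_eq_one, e.norm_eq_one] at h2
      nlinarith [norm_nonneg (e a + e b)]
    have h3 : (‖e a + e b‖ / μ) ^ 2 ≤ 4 / μ ^ 2 := by rw [div_pow]; gcongr
    have h4 : 7 * ((‖e a + e b‖ / μ) ^ 2 * s4) * l ≤ 7 * (4 / μ ^ 2 * s4) * l := by gcongr
    rw [e.norm_eq_one, e.norm_eq_one, ← mul_add, ← mul_add]
    refine mul_le_mul_of_nonneg_left ?_ (inv_pos.2 hΛ0).le
    have h5 : 7 * ((1 / μ) ^ 2 * s4) * l = 7 * (1 / μ ^ 2 * s4) * l := by rw [div_pow, one_pow]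
    rw [h5]
    have h6 : 42 / μ ^ 2 * s4 * l = 7 * (4 / μ ^ 2 * s4) * l + 7 * (1 / μ ^ 2 * s4) * l
      + 7 * (1 / μ ^ 2 * s4) * l := by ring
    linarith
  refine (Finset.sum_le_sum fun a _ => Finset.sum_le_sum fun b _ => hterm a b).trans (le_of_eq ?_)
  simp only [← Finset.mul_sum, Finset.sum_add_distrib, ← Finset.sum_mul, Finset.sum_const,
    Finset.card_univ, Fintype.card_fin, nsmul_eq_mul]
  ring

end Covariance


/-! ### Application to the zeroth-order gradient estimator. -/

section Instances

variable {d : ℕ} {Z Ω : Type*} [MeasurableSpace Z] {mΩ : MeasurableSpace Ω} {P : Measure Ω}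
  {Q : Measure Z} [IsProbabilityMeasure Q] {F : Vec d → Z → ℝ} {H : Z → ℝ} {σ μ L : ℝ}
  {xstar : Vec d} {ζ : ℕ → Ω → Z} {u : ℕ → Ω → Vec d} {ν η α β C c0 : ℝ} {x0 xν : Vec d}

omit [IsProbabilityMeasure Q] in
lemma IIDInputs.inputs (h : IIDInputs P Q ζ u) :
    Inputs P (noiseLaw d Q) (fun i ω => (ζ i ω, u i ω)) :=
  ⟨fun i => (h.measurable_noise i).prodMk (h.measurable_gauss i), h.law, h.indep⟩

omit [MeasurableSpace Z] in
lemma iterates_iterate (F : Vec d → Z → ℝ) (ν η α : ℝ) (x0 : Vec d) (ζ : ℕ → Ω → Z)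
    (u : ℕ → Ω → Vec d) :
    Iterates (fun i ω => (ζ i ω, u i ω)) (fun x p => gradEst F ν x p.1 p.2) η α
      (iterate F ν η α x0 ζ u) :=
  ⟨⟨x0, fun _ => rfl⟩, fun k ω => by simp [iterate]⟩

lemma hessian_surrogate (ho : UnbiasedOracle F Q σ) (hc : SmoothStronglyConvex (objective F Q) μ L)
    (hn : GradientNoise F Q xstar) (hh : HessianEnvelope F Q H) (hν : 0 < ν) (x : Vec d) :
    hessian (surrogate F Q ν) x = smoothHess (objective F Q) ν x := by
  rw [hessian, surrogate_eq_smooth ho hn hh hν,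
    show gradient (smooth (objective F Q) ν)
      = smoothGrad (objective F Q) ν from
      funext fun y => (hc.hasGradientAt_smooth ν y).gradient]
  exact (hc.hasFDerivAt_smoothGrad ν x).fderiv

/-- The zeroth-order gradient estimator is a stochastic field. -/
lemma exists_stochasticField (ho : UnbiasedOracle F Q σ)
    (hc : SmoothStronglyConvex (objective F Q) μ L) (hn : GradientNoise F Q xstar)
    (hh : HessianEnvelope F Q H) (hx : MemLp (gradF F xstar) 4 Q) (hν : 0 < ν)
    (hxν : smoothGrad (objective F Q) ν xν = 0) :
    ∃ Φ c, StochasticField (noiseLaw d Q) (fun x p => gradEst F ν x p.1 p.2)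
      (smoothGrad (objective F Q) ν) (hessian (surrogate F Q ν) xν) xν Φ
      μ L c := by
  have hΦ := memLp_lipConst (d := d) hh
  -- `H` is only almost everywhere measurable, so a measurable version is used; this is why
  -- `StochasticField` asks for its Lipschitz bound only almost everywhere.
  set Ψ := hΦ.aestronglyMeasurable.mk _ with hΨ
  have hae := hΦ.aestronglyMeasurable.ae_eq_mk
  rw [hessian_surrogate ho hc hn hh hν]
  refine ⟨Ψ, L * gaussMean d / ν, ?_, ?_, ?_, ?_, ?_, ?_, ?_, ?_, ?_, ?_,
    hc.mu_pos, hc.L_pos.le, ?_⟩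
  · exact measurable_gradEst ho hn ν
  · exact hΦ.aestronglyMeasurable.stronglyMeasurable_mk.measurable
  · exact hΦ.ae_eq hae
  · filter_upwards [hae] with a ha x y
    rw [hΨ, ← ha]
    exact norm_gradEst_sub_le hn hh hν x y a.1 a.2
  · exact memLp_gradEst ho hn hh hν hx xν
  · exact integral_gradEst ho hc hn hh hx hν
  · intro x
    have := hc.smoothGrad_mono ν x xν
    rwa [hxν, sub_zero] at this
  · intro x
    have := hc.smoothGrad_lipschitz ν x xν
    rwa [hxν, sub_zero] at this
  · intro x
    have := hc.smoothGrad_remainder hν xν (x - xν)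
    rwa [hxν, sub_zero, add_sub_cancel] at this
  · intro v w
    rw [hc.smoothHess_symm, real_inner_comm]
  · have := gaussMean_nonneg d
    have := hc.L_pos
    positivity

/-- The error of the batch-means estimator for zeroth-order stochastic gradient descent. -/
theorem exists_l1le_covEst_iterate [IsProbabilityMeasure P] (ho : UnbiasedOracle F Q σ)
    (hc : SmoothStronglyConvex (objective F Q) μ L) (hn : GradientNoise F Q xstar)
    (hh : HessianEnvelope F Q H) (hx : MemLp (gradF F xstar) 4 Q) (hi : IIDInputs P Q ζ u)
    (hη : 0 < η) (h0 : 1 / 2 < α) (h1 : α < 1) (hb : Blocks (blockStart C β) c0) (hν : 0 < ν)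
    (hxν : smoothGrad (objective F Q) ν xν = 0) :
    ∃ K, 0 ≤ K ∧ ∀ n lam : ℕ, ∀ Nb : ℝ, 0 ≤ Nb → 1 ≤ n →
      (∀ i ≤ n + 1, blockLen C β i ≤ lam) →
      (∑ i ∈ Finset.Icc 1 n, blockEnd (blockStart C β) i ≤ Nb) →
      L1le P (fun ω => ‖covEst C β (fun i => iterate F ν η α x0 ζ u i ω) n - asympCov F Q ν xν‖)
        ((∑ i ∈ Finset.Icc 1 n, (blockLen C β i : ℝ))⁻¹ *
          (42 * (d : ℝ) ^ 2 / μ ^ 2 * √(∫ p, ‖gradEst F ν xν p.1 p.2‖ ^ 4 ∂(noiseLaw d Q))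
            * (lam * √lam * √n) + K * rest α lam n Nb)) := by
  obtain ⟨Φ, c, hG⟩ := exists_stochasticField ho hc hn hh hx hν hxν
  have e : asympCov F Q ν xν = sandwich (noiseLaw d Q) (fun x p => gradEst F ν x p.1 p.2)
    (hessian (surrogate F Q ν) xν) xν := rfl
  rw [e]
  refine (iterates_iterate F ν η α x0 ζ u).exists_l1le_covEst (fun v => ?_) hi.inputs hG hη h0 h1 hb
  rw [hessian_surrogate ho hc hn hh hν]
  exact hc.smoothHess_lower ν xν v

lemma measurable_covEst_iterate (ho : UnbiasedOracle F Q σ)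
    (hc : SmoothStronglyConvex (objective F Q) μ L) (hn : GradientNoise F Q xstar)
    (hh : HessianEnvelope F Q H) (hx : MemLp (gradF F xstar) 4 Q) (hi : IIDInputs P Q ζ u)
    (hν : 0 < ν) (hxν : smoothGrad (objective F Q) ν xν = 0) (n : ℕ) :
    StronglyMeasurable fun ω => covEst C β (fun i => iterate F ν η α x0 ζ u i ω) n := by
  obtain ⟨Φ, c, hG⟩ := exists_stochasticField ho hc hn hh hx hν hxν
  exact stronglyMeasurable_covEst
    (fun k => ((iterates_iterate F ν η α x0 ζ u).measurable' hi.inputs hG k)) n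

end Instances


/-! ### Orders of batch lengths, batch counts and index counts. -/

section Batches

variable {C β : ℝ}

/-- The number of the batch that contains an index. -/
noncomputable def batchIndex (C β : ℝ) (i : ℕ) : ℕ := Nat.findGreatest (fun m => batchStart C β m ≤ i) i

lemma blockStart_eq (C β : ℝ) (i : ℕ) : blockStart C β i = batchStart C β (batchIndex C β i) := rfl

lemma batchStart_zero (hβ : 0 < β) : batchStart C β 0 = 0 := by
  simp [batchStart, Real.zero_rpow hβ.ne']

lemma batchStart_one : batchStart C β 1 = 1 := by simp [batchStart]

lemma batchStart_of_ne {k : ℕ} (hk : k ≠ 1) : batchStart C β k = ⌊C * (k : ℝ) ^ β⌋₊ := by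
  simp [batchStart, hk]

section

variable (hβ : 0 < β) (ha : StrictMono (batchStart C β))
include hβ

lemma batchStart_batchIndex_le (i : ℕ) : batchStart C β (batchIndex C β i) ≤ i :=
  Nat.findGreatest_spec (P := fun m => batchStart C β m ≤ i) (Nat.zero_le i)
    (by rw [batchStart_zero hβ]; exact Nat.zero_le i)

include ha

omit hβ in
-- The search for the batch stops at `i`; a larger batch number is excluded because strict
-- monotonicity gives `m ≤ a_m`.
lemma lt_batchStart_batchIndex_succ (i : ℕ) : i < batchStart C β (batchIndex C β i + 1) := by
  rcases le_or_gt (batchIndex C β i + 1) i with h | h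
  · exact not_le.1 (Nat.findGreatest_is_greatest (P := fun m => batchStart C β m ≤ i)
      (Nat.lt_succ_self _) h)
  · exact lt_of_lt_of_le h (ha.le_apply)

lemma batchIndex_eq {i m : ℕ} (h1 : batchStart C β m ≤ i) (h2 : i < batchStart C β (m + 1)) :
    batchIndex C β i = m := by
  have e1 := batchStart_batchIndex_le (C := C) hβ i
  have e2 := lt_batchStart_batchIndex_succ ha i
  have e3 := ha.lt_iff_lt.1 (lt_of_le_of_lt e1 h2)
  have e4 := ha.lt_iff_lt.1 (lt_of_le_of_lt h1 e2)
  omega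

lemma batchIndex_le {i M : ℕ} (h : i ≤ batchStart C β M) : batchIndex C β i ≤ M :=
  ha.le_iff_le.1 ((batchStart_batchIndex_le hβ i).trans h)

end

variable (hC : 0 < C) (hβ : 2 < β) (ha : StrictMono (batchStart C β))

include hC in
lemma batchStart_le {k : ℕ} (hk : k ≠ 1) : (batchStart C β k : ℝ) ≤ C * (k : ℝ) ^ β := by
  rw [batchStart_of_ne hk]; exact Nat.floor_le (by positivity)

lemma le_batchStart {k : ℕ} (hk : k ≠ 1) : C * (k : ℝ) ^ β ≤ batchStart C β k + 1 := by
  rw [batchStart_of_ne hk]; exact (Nat.lt_floor_add_one _).le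

include hC hβ ha

/-- Batches that grow polynomially are comparable. -/
lemma exists_blocks : ∃ c0, Blocks (blockStart C β) c0 := by
  have β0 : 0 < β := by linarith
  -- From `m = 2` on, `m + 1 ≤ 2m` yields the factor `2^β`; the second summand covers the batches
  -- `0` and `1`.
  refine ⟨2 ^ β + batchStart C β 2, fun i => ?_, fun i k hik hki => ?_, fun i => ?_⟩
  · exact batchStart_batchIndex_le β0 i
  · rw [blockStart_eq] at hik ⊢
    rw [batchIndex_eq β0 ha hik (lt_of_le_of_lt hki (lt_batchStart_batchIndex_succ ha i)),
      blockStart_eq]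
  · rw [blockStart_eq]
    have h1 : (i : ℝ) + 1 ≤ batchStart C β (batchIndex C β i + 1) := by
      exact_mod_cast lt_batchStart_batchIndex_succ ha i
    refine h1.trans ?_
    set m := batchIndex C β i
    have h2 : (1 : ℝ) ≤ 2 ^ β := Real.one_le_rpow (by norm_num) β0.le
    have h3 : (0 : ℝ) ≤ batchStart C β 2 := Nat.cast_nonneg _
    rcases Nat.lt_or_ge m 2 with hm | hm
    · interval_cases m
      · rw [batchStart_zero β0, batchStart_one]; push_cast; linarith
      · rw [batchStart_one]; push_cast; linarith
    · have h4 := batchStart_le (β := β) hC (show m + 1 ≠ 1 by omega)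
      have h5 := le_batchStart (C := C) (β := β) (show m ≠ 1 by omega)
      have hm' : (2 : ℝ) ≤ m := by exact_mod_cast hm
      calc (batchStart C β (m + 1) : ℝ) ≤ C * ((m + 1 : ℕ) : ℝ) ^ β := h4
        _ ≤ C * (2 * (m : ℝ)) ^ β := by gcongr; push_cast; linarith
        _ = 2 ^ β * (C * (m : ℝ) ^ β) := by rw [Real.mul_rpow (by norm_num) (by positivity)]; ring
        _ ≤ 2 ^ β * (batchStart C β m + 1) := by gcongr
        _ ≤ _ := by gcongr; linarith

omit ha in
-- Bernoulli's inequality gives `(m + 1)^β - m^β ≤ β (m + 1)^(β - 1)`. Rounding costs `1`, and `C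
-- 2^β` covers `m = 0, 1`, where the starts are not both rounded powers.
lemma exists_batch_length_le : ∃ c, 0 < c ∧ ∀ m : ℕ,
    (batchStart C β (m + 1) : ℝ) - batchStart C β m ≤ c * ((m : ℝ) + 1) ^ (β - 1) := by
  have β0 : 0 < β := by linarith
  refine ⟨C * β + 1 + C * 2 ^ β, by positivity, fun m => ?_⟩
  have hx : (1 : ℝ) ≤ ((m : ℝ) + 1) ^ (β - 1) :=
    Real.one_le_rpow (by linarith [m.cast_nonneg (α := ℝ)]) (by linarith)
  have hp : (0 : ℝ) < 2 ^ β := by positivity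
  rcases Nat.lt_or_ge m 2 with hm | hm
  · have e : (batchStart C β (m + 1) : ℝ) - batchStart C β m ≤ 1 + C * 2 ^ β := by
      interval_cases m
      · rw [batchStart_zero β0, batchStart_one]; push_cast; nlinarith
      · have := batchStart_le (C := C) (β := β) hC (show 2 ≠ 1 by norm_num)
        rw [batchStart_one]; push_cast at this ⊢; linarith
    have h2 : 0 < C * β := by positivity
    have h3 : (1 + C * 2 ^ β) * 1 ≤ (1 + C * 2 ^ β) * ((m : ℝ) + 1) ^ (β - 1) := by gcongr
    nlinarith
  · have h4 := batchStart_le (β := β) hC (show m + 1 ≠ 1 by omega)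
    have h5 := le_batchStart (C := C) (β := β) (show m ≠ 1 by omega)
    have hm0 : (0 : ℝ) < (m : ℝ) + 1 := by positivity
    have hb := one_add_mul_self_le_rpow_one_add (s := -1 / ((m : ℝ) + 1)) (p := β)
      (by rw [neg_div, neg_le_neg_iff, div_le_one hm0]; linarith [m.cast_nonneg (α := ℝ)])
      (by linarith)
    have e1 : ((m : ℝ) + 1) * (1 + -1 / ((m : ℝ) + 1)) = m := by field_simp; ring
    have e0 : 0 ≤ 1 + -1 / ((m : ℝ) + 1) := by
      have : 1 / ((m : ℝ) + 1) ≤ 1 := by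
        rw [div_le_one hm0]; linarith [m.cast_nonneg (α := ℝ)]
      rw [neg_div]; linarith
    have e2 : ((m : ℝ) + 1) ^ β - β * ((m : ℝ) + 1) ^ (β - 1) ≤ (m : ℝ) ^ β := by
      calc _ = ((m : ℝ) + 1) ^ β * (1 + β * (-1 / ((m : ℝ) + 1))) := by
            rw [Real.rpow_sub_one hm0.ne']; ring
        _ ≤ ((m : ℝ) + 1) ^ β * (1 + -1 / ((m : ℝ) + 1)) ^ β := by gcongr
        _ = _ := by rw [← Real.mul_rpow hm0.le e0, e1]
    push_cast at h4
    have e3 := mul_le_mul_of_nonneg_left e2 hC.le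
    have h6 : 0 < C * 2 ^ β * ((m : ℝ) + 1) ^ (β - 1) := by positivity
    linarith

omit hC in
/-- The number of blocks. -/
lemma sum_blockEnd_le {n M : ℕ} (hn : n < batchStart C β (M + 1)) :
    ∑ i ∈ Finset.Icc 1 n, blockEnd (blockStart C β) i ≤ (M : ℝ) + 2 := by
  have β0 : 0 < β := by linarith
  have e : ∑ i ∈ Finset.Icc 1 n, blockEnd (blockStart C β) i
      = (((Finset.Icc 1 n).filter fun i => blockStart C β (i + 1) = i + 1).card : ℝ) := by
    simp [blockEnd]
  rw [e]
  have hc : ((Finset.Icc 1 n).filter fun i => blockStart C β (i + 1) = i + 1).card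
      ≤ (Finset.range (M + 2)).card := by
    -- An index `i + 1` that starts a batch is determined by the number of that batch.
    refine Finset.card_le_card_of_injOn (fun i => batchIndex C β (i + 1)) ?_ ?_
    · intro i hi
      simp only [Finset.coe_filter, Finset.mem_Icc, Set.mem_ofPred_eq] at hi
      have := batchIndex_le β0 ha (show i + 1 ≤ batchStart C β (M + 1) by omega)
      simp only [Finset.coe_range, Set.mem_Iio]
      omega
    · intro i hi j hj hij
      simp only [Finset.coe_filter, Finset.mem_Icc, Set.mem_ofPred_eq] at hi hj
      have h1 := hi.2
      have h2 := hj.2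
      rw [blockStart_eq] at h1 h2
      simp only at hij
      rw [hij, h2] at h1
      omega
  rw [Finset.card_range] at hc
  exact_mod_cast hc

omit hC in
/-- The sum of the lengths of the cut blocks, from below. -/
lemma sum_blockLen_ge {n M : ℕ} (hM : 1 ≤ M) (hn : batchStart C β M ≤ n) :
    ((batchStart C β M : ℝ) - 1) ^ 2 ≤ 2 * M * ∑ i ∈ Finset.Icc 1 n, (blockLen C β i : ℝ) := by
  have β0 : 0 < β := by linarith
  set a : ℕ → ℕ := batchStart C β with hadef
  set l : ℕ → ℝ := fun i => (blockLen C β i : ℝ) with hl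
  -- A full batch of `g` indices contributes `1 + 2 + ⋯ + g ≥ g² / 2`.
  have block : ∀ m, ((a (m + 1) : ℝ) - a m) ^ 2 ≤ 2 * ∑ i ∈ Finset.Ico (a m) (a (m + 1)), l i := by
    intro m
    have hlt : a m ≤ a (m + 1) := (ha m.lt_succ_self).le
    rw [Finset.sum_Ico_eq_sum_range]
    have e1 : ∀ j ∈ Finset.range (a (m + 1) - a m), l (a m + j) = (j : ℝ) + 1 := by
      intro j hj
      have hj' := Finset.mem_range.1 hj
      have h1 : blockStart C β (a m + j) = a m := by
        have h2 : a m + j < a (m + 1) := by omega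
        rw [blockStart_eq, batchIndex_eq β0 ha (m := m) (Nat.le_add_right _ _) h2]
      simp only [hl, blockLen, h1]
      rw [Nat.add_sub_cancel_left]
      push_cast
      ring
    rw [Finset.sum_congr rfl e1, ← Nat.cast_sub hlt]
    generalize a (m + 1) - a m = g
    have e2 : ∀ g : ℕ, (2 : ℝ) * ∑ j ∈ Finset.range g, ((j : ℝ) + 1) = g * (g + 1) := by
      intro g
      induction g with
      | zero => simp
      | succ g ih => rw [Finset.sum_range_succ, mul_add, ih]; push_cast; ring
    rw [e2]
    nlinarith [g.cast_nonneg (α := ℝ)]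
  have total : ∀ m, 1 ≤ m → ∑ k ∈ Finset.Ico 1 m, ((a (k + 1) : ℝ) - a k) ^ 2
      ≤ 2 * ∑ i ∈ Finset.Ico 1 (a m), l i := by
    intro m hm
    induction m, hm using Nat.le_induction with
    | base => simp [hadef, batchStart_one]
    | succ m hm ih =>
      have h1 : 1 ≤ a m := hm.trans ha.le_apply
      rw [Finset.sum_Ico_succ_top hm, ← Finset.sum_Ico_consecutive l h1 (ha m.lt_succ_self).le,
        mul_add]
      exact add_le_add ih (block m)
  have tele : ∑ k ∈ Finset.Ico 1 M, ((a (k + 1) : ℝ) - a k) = (a M : ℝ) - 1 := by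
    rw [Finset.sum_Ico_sub (fun k => (a k : ℝ)) hM]
    simp [hadef, batchStart_one]
  -- Cauchy-Schwarz over the `M - 1` batch lengths, which add up to `a_M - 1`.
  have cs := sq_sum_le_card_mul_sum_sq (s := Finset.Ico 1 M) (f := fun k => (a (k + 1) : ℝ) - a k)
  rw [tele, Nat.card_Ico] at cs
  have hsub : ∑ i ∈ Finset.Ico 1 (a M), l i ≤ ∑ i ∈ Finset.Icc 1 n, l i := by
    refine Finset.sum_le_sum_of_subset_of_nonneg (fun i hi => ?_) fun _ _ _ => Nat.cast_nonneg _
    simp only [Finset.mem_Ico, Finset.mem_Icc] at hi ⊢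
    omega
  have hM' : ((M - 1 : ℕ) : ℝ) ≤ M := by exact_mod_cast Nat.sub_le M 1
  have hpos : 0 ≤ ∑ k ∈ Finset.Ico 1 M, ((a (k + 1) : ℝ) - a k) ^ 2 :=
    Finset.sum_nonneg fun _ _ => sq_nonneg _
  calc ((a M : ℝ) - 1) ^ 2 ≤ ((M - 1 : ℕ) : ℝ) * ∑ k ∈ Finset.Ico 1 M, ((a (k + 1) : ℝ) - a k) ^ 2 := cs
    _ ≤ M * (2 * ∑ i ∈ Finset.Icc 1 n, l i) := by
        refine mul_le_mul hM' ((total M hM).trans ?_) hpos (by positivity)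
        linarith
    _ = _ := by ring

/-- The orders of the quantities that describe the batches. -/
lemma exists_batch_orders : ∃ c : ℝ, 1 ≤ c ∧ ∀ᶠ M : ℕ in atTop, ∀ n : ℕ,
    batchStart C β M ≤ n → n < batchStart C β (M + 1) →
    ∃ lam : ℕ, 1 ≤ n ∧ (∀ i ≤ n + 1, blockLen C β i ≤ lam) ∧
      (lam : ℝ) ≤ c * (M : ℝ) ^ (β - 1) ∧ (n : ℝ) ≤ c * (M : ℝ) ^ β ∧
      (∑ i ∈ Finset.Icc 1 n, (blockLen C β i : ℝ))⁻¹ ≤ c * (M : ℝ) ^ (1 - 2 * β) := by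
  have β0 : 0 < β := by linarith
  obtain ⟨c1, hc1, hlen⟩ := exists_batch_length_le hC hβ
  have hbig : ∀ᶠ M : ℕ in atTop, 4 ≤ C * (M : ℝ) ^ β := by
    have : Tendsto (fun M : ℕ => C * (M : ℝ) ^ β) atTop atTop :=
      ((tendsto_rpow_atTop β0).comp tendsto_natCast_atTop_atTop).const_mul_atTop hC
    exact this.eventually_ge_atTop 4
  set c := 1 + c1 * 3 ^ (β - 1) + C * 2 ^ β + 8 / C ^ 2 with hc
  have p1 : 0 < c1 * 3 ^ (β - 1) := by positivity
  have p2 : 0 < C * 2 ^ β := by positivity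
  have p3 : 0 < 8 / C ^ 2 := by positivity
  refine ⟨c, by linarith, ?_⟩
  filter_upwards [hbig, eventually_ge_atTop 2] with M hM4 hM2 n hn1 hn2
  have hM1 : (2 : ℝ) ≤ M := by exact_mod_cast hM2
  have hM0 : (0 : ℝ) < M := by linarith
  have hn : 1 ≤ n := le_trans (le_trans (by omega) (ha.le_apply (x := M))) hn1
  -- The bound must hold up to `n + 1`, which may open batch `M + 1`; hence `M + 2` in place of `M +
  -- 1`.
  refine ⟨⌊c1 * ((M : ℝ) + 2) ^ (β - 1)⌋₊, hn, fun i hi => ?_, ?_, ?_, ?_⟩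
  · refine Nat.le_floor ?_
    have h1 := batchIndex_le β0 ha (show i ≤ batchStart C β (M + 1) by omega)
    have h2 := lt_batchStart_batchIndex_succ ha i
    have h3 := batchStart_batchIndex_le (C := C) β0 i
    have h4 : (blockLen C β i : ℝ) ≤ batchStart C β (batchIndex C β i + 1)
        - batchStart C β (batchIndex C β i) := by
      have hlt : batchStart C β (batchIndex C β i) ≤ batchStart C β (batchIndex C β i + 1) :=
        (ha (Nat.lt_succ_self _)).le
      rw [← Nat.cast_sub hlt]
      unfold blockLen
      rw [blockStart_eq]
      exact_mod_cast (by omega)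
    refine h4.trans ((hlen _).trans ?_)
    have h5 : (batchIndex C β i : ℝ) + 1 ≤ (M : ℝ) + 2 := by
      have : (batchIndex C β i : ℝ) ≤ ((M + 1 : ℕ) : ℝ) := by exact_mod_cast h1
      push_cast at this; linarith
    have : 0 ≤ β - 1 := by linarith
    gcongr
  · refine (Nat.floor_le (by positivity)).trans ?_
    have : 0 ≤ β - 1 := by linarith
    calc c1 * ((M : ℝ) + 2) ^ (β - 1) ≤ c1 * (3 * (M : ℝ)) ^ (β - 1) := by gcongr; linarith
      _ = c1 * 3 ^ (β - 1) * (M : ℝ) ^ (β - 1) := by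
          rw [Real.mul_rpow (by norm_num) hM0.le]; ring
      _ ≤ _ := by gcongr; linarith
  · have h1 : (n : ℝ) ≤ batchStart C β (M + 1) := by exact_mod_cast hn2.le
    have h2 := batchStart_le (β := β) hC (show M + 1 ≠ 1 by omega)
    calc (n : ℝ) ≤ C * ((M + 1 : ℕ) : ℝ) ^ β := h1.trans h2
      _ ≤ C * (2 * (M : ℝ)) ^ β := by gcongr; push_cast; linarith
      _ = C * 2 ^ β * (M : ℝ) ^ β := by rw [Real.mul_rpow (by norm_num) hM0.le]; ring
      _ ≤ _ := by gcongr; linarith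
  · have h1 := sum_blockLen_ge hβ ha (show 1 ≤ M by omega) hn1
    have h2 := le_batchStart (C := C) (β := β) (show M ≠ 1 by omega)
    set Λ := ∑ i ∈ Finset.Icc 1 n, (blockLen C β i : ℝ)
    have h3 : (C * (M : ℝ) ^ β / 2) ^ 2 ≤ 2 * M * Λ := by
      refine le_trans (pow_le_pow_left₀ (by positivity) ?_ 2) h1
      linarith
    have h4 : (M : ℝ) ^ (2 * β - 1) * M = (M : ℝ) ^ β * (M : ℝ) ^ β := by
      rw [Real.rpow_sub_one hM0.ne', div_mul_cancel₀ _ hM0.ne', ← Real.rpow_add hM0, two_mul]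
    have h5 : C ^ 2 / 8 * (M : ℝ) ^ (2 * β - 1) ≤ Λ := by
      have : M * (C ^ 2 / 8 * (M : ℝ) ^ (2 * β - 1)) ≤ M * Λ := by
        calc M * (C ^ 2 / 8 * (M : ℝ) ^ (2 * β - 1))
            = C ^ 2 / 8 * ((M : ℝ) ^ (2 * β - 1) * M) := by ring
          _ = (C * (M : ℝ) ^ β / 2) ^ 2 / 2 := by rw [h4]; ring
          _ ≤ _ := by linarith
      exact le_of_mul_le_mul_left this hM0
    calc Λ⁻¹ ≤ (C ^ 2 / 8 * (M : ℝ) ^ (2 * β - 1))⁻¹ := inv_anti₀ (by positivity) h5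
      _ = 8 / C ^ 2 * (M : ℝ) ^ (1 - 2 * β) := by
          rw [show 1 - 2 * β = -(2 * β - 1) by ring, Real.rpow_neg hM0.le, mul_inv, inv_div]
      _ ≤ _ := by gcongr; linarith

end Batches

/-! ### Comparison of exponents with the claimed rate. -/

section Rates

lemma monomial_le {c x l n b w β p q r : ℝ} (hc : 1 ≤ c) (hx : 0 < x) (hl0 : 0 ≤ l)
    (hl : l ≤ c * x ^ (β - 1)) (hn0 : 0 ≤ n) (hn : n ≤ c * x ^ β) (hb0 : 0 ≤ b) (hb : b ≤ c * x)
    (hw : w ≤ c * x ^ (1 - 2 * β)) (hp : 0 ≤ p) (hq : 0 ≤ q) (hr : 0 ≤ r) :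
    w * (l ^ p * n ^ q * b ^ r)
      ≤ c ^ (1 + p + q + r) * x ^ (p * (β - 1) + q * β + r + 1 - 2 * β) := by
  have hc0 : 0 < c := by linarith
  calc w * (l ^ p * n ^ q * b ^ r)
      ≤ (c * x ^ (1 - 2 * β)) * ((c * x ^ (β - 1)) ^ p * (c * x ^ β) ^ q * (c * x) ^ r) := by
        gcongr
    _ = (c * c ^ p * c ^ q * c ^ r)
        * (x ^ (1 - 2 * β) * x ^ ((β - 1) * p) * x ^ (β * q) * x ^ r) := by
        rw [Real.mul_rpow hc0.le (by positivity), Real.mul_rpow hc0.le (by positivity),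
          Real.mul_rpow hc0.le hx.le, ← Real.rpow_mul hx.le, ← Real.rpow_mul hx.le]
        ring
    _ = _ := by
        rw [← Real.rpow_add hx, ← Real.rpow_add hx, ← Real.rpow_add hx, Real.rpow_add hc0,
          Real.rpow_add hc0, Real.rpow_add hc0, Real.rpow_one]
        congr 2
        ring

/-- The mechanism that removes `ν`-dependent constants: a strictly smaller exponent absorbs any
constant once `M` is large. -/
lemma eventually_const_mul_rpow_le (K : ℝ) {e e' : ℝ} (h : e < e') {ε : ℝ} (hε : 0 < ε) :
    ∀ᶠ M : ℕ in atTop, K * (M : ℝ) ^ e ≤ ε * (M : ℝ) ^ e' := by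
  have t : Tendsto (fun M : ℕ => K * (M : ℝ) ^ (-(e' - e))) atTop (𝓝 0) := by
    simpa using ((tendsto_rpow_neg_atTop (sub_pos.2 h)).comp
      tendsto_natCast_atTop_atTop).const_mul K
  filter_upwards [t.eventually_le_const hε, eventually_gt_atTop 0] with M hM hM0
  have hM0' : (0 : ℝ) < M := by exact_mod_cast hM0
  calc K * (M : ℝ) ^ e = K * (M : ℝ) ^ (-(e' - e)) * (M : ℝ) ^ e' := by
        rw [mul_assoc, ← Real.rpow_add hM0']; congr 2; ring
    _ ≤ _ := by gcongr

variable {C β α : ℝ}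

set_option maxHeartbeats 1000000 in
-- `k0` is chosen before `K`: the leading term keeps a universal constant, while an arbitrary `K` in
-- front of `rest` only affects how large `M` must be.
lemma exists_batch_bounds (hC : 0 < C) (ha : StrictMono (batchStart C β)) (h0 : 1 / 2 < α)
    (h1 : α < 1) (hβ : 1 / (1 - α) < β) :
    ∃ k0 : ℝ, 0 < k0 ∧ ∀ K : ℝ, 0 ≤ K → ∀ᶠ M : ℕ in atTop, ∀ n : ℕ,
      batchStart C β M ≤ n → n < batchStart C β (M + 1) →
      ∃ lam : ℕ, 1 ≤ n ∧ (∀ i ≤ n + 1, blockLen C β i ≤ lam) ∧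
        (∑ i ∈ Finset.Icc 1 n, (blockLen C β i : ℝ))⁻¹ * (lam * √lam * √n)
          ≤ k0 * (M : ℝ) ^ (-(1 / 2 : ℝ)) ∧
        (∑ i ∈ Finset.Icc 1 n, (blockLen C β i : ℝ))⁻¹ * (K * rest α lam n ((M : ℝ) + 2))
          ≤ (M : ℝ) ^ (-(1 / 2 : ℝ)) + (M : ℝ) ^ (-(α * β / 4))
            + (M : ℝ) ^ (((α - 1) * β + 1) / 2) := by
  have hα1 : 0 < 1 - α := by linarith
  have hβ1 : 1 < β * (1 - α) := by rwa [div_lt_iff₀ hα1] at hβ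
  have hβ2 : 2 < β := by nlinarith
  obtain ⟨c0, hc0, hord⟩ := exists_batch_orders hC hβ2 ha
  set c := c0 + 4 with hc
  have hc1 : 1 ≤ c := by linarith
  refine ⟨c ^ (1 + 3 / 2 + 1 / 2 + 0 : ℝ), by positivity, fun K hK => ?_⟩
  have t : (0 : ℝ) < 1 / 10 := by norm_num
  -- `p`, `q`, `r` are the exponents of `lam`, `n` and `1 + Nb` in a term of `rest`, and `e` is the
  -- target exponent. Each of the ten terms may take a tenth of one target power.
  have g := fun (p q r e : ℝ) (h : p * (β - 1) + q * β + r + 1 - 2 * β < e) =>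
    eventually_const_mul_rpow_le (K * c ^ (1 + p + q + r)) h t
  have hαβ : 1 < α * β := by nlinarith
  -- Makes `lam^(3/2) n^(1 - α)` strictly smaller than the leading `lam^(3/2) n^(1/2)`.
  have hαh : 0 < (α - 1 / 2) * β := mul_pos (by linarith) (by linarith)
  filter_upwards [hord, eventually_ge_atTop 1,
    g 1 (1 - α / 2) 0 (-(α * β / 4)) (by linarith),
    g 2 0 0 (-(1 / 2)) (by linarith),
    g 0 (1 + α) 0 (((α - 1) * β + 1) / 2) (by linarith),
    g (3 / 2) (1 - α) 0 (-(1 / 2)) (by linarith),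
    g (3 / 2) (α / 2) 0 (-(1 / 2)) (by linarith),
    g 1 ((1 + α) / 2) 0 (((α - 1) * β + 1) / 2) (by linarith),
    g (1 / 2) (3 * α / 2) 1 (((α - 1) * β + 1) / 2) (by linarith),
    g 0 ((1 + 3 * α) / 2) 0 (((α - 1) * β + 1) / 2) (by linarith),
    g (1 / 2) 1 0 (-(1 / 2)) (by linarith),
    g (1 / 2) (α + 1 / 2) 0 (((α - 1) * β + 1) / 2) (by linarith)]
    with M hM hM1 e1 e2 e3 e4 e5 e6 e7 e8 e9 e10 n hn1 hn2
  obtain ⟨lam, hn, hlam, b1, b2, b3⟩ := hM n hn1 hn2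
  have hM1' : (1 : ℝ) ≤ M := by exact_mod_cast hM1
  have hx : (0 : ℝ) < M := by linarith
  refine ⟨lam, hn, hlam, ?_, ?_⟩
  all_goals
    set w := (∑ i ∈ Finset.Icc 1 n, (blockLen C β i : ℝ))⁻¹
    have b1' : (lam : ℝ) ≤ c * (M : ℝ) ^ (β - 1) := b1.trans (by gcongr; linarith)
    have b2' : (n : ℝ) ≤ c * (M : ℝ) ^ β := b2.trans (by gcongr; linarith)
    have b3' : w ≤ c * (M : ℝ) ^ (1 - 2 * β) := b3.trans (by gcongr; linarith)
    have b4' : 1 + ((M : ℝ) + 2) ≤ c * M := by nlinarith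
    have m := fun (p q r : ℝ) (hp : 0 ≤ p) (hq : 0 ≤ q) (hr : 0 ≤ r) =>
      monomial_le hc1 hx (Nat.cast_nonneg lam) b1' (Nat.cast_nonneg n) b2'
        (by positivity : 0 ≤ 1 + ((M : ℝ) + 2)) b4' b3' hp hq hr
    have hs : √(lam : ℝ) = (lam : ℝ) ^ (1 / 2 : ℝ) := Real.sqrt_eq_rpow _
    have hs3 : (lam : ℝ) * √lam = (lam : ℝ) ^ (3 / 2 : ℝ) := by
      rw [hs, show (3 / 2 : ℝ) = 1 + 1 / 2 by norm_num,
        Real.rpow_add_of_nonneg (Nat.cast_nonneg _) zero_le_one (by norm_num), Real.rpow_one]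
  · have h := m (3 / 2) (1 / 2) 0 (by norm_num) (by norm_num) le_rfl
    rw [Real.rpow_zero, mul_one, ← hs3, ← Real.sqrt_eq_rpow] at h
    refine h.trans (le_of_eq ?_)
    congr 2; ring
  · have f : ∀ (p q r e : ℝ), 0 ≤ p → 0 ≤ q → 0 ≤ r →
        K * c ^ (1 + p + q + r) * (M : ℝ) ^ (p * (β - 1) + q * β + r + 1 - 2 * β)
          ≤ 1 / 10 * (M : ℝ) ^ e →
        w * (K * ((lam : ℝ) ^ p * (n : ℝ) ^ q * (1 + ((M : ℝ) + 2)) ^ r))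
          ≤ 1 / 10 * (M : ℝ) ^ e := by
      intro p q r e hp hq hr h
      refine le_trans (le_of_eq_of_le ?_ (mul_le_mul_of_nonneg_left (m p q r hp hq hr) hK)) (h.trans' (le_of_eq ?_))
      · ring
      · ring
    have f1 := f _ _ _ _ (by linarith) (by linarith) (by linarith) e1
    have f2 := f _ _ _ _ (by linarith) (by linarith) (by linarith) e2
    have f3 := f _ _ _ _ (by linarith) (by linarith) (by linarith) e3
    have f4 := f _ _ _ _ (by linarith) (by linarith) (by linarith) e4
    have f5 := f _ _ _ _ (by linarith) (by linarith) (by linarith) e5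
    have f6 := f _ _ _ _ (by linarith) (by linarith) (by linarith) e6
    have f7 := f _ _ _ _ (by linarith) (by linarith) (by linarith) e7
    have f8 := f _ _ _ _ (by linarith) (by linarith) (by linarith) e8
    have f9 := f _ _ _ _ (by linarith) (by linarith) (by linarith) e9
    have f10 := f _ _ _ _ (by linarith) (by linarith) (by linarith) e10
    simp only [Real.rpow_zero, Real.rpow_one, mul_one, one_mul, ← hs3, ← hs, Real.rpow_two] at f1 f2 f3 f4 f5 f6 f7 f8 f9 f10
    have u1 : 0 ≤ (M : ℝ) ^ (-(1 / 2 : ℝ)) := by positivity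
    have u2 : 0 ≤ (M : ℝ) ^ (-(α * β / 4)) := by positivity
    have u3 : 0 ≤ (M : ℝ) ^ (((α - 1) * β + 1) / 2) := by positivity
    unfold rest
    linarith

end Rates


/-! ### The rate, and the conclusion. -/

section Rate

variable {d : ℕ} {Z : Type*} [MeasurableSpace Z] {F : Vec d → Z → ℝ} {Q : Measure Z} {L : ℝ}
  {H : Z → ℝ} {α β ν : ℝ} {y : Vec d}

lemma sigma1_nonneg : 0 ≤ sigma1 F Q H ν y := by unfold sigma1; positivity

/-- All three coefficients of the rate are at least `1`, and `(1 + ν)² ≤ 2(1 + ν²) ≤ 4√(1 + ν² +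
ν⁴)`. Thus the growth in `ν` of the leading term is carried by the coefficient of `M^(-1/2)`. -/
lemma le_rate (hL : 0 ≤ L) (hν : 0 < ν) {c k : ℝ} (hc : 0 ≤ c) (hk : 0 ≤ k) (M : ℕ) :
    c * (1 + ν) ^ 2 * (k * (M : ℝ) ^ (-(1 / 2 : ℝ)))
      + ((M : ℝ) ^ (-(1 / 2 : ℝ)) + (M : ℝ) ^ (-(α * β / 4)) + (M : ℝ) ^ (((α - 1) * β + 1) / 2))
      ≤ (4 * c * k + 1) * rate F Q L H α β ν y M := by
  have hs := sigma1_nonneg (F := F) (Q := Q) (H := H) (ν := ν) (y := y)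
  have hd : 0 ≤ constCd F Q L H ν y := hL.trans (le_max_left _ _)
  have u1 : 0 ≤ (M : ℝ) ^ (-(1 / 2 : ℝ)) := by positivity
  have u2 : 0 ≤ (M : ℝ) ^ (-(α * β / 4)) := by positivity
  have u3 : 0 ≤ (M : ℝ) ^ (((α - 1) * β + 1) / 2) := by positivity
  have s1 : 1 ≤ √(1 + sigma1 F Q H ν y + constCd F Q L H ν y ^ 3 + ν
      + (ν + ν ^ 2 + ν ^ 3) * sigma1 F Q H ν y) := by
    refine Real.one_le_sqrt.2 ?_
    have : 0 ≤ constCd F Q L H ν y ^ 3 := by positivity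
    have : 0 ≤ (ν + ν ^ 2 + ν ^ 3) * sigma1 F Q H ν y := by positivity
    linarith
  have s3 : 1 ≤ √(1 + ν + ν ^ 2) := Real.one_le_sqrt.2 (by nlinarith)
  have s2 : (1 + ν) ^ 2 ≤ 4 * √(1 + ν ^ 2 + ν ^ 4) := by
    have : (1 + ν ^ 2) / 2 ≤ √(1 + ν ^ 2 + ν ^ 4) := Real.le_sqrt_of_sq_le (by nlinarith [sq_nonneg (ν ^ 2)])
    nlinarith [sq_nonneg (1 - ν)]
  have s2' : 1 ≤ √(1 + ν ^ 2 + ν ^ 4) := Real.one_le_sqrt.2 (by nlinarith [sq_nonneg (ν ^ 2)])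
  unfold rate
  set A := √(1 + sigma1 F Q H ν y + constCd F Q L H ν y ^ 3 + ν
      + (ν + ν ^ 2 + ν ^ 3) * sigma1 F Q H ν y)
  set B := √(1 + ν ^ 2 + ν ^ 4)
  set D := √(1 + ν + ν ^ 2)
  set p1 := (M : ℝ) ^ (-(1 / 2 : ℝ))
  set p2 := (M : ℝ) ^ (-(α * β / 4))
  set p3 := (M : ℝ) ^ (((α - 1) * β + 1) / 2)
  have q1 : c * (1 + ν) ^ 2 * (k * p1) ≤ 4 * c * k * (B * p1) := by
    calc c * (1 + ν) ^ 2 * (k * p1) ≤ c * (4 * B) * (k * p1) := by gcongr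
      _ = _ := by ring
  have q2 : p1 ≤ B * p1 := le_mul_of_one_le_left u1 s2'
  have q3 : p2 ≤ A * p2 := le_mul_of_one_le_left u2 s1
  have q4 : p3 ≤ D * p3 := le_mul_of_one_le_left u3 s3
  have q5 : 0 ≤ 4 * c * k * (A * p2 + D * p3) := by positivity
  linarith

lemma tendsto_rate (h0 : 0 < α) (h1 : α < 1) (hβ : 1 / (1 - α) < β) :
    Tendsto (fun M : ℕ => rate F Q L H α β ν y M) atTop (𝓝 0) := by
  have hα1 : 0 < 1 - α := by linarith
  have hβ1 : 1 < β * (1 - α) := by rwa [div_lt_iff₀ hα1] at hβ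
  have hβ0 : 0 < β := lt_trans (by positivity) hβ
  have t : ∀ e : ℝ, e < 0 → Tendsto (fun M : ℕ => (M : ℝ) ^ e) atTop (𝓝 0) := fun e he => by
    have := (tendsto_rpow_neg_atTop (neg_pos.2 he)).comp (tendsto_natCast_atTop_atTop (R := ℝ))
    simpa [Function.comp_def] using this
  have h := (((t (-(α * β / 4)) (by have := mul_pos h0 hβ0; linarith)).const_mul
      (√(1 + sigma1 F Q H ν y + constCd F Q L H ν y ^ 3 + ν
        + (ν + ν ^ 2 + ν ^ 3) * sigma1 F Q H ν y))).add
    ((t (-(1 / 2)) (by norm_num)).const_mul (√(1 + ν ^ 2 + ν ^ 4)))).add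
    ((t (((α - 1) * β + 1) / 2) (by linarith)).const_mul (√(1 + ν + ν ^ 2)))
  simp only [mul_zero, add_zero] at h
  exact h

end Rate

lemma tendsto_batchIndex {C β : ℝ} (ha : StrictMono (batchStart C β)) :
    Tendsto (batchIndex C β) atTop atTop := by
  refine tendsto_atTop.2 fun m => ?_
  filter_upwards [eventually_ge_atTop (batchStart C β m)] with n hn
  have := ha.lt_iff_lt.1 (lt_of_le_of_lt hn (lt_batchStart_batchIndex_succ ha n))
  omega

lemma tendstoInMeasure_of_integral {E Ω : Type*} [NormedAddCommGroup E] {mΩ : MeasurableSpace Ω}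
    {P : Measure Ω} {X : ℕ → Ω → E} {a : E} (hX : ∀ n, AEStronglyMeasurable (X n) P)
    (hi : ∀ n, Integrable (fun ω => ‖X n ω - a‖) P)
    (h : Tendsto (fun n => ∫ ω, ‖X n ω - a‖ ∂P) atTop (𝓝 0)) :
    TendstoInMeasure P X atTop fun _ => a := by
  refine tendstoInMeasure_of_tendsto_eLpNorm one_ne_zero hX aestronglyMeasurable_const ?_
  have e : ∀ n, eLpNorm (X n - fun _ => a) 1 P = ENNReal.ofReal (∫ ω, ‖X n ω - a‖ ∂P) := by
    intro n
    rw [eLpNorm_one_eq_lintegral_enorm,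
      ofReal_integral_eq_lintegral_ofReal (hi n) (ae_of_all _ fun _ => norm_nonneg _)]
    exact lintegral_congr fun ω => (ofReal_norm _).symm
  simp only [e]
  simpa using ENNReal.tendsto_ofReal h

section Main

variable {d : ℕ} {Z Ω : Type*} [MeasurableSpace Z] {mΩ : MeasurableSpace Ω} {P : Measure Ω}
  {Q : Measure Z} [IsProbabilityMeasure P] [IsProbabilityMeasure Q] {F : Vec d → Z → ℝ}
  {H : Z → ℝ} {σ μ L : ℝ} {xstar xν : Vec d} {ζ : ℕ → Ω → Z} {u : ℕ → Ω → Vec d} {x0 : Vec d}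
  {η α β C c0 ν : ℝ}

/-- The error bound is used only for integrability, so crude parameters suffice: no cut block
exceeds `n + 2` indices, and `Nb` is the sum itself. For `n = 0` the estimator is constant. -/
lemma integrable_norm_covEst_sub (ho : UnbiasedOracle F Q σ)
    (hc : SmoothStronglyConvex (objective F Q) μ L) (hn : GradientNoise F Q xstar)
    (hh : HessianEnvelope F Q H) (hx : MemLp (gradF F xstar) 4 Q) (hi : IIDInputs P Q ζ u)
    (hη : 0 < η) (h0 : 1 / 2 < α) (h1 : α < 1) (hb : Blocks (blockStart C β) c0) (hν : 0 < ν)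
    (hxν : smoothGrad (objective F Q) ν xν = 0) (n : ℕ) :
    Integrable (fun ω => ‖covEst C β (fun i => iterate F ν η α x0 ζ u i ω) n
      - asympCov F Q ν xν‖) P := by
  rcases Nat.eq_zero_or_pos n with rfl | hn1
  · simp [covEst]
  · obtain ⟨K, -, hK⟩ := exists_l1le_covEst_iterate (x0 := x0) ho hc hn hh hx hi hη h0 h1 hb hν hxν
    refine (hK n (n + 2) (∑ i ∈ Finset.Icc 1 n, blockEnd (blockStart C β) i)
      (Finset.sum_nonneg fun i _ => blockEnd_nonneg _ i) hn1 (fun i hi => ?_) le_rfl).1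
    unfold blockLen
    omega

/-- The mean error of the covariance estimator along the batches. -/
theorem exists_mean_error_le (hmin : ∀ y, objective F Q xstar ≤ objective F Q y)
    (ho : UnbiasedOracle F Q σ)
    (hc : SmoothStronglyConvex (objective F Q) μ L) (hn : GradientNoise F Q xstar)
    (hh : HessianEnvelope F Q H) (hx : MemLp (gradF F xstar) 4 Q) (hi : IIDInputs P Q ζ u)
    (hη : 0 < η) (h0 : 1 / 2 < α) (h1 : α < 1) (hβ : 1 / (1 - α) < β) (hC : 0 < C)
    (ha : StrictMono (batchStart C β)) :
    ∃ K : ℝ, 0 < K ∧ ∀ ν : ℝ, 0 < ν → ∀ y, smoothGrad (objective F Q) ν y = 0 →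
      ∀ᶠ M : ℕ in atTop, ∀ n : ℕ, batchStart C β M ≤ n → n < batchStart C β (M + 1) →
        ∫ ω, ‖covEst C β (fun i => iterate F ν η α x0 ζ u i ω) n - asympCov F Q ν y‖ ∂P
          ≤ K * rate F Q L H α β ν y M := by
  have hα1 : 0 < 1 - α := by linarith
  have hβ2 : 2 < β := lt_trans (by rw [lt_div_iff₀ hα1]; linarith) hβ
  obtain ⟨c0, hb⟩ := exists_blocks hC hβ2 ha
  obtain ⟨k0, hk0, hbounds⟩ := exists_batch_bounds hC ha h0 h1 hβ
  have hL := hc.L_pos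
  have hμ := hc.mu_pos
  obtain ⟨K1, hK1, hmom⟩ := integral_norm_gradEst_pow_le ho hn hh hx
    (show 0 ≤ L * gaussMean d / μ by have := gaussMean_nonneg d; positivity)
  set c := 42 * (d : ℝ) ^ 2 / μ ^ 2 * √K1 with hcdef
  have hc0 : 0 ≤ c := by positivity
  refine ⟨4 * c * k0 + 1, by positivity, fun ν hν y hy => ?_⟩
  obtain ⟨K, hK, hest⟩ := exists_l1le_covEst_iterate (x0 := x0) ho hc hn hh hx hi hη h0 h1 hb hν hy
  -- `K` depends on `ν`, but it enters after the final constant is fixed, so it only determines how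
  -- large `M` must be.
  filter_upwards [hbounds K hK] with M hM n hn1 hn2
  obtain ⟨lam, hn0, hlam, b1, b2⟩ := hM n hn1 hn2
  have h := (hest n lam (M + 2) (by positivity) hn0 hlam (sum_blockEnd_le hβ2 ha hn2)).2
  simp only [abs_norm] at h
  refine h.trans (le_trans ?_ (le_rate hL.le hν hc0 hk0.le M))
  have hm := hmom ν hν y (hc.norm_sub_min_le hν.le (gradient_eq_zero_of_min hc hmin) hy)
  have hs : √(∫ p, ‖gradEst F ν y p.1 p.2‖ ^ 4 ∂(noiseLaw d Q)) ≤ √K1 * (1 + ν) ^ 2 := by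
    refine (Real.sqrt_le_sqrt hm).trans (le_of_eq ?_)
    rw [Real.sqrt_mul hK1.le, show (1 + ν) ^ 4 = ((1 + ν) ^ 2) ^ 2 by ring,
      Real.sqrt_sq (by positivity)]
  rw [mul_add]
  refine add_le_add ?_ b2
  calc _ = 42 * (d : ℝ) ^ 2 / μ ^ 2 * √(∫ p, ‖gradEst F ν y p.1 p.2‖ ^ 4 ∂(noiseLaw d Q))
        * ((∑ i ∈ Finset.Icc 1 n, (blockLen C β i : ℝ))⁻¹ * (lam * √lam * √n)) := by ring
    _ ≤ 42 * (d : ℝ) ^ 2 / μ ^ 2 * (√K1 * (1 + ν) ^ 2) * (k0 * (M : ℝ) ^ (-(1 / 2 : ℝ))) := by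
        gcongr
    _ = _ := by rw [hcdef]; ring

end Main

end ZOSGD

theorem theorem1 {d : ℕ} {Z Ω : Type*} [MeasurableSpace Z] [MeasurableSpace Ω]
    (P : Measure Ω) [IsProbabilityMeasure P] (Q : Measure Z) [IsProbabilityMeasure Q]
    (F : ZOSGD.Vec d → Z → ℝ) (H : Z → ℝ) (σ μ L : ℝ) (xstar : ZOSGD.Vec d)
    (hmin : ∀ y, ZOSGD.objective F Q xstar ≤ ZOSGD.objective F Q y)
    (horacle : ZOSGD.UnbiasedOracle F Q σ)
    (hconvex : ZOSGD.SmoothStronglyConvex (ZOSGD.objective F Q) μ L)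
    (hnoise : ZOSGD.GradientNoise F Q xstar)
    (hhess : ZOSGD.HessianEnvelope F Q H)
    (hfourth : MemLp (ZOSGD.gradF F xstar) 4 Q)
    (ζ : ℕ → Ω → Z) (u : ℕ → Ω → ZOSGD.Vec d) (hinputs : ZOSGD.IIDInputs P Q ζ u)
    (x0 : ZOSGD.Vec d) (η α β C : ℝ) (hη : 0 < η) (hα : 1 / 2 < α) (hα' : α < 1)
    (hβ : 1 / (1 - α) < β) (hC : 0 < C) (hbatch : StrictMono (ZOSGD.batchStart C β)) :
    ∃ K : ℝ, 0 < K ∧ ∀ ν : ℝ, 0 < ν → ∃ xν : ZOSGD.Vec d,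
      (∀ y, y ≠ xν → ZOSGD.surrogate F Q ν xν < ZOSGD.surrogate F Q ν y) ∧
      (∀ n, Integrable (fun ω => ‖ZOSGD.covEst C β
          (fun i => ZOSGD.iterate F ν η α x0 ζ u i ω) n - ZOSGD.asympCov F Q ν xν‖) P) ∧
      (∀ᶠ M : ℕ in atTop, ∀ n : ℕ,
        ZOSGD.batchStart C β M ≤ n → n < ZOSGD.batchStart C β (M + 1) →
        ∫ ω, ‖ZOSGD.covEst C β (fun i => ZOSGD.iterate F ν η α x0 ζ u i ω) n
            - ZOSGD.asympCov F Q ν xν‖ ∂P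
          ≤ K * ZOSGD.rate F Q L H α β ν xν M) ∧
      Tendsto (fun n => ∫ ω, ‖ZOSGD.covEst C β
          (fun i => ZOSGD.iterate F ν η α x0 ζ u i ω) n - ZOSGD.asympCov F Q ν xν‖ ∂P)
        atTop (𝓝 0) ∧
      TendstoInMeasure P (fun n ω => ZOSGD.covEst C β
          (fun i => ZOSGD.iterate F ν η α x0 ζ u i ω) n) atTop
        (fun _ => ZOSGD.asympCov F Q ν xν) := by
  have hα1 : 0 < 1 - α := by linarith
  have hβ2 : 2 < β := lt_trans (by rw [lt_div_iff₀ hα1]; linarith) hβ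
  obtain ⟨c0, hb⟩ := ZOSGD.exists_blocks hC hβ2 hbatch
  obtain ⟨K, hK, hbound⟩ := ZOSGD.exists_mean_error_le (x0 := x0) hmin horacle hconvex hnoise hhess
    hfourth hinputs hη hα hα' hβ hC hbatch
  refine ⟨K, hK, fun ν hν => ?_⟩
  obtain ⟨y, hy⟩ := hconvex.exists_smooth_min ν
  have hint := ZOSGD.integrable_norm_covEst_sub (x0 := x0) horacle hconvex hnoise hhess hfourth
    hinputs hη hα hα' hb hν hy
  have hlim : Tendsto (fun n => ∫ ω, ‖ZOSGD.covEst C β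
      (fun i => ZOSGD.iterate F ν η α x0 ζ u i ω) n - ZOSGD.asympCov F Q ν y‖ ∂P)
      atTop (𝓝 0) := by
    -- Every `n` lies in the batch numbered `batchIndex n`, which tends to infinity, so a rate in
    -- `M` gives convergence in `n`.
    have t := ZOSGD.tendsto_batchIndex hbatch
    have hr := ((ZOSGD.tendsto_rate (F := F) (Q := Q) (L := L) (H := H) (ν := ν) (y := y)
      (by linarith) hα' hβ).const_mul K).comp t
    rw [mul_zero] at hr
    refine squeeze_zero' (Eventually.of_forall fun n => integral_nonneg fun ω => norm_nonneg _)
      ?_ hr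
    filter_upwards [t.eventually (hbound ν hν y hy)] with n hn
    exact hn n (ZOSGD.batchStart_batchIndex_le (by linarith) n)
      (ZOSGD.lt_batchStart_batchIndex_succ hbatch n)
  refine ⟨y, fun z hz => ?_, hint, hbound ν hν y hy, hlim,
    ZOSGD.tendstoInMeasure_of_integral (fun n => (ZOSGD.measurable_covEst_iterate horacle hconvex
      hnoise hhess hfourth hinputs hν hy n).aestronglyMeasurable) hint hlim⟩
  rw [ZOSGD.surrogate_eq_smooth horacle hnoise hhess hν]
  exact hconvex.smooth_lt hy hz
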